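/- **Setting.** Let $F$ be a totally real number field, $e=[F:\mathbb{Q}]$, and let $D$ be either $F$ itself (type I; put $d=1$) or a division quaternion algebra with centre $F$ which is totally indefinite, i.e. $D\otimes_{\mathbb{Q}}\mathbb{R}\cong \mathrm{M}_2(\mathbb{R})^e$ (type II; put $d=2$). Let $\mathrm{Trd}_{D/\mathbb{Q}}=\mathrm{Tr}_{F/\mathbb{Q}}\circ\mathrm{Trd}_{D/F}$ be the reduced trace and $\mathrm{Tr}_{D/\mathbb{Q}}$ the non-reduced trace. Let $\dagger$ be a positive involution of $D$: $(ab)^\dagger=b^\dagger a^\dagger$, $a^{\dagger\dagger}=a$, and $\mathrm{Trd}_{D/\mathbb{Q}}(aa^\dagger)>0$ for $a\neq 0$; put $|a|_D=\sqrt{\mathrm{Trd}_{D/\mathbb{Q}}(aa^\dagger)}$. Let $V$ be a left $D$-vector space of dimension $m\geq 1$ with a non-degenerate $(D,\dagger)$-skew-Hermitian form, i.e. a $\mathbb{Q}$-bilinear map $\psi\colon V\times V\to D$ with $\psi(y,x)=-\psi(x,y)^\dagger$ and $\psi(ax,by)=a\psi(x,y)b^\dagger$, such that for each $x\neq 0$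 there is $y$ with $\psi(x,y)\neq 0$. Let $L\subset V$ be a $\mathbb{Z}$-lattice of full rank (finitely generated and spanning $V$ over $\mathbb{Q}$) with $\mathrm{Trd}_{D/\mathbb{Q}}\psi(L\times L)\subset\mathbb{Z}$, and let $\mathrm{Stab}_D(L)=\{a\in D: aL\subset L\}$. Let $\mathrm{disc}(L)$ be the determinant of the Gram matrix of $\mathrm{Trd}_{D/\mathbb{Q}}\circ\psi$ in a $\mathbb{Z}$-basis of $L$, and for an order $R$ of $D$ (a subring that is a full-rank $\mathbb{Z}$-lattice in $D$) let $\mathrm{disc}(R)$ be the determinant of the Gram matrix of $(a,b)\mapsto\mathrm{Tr}_{D/\mathbb{Q}}(ab)$ in a $\mathbb{Z}$-basis of $R$. A $D$-basis $v_1,\dots,v_m$ of $V$ is *weakly symplectic* if $\psi(v_i,v_j)=0$ except when $\{i,j\}=\{2k-1,2k\}$ for some $k\in\mathbb{Z}$, and *weakly unitary* if $\psi(v_i,v_j)=0$ for all $i\neq j$. **Theorem.** (a) For all $m\geq 1$ and $n$ there are real constants $C_1,\dots,C_6$, depending only on $m$ and $n$, such that for all data as above with $\dim_D V=m$ and $\dim_{\mathbb{Q}}D=n$,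 and with $R=\mathrm{Stab}_D(L)$, there is a $D$-basis $v_1,\dots,v_m$ of $V$ such that: (i) $v_1,\dots,v_m\in L$; (ii) the basis is weakly symplectic if $D$ has type I, and weakly unitary if $D$ has type II; (iii) $Rv_1+\dots+Rv_m$ has finite index in $L$ and $[L:Rv_1+\dots+Rv_m]\leq C_1\,|\mathrm{disc}(R)|^{C_2}\,|\mathrm{disc}(L)|^{C_3}$; (iv) $|\psi(v_i,v_j)|_D\leq C_4\,|\mathrm{disc}(R)|^{C_5}\,|\mathrm{disc}(L)|^{C_6}$ for all $1\leq i,j\leq m$. (b) For all data as above, every order $R$ of $D$ contained in $\mathrm{Stab}_D(L)$, and every positive integer $\eta$ with $\eta R^\dagger\subset R$, there is a $D$-basis $v_1,\dots,v_m$ of $V$ satisfying (i), (ii), $$[L:Rv_1+\dots+Rv_m]\leq A\,\eta^{A_\eta}\,|\mathrm{disc}(R)|^{A_R}\,|\mathrm{disc}(L)|^{A_L}$$ (the index being finite) and, whenever $\psi(v_i,v_j)\neq 0$, $$|\psi(v_i,v_j)|_D\leq B\,\eta^{B_\eta}\,|\mathrm{disc}(R)|^{B_R}\,|\mathrm{disc}(L)|^{B_L},$$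 where, for $d=1$, $$A=(em^2)^{em(m+2)/16},\quad A_\eta=0,\quad A_R=\tfrac{m(m+2)}{8},\quad A_L=\tfrac{m-2}{4},$$ $$B=(em^2)^{(m(m+2)+24)/32},\quad B_\eta=0,\quad B_R=\tfrac{m(m+2)-8}{16e},\quad B_L=\tfrac{m+2}{8e},$$ and, for $d=2$, $$A=(2em^2)^{em(m+2)/2},\quad A_\eta=14em,\quad A_R=\tfrac{m(m+16)}{4},\quad A_L=\tfrac{m-1}{2},$$ $$B=(2em^2)^{(m(m+1)+14)/8},\quad B_\eta=7,\quad B_R=\tfrac{m(m+1)+26}{16e},\quad B_L=\tfrac{m+1}{8e}.$$ -/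

import Mathlib

universe u v w

open scoped TensorProduct

namespace SkewHermitianLattice

/-! ### Traces -/

section Traces

/-- The non-reduced trace `Tr_{A/k}` of an algebra `A` over a field `k`: the trace of left
multiplication.  (Mathlib's `Algebra.trace` is restricted to commutative algebras.) -/
noncomputable def fullTrace (k : Type u) (A : Type v) [Field k] [Ring A] [Algebra k A] :
    A →ₗ[k] k :=
  LinearMap.trace k A ∘ₗ LinearMap.mul k A

variable (F : Type u) (D : Type v) [Field F] [DivisionRing D] [Algebra F D]

/-- The degree `d = √(dim_F D)` of a central division algebra `D` over `F`. -/
noncomputable def degree : ℕ := Nat.sqrt (Module.finrank F D)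

/-- The reduced trace `Trd_{D/F}` of a central division algebra over a field of characteristic
zero, as the `F`-linear map with `d · Trd_{D/F}(a) = Tr_{D/F}(a)`.  The theorem
`algebraMap_reducedTrace` below identifies it with the matrix trace after any splitting of `D`. -/
noncomputable def reducedTrace : D →ₗ[F] F :=
  ((degree F D : F)⁻¹) • fullTrace F D

/-- The trace of left multiplication by `M` on `n × n` matrices is `n` times the trace of `M`. -/
theorem fullTrace_matrix {K : Type w} [Field K] {n : ℕ} (M : Matrix (Fin n) (Fin n) K) :
    fullTrace K (Matrix (Fin n) (Fin n) K) M = (n : K) * Matrix.trace M := by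
  rw [fullTrace, LinearMap.comp_apply,
    LinearMap.trace_eq_matrix_trace K (Matrix.stdBasis K (Fin n) (Fin n)), Matrix.trace,
    Fintype.sum_prod_type]
  have key : ∀ i j : Fin n,
      (LinearMap.toMatrix (Matrix.stdBasis K (Fin n) (Fin n)) (Matrix.stdBasis K (Fin n) (Fin n))
        (LinearMap.mul K (Matrix (Fin n) (Fin n) K) M)).diag (i, j) = M i i := by
    intro i j
    rw [Matrix.diag_apply, LinearMap.toMatrix_apply, Matrix.stdBasis_eq_single]
    simp [Matrix.stdBasis, Matrix.mul_apply, Matrix.single_apply]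
  simp only [key, Finset.sum_const, Finset.card_univ, Fintype.card_fin, nsmul_eq_mul,
    Matrix.trace, Matrix.diag_apply, Finset.mul_sum]

variable {F D} in
/-- For every splitting `φ : K ⊗_F D ≃ M_n(K)` over a field extension `K / F`, the reduced trace
of `a` is the trace of the matrix `φ (1 ⊗ a)`. -/
theorem algebraMap_reducedTrace [CharZero F] [FiniteDimensional F D]
    {K : Type w} [Field K] [Algebra F K] {n : ℕ}
    (φ : (K ⊗[F] D) ≃ₐ[K] Matrix (Fin n) (Fin n) K) (a : D) :
    algebraMap F K (reducedTrace F D a) = Matrix.trace (φ (1 ⊗ₜ a)) := by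
  have hK : CharZero K := charZero_of_injective_algebraMap (algebraMap F K).injective
  have hfin : Module.finrank F D = n * n := by
    rw [← Module.finrank_baseChange (R := K), φ.toLinearEquiv.finrank_eq,
      Module.finrank_matrix]
    simp
  have hdeg : degree F D = n := by rw [degree, hfin, Nat.sqrt_eq]
  have hn : (n : K) ≠ 0 := by
    have h : 0 < Module.finrank F D := Module.finrank_pos
    rw [hfin] at h
    exact_mod_cast (Nat.pos_of_mul_pos_left h).ne'
  have h1 : algebraMap F K (fullTrace F D a) = fullTrace K (K ⊗[F] D) (1 ⊗ₜ a) := by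
    rw [fullTrace, fullTrace, LinearMap.comp_apply, LinearMap.comp_apply,
      ← LinearMap.trace_baseChange]
    congr 1
    ext x
    simp
  have h2 : fullTrace K (K ⊗[F] D) (1 ⊗ₜ a) =
      fullTrace K (Matrix (Fin n) (Fin n) K) (φ (1 ⊗ₜ a)) := by
    rw [fullTrace, fullTrace, LinearMap.comp_apply, LinearMap.comp_apply,
      ← LinearMap.trace_conj' _ φ.toLinearEquiv]
    congr 1
    ext x : 1
    simp [LinearEquiv.conj_apply]
  simp only [reducedTrace, LinearMap.smul_apply, smul_eq_mul, map_mul, map_inv₀, map_natCast,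
    h1, h2, fullTrace_matrix, hdeg]
  field_simp

variable [CharZero F] [CharZero D]

/-- The reduced trace `Trd_{D/ℚ} = Tr_{F/ℚ} ∘ Trd_{D/F}`. -/
noncomputable def reducedTraceRat : D →ₗ[ℚ] ℚ :=
  Algebra.trace ℚ F ∘ₗ (reducedTrace F D).restrictScalars ℚ

/-- The norm `|a|_D = √(Trd_{D/ℚ}(a a†))`; the involution `†` is written `star`. -/
noncomputable def normD [StarRing D] (a : D) : ℝ :=
  Real.sqrt ((reducedTraceRat F D (a * star a) : ℚ) : ℝ)

/-- The involution `†` of `D` is positive: `(a, b) ↦ Trd_{D/ℚ}(a b†)` is positive definite. -/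
def IsPositiveInvolution [StarRing D] : Prop :=
  ∀ a : D, a ≠ 0 → 0 < reducedTraceRat F D (a * star a)

/-- `D = F` is a totally real number field. -/
def IsTypeI [NumberField F] : Prop :=
  NumberField.IsTotallyReal F ∧ Function.Bijective (algebraMap F D)

/-- `D` is a (division) quaternion algebra over the totally real number field `F` which is totally
indefinite, that is, `ℝ ⊗_ℚ D ≅ M₂(ℝ)^[F : ℚ]`. -/
def IsTypeII [NumberField F] : Prop :=
  NumberField.IsTotallyReal F ∧ Algebra.IsCentral F D ∧ Module.finrank F D = 4 ∧
    Nonempty ((ℝ ⊗[ℚ] D) ≃ₐ[ℝ] (Fin (Module.finrank ℚ F) → Matrix (Fin 2) (Fin 2) ℝ))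

end Traces

/-! ### Lattices, discriminants and orders -/

section Lattices

variable {W : Type w} [AddCommGroup W] [Module ℚ W]

open Classical in
/-- The discriminant `disc(Λ, φ)` of a bilinear form `φ` on a free `ℤ`-module `Λ` of finite rank:
the determinant of the Gram matrix of `φ` in a `ℤ`-basis of `Λ` (any basis, by `disc_eq`). -/
noncomputable def disc (Λ : Submodule ℤ W) (φ : LinearMap.BilinForm ℚ W) : ℚ :=
  if h : ∃ n : ℕ, Nonempty (Module.Basis (Fin n) ℤ Λ) then
    (Matrix.of fun i j => φ (h.choose_spec.some i : W) (h.choose_spec.some j : W)).det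
  else 0

/-- The discriminant may be computed in any basis. -/
theorem disc_eq {n : ℕ} (Λ : Submodule ℤ W) (φ : LinearMap.BilinForm ℚ W)
    (b : Module.Basis (Fin n) ℤ Λ) :
    disc Λ φ = (Matrix.of fun i j => φ (b i : W) (b j : W)).det := by
  have h : ∃ n : ℕ, Nonempty (Module.Basis (Fin n) ℤ Λ) := ⟨n, ⟨b⟩⟩
  rw [disc, dif_pos h]
  have hn : h.choose = n := by
    simpa using Fintype.card_congr (h.choose_spec.some.indexEquiv b)
  generalize h.choose_spec.some = c
  revert c
  rw [hn]
  intro c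
  set P : Matrix (Fin n) (Fin n) ℚ := (b.toMatrix c).map (Int.cast : ℤ → ℚ) with hP
  have hc : ∀ j, (c j : W) = ∑ i, P i j • (b i : W) := by
    intro j
    have h1 := b.sum_toMatrix_smul_self c j
    have h2 := congrArg (fun x : Λ => (x : W)) h1
    simp only [AddSubmonoidClass.coe_finsetSum, Submodule.coe_smul] at h2
    rw [← h2]
    refine Finset.sum_congr rfl fun i _ => ?_
    rw [hP, Matrix.map_apply, Int.cast_smul_eq_zsmul]
  have hmat : (Matrix.of fun i j => φ (c i : W) (c j : W)) =
      P.transpose * (Matrix.of fun i j => φ (b i : W) (b j : W)) * P := by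
    ext i j
    rw [Matrix.of_apply, hc i, hc j]
    simp only [map_sum, map_smul, LinearMap.sum_apply, LinearMap.smul_apply, smul_eq_mul,
      Matrix.mul_apply, Matrix.transpose_apply, Matrix.of_apply, Finset.mul_sum,
      Finset.sum_mul]
    refine Finset.sum_congr rfl fun k _ => ?_
    refine Finset.sum_congr rfl fun l _ => ?_
    ring
  have hdet : P.det * P.det = 1 := by
    have h1 : IsUnit (b.toMatrix c).det := by
      rw [← Matrix.isUnit_iff_isUnit_det]
      exact ⟨⟨b.toMatrix c, c.toMatrix b, b.toMatrix_mul_toMatrix_flip c,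
        c.toMatrix_mul_toMatrix_flip b⟩, rfl⟩
    have h2 : P.det = ((b.toMatrix c).det : ℚ) := by
      rw [hP]
      exact (Int.cast_det (b.toMatrix c)).symm
    rcases Int.isUnit_iff.mp h1 with h3 | h3 <;> rw [h2, h3] <;> norm_num
  rw [hmat, Matrix.det_mul, Matrix.det_mul, Matrix.det_transpose]
  linear_combination (Matrix.of fun i j => φ (b i : W) (b j : W)).det * hdet

variable {D : Type v} [DivisionRing D] [CharZero D]

/-- The subring `R` of `D` is an order: it is a `ℤ`-lattice of full rank in `D`. -/
def IsOrder (R : Subalgebra ℤ D) : Prop :=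
  Submodule.IsLattice ℚ (Subalgebra.toSubmodule R)

/-- The discriminant of an order `R` in `D`: the discriminant on `R` of the non-reduced trace form
`(a, b) ↦ Tr_{D/ℚ}(a b)`. -/
noncomputable def orderDisc (R : Subalgebra ℤ D) : ℚ :=
  disc (Subalgebra.toSubmodule R) ((LinearMap.mul ℚ D).compr₂ (fullTrace ℚ D))

variable [Module D W]

variable (D) in
/-- The stabiliser `Stab_D(L) = {a ∈ D : a L ⊆ L}`. -/
def stab (L : Submodule ℤ W) : Subalgebra ℤ D where
  carrier := {a | ∀ x ∈ L, a • x ∈ L}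
  mul_mem' {a b} ha hb x hx := by
    rw [mul_smul]
    exact ha _ (hb _ hx)
  add_mem' {a b} ha hb x hx := by
    rw [add_smul]
    exact L.add_mem (ha _ hx) (hb _ hx)
  algebraMap_mem' n x hx := by
    rw [Algebra.algebraMap_eq_smul_one, smul_assoc, one_smul]
    exact L.smul_mem n hx

/-- The index `[L : R v₁ + ⋯ + R v_m]`. -/
noncomputable def spanIndex (L : Submodule ℤ W) (R : Subalgebra ℤ D) {m : ℕ} (x : Fin m → W) : ℕ :=
  (Submodule.span R (Set.range x)).toAddSubgroup.relIndex L.toAddSubgroup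

end Lattices

/-! ### Skew-Hermitian forms -/

section Forms

variable {D : Type v} [DivisionRing D] [CharZero D]
  {V : Type w} [AddCommGroup V] [Module ℚ V] [Module D V]

/-- A `ℚ`-bilinear map `ψ : V × V → D` is a `(D, †)`-skew-Hermitian form. -/
def IsSkewHermitian [StarRing D] (ψ : V →ₗ[ℚ] V →ₗ[ℚ] D) : Prop :=
  (∀ x y : V, ψ y x = -star (ψ x y)) ∧
    ∀ (a b : D) (x y : V), ψ (a • x) (b • y) = a * ψ x y * star b

/-- The form `ψ` is non-degenerate. -/
def IsNondegenerate (ψ : V →ₗ[ℚ] V →ₗ[ℚ] D) : Prop :=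
  ∀ x : V, x ≠ 0 → ∃ y : V, ψ x y ≠ 0

/-- The `ℚ`-bilinear form `Trd_{D/ℚ} ∘ ψ`. -/
noncomputable def traceOfForm (F : Type u) [Field F] [CharZero F] [Algebra F D]
    (ψ : V →ₗ[ℚ] V →ₗ[ℚ] D) : LinearMap.BilinForm ℚ V :=
  ψ.compr₂ (reducedTraceRat F D)

/-- The basis `v₁, …, v_m` is weakly symplectic: `ψ(v_i, v_j) = 0` except when
`{i, j} = {2k - 1, 2k}` for some integer `k`.  (The entry of `x` at `i : Fin m` is `v_{i + 1}`.) -/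
def IsWeaklySymplectic (ψ : V →ₗ[ℚ] V →ₗ[ℚ] D) {m : ℕ} (x : Fin m → V) : Prop :=
  ∀ i j : Fin m,
    (¬ ∃ k : ℤ, ({(i : ℤ) + 1, (j : ℤ) + 1} : Set ℤ) = {2 * k - 1, 2 * k}) → ψ (x i) (x j) = 0

/-- The basis `v₁, …, v_m` is weakly unitary: `ψ(v_i, v_j) = 0` whenever `i ≠ j`. -/
def IsWeaklyUnitary (ψ : V →ₗ[ℚ] V →ₗ[ℚ] D) {m : ℕ} (x : Fin m → V) : Prop :=
  ∀ i j : Fin m, i ≠ j → ψ (x i) (x j) = 0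

end Forms

/-! ### The explicit constants

Here `d` is `1` for type I and `2` for type II, `e = [F : ℚ]`, and `m = dim_D V`. -/

section Constants

/-- Multiplicative constant in the bound for the index. -/
noncomputable def indexMult (d e m : ℕ) : ℝ :=
  if d = 1 then ((e : ℝ) * (m : ℝ) ^ 2) ^ ((e : ℝ) * m * (m + 2) / 16)
  else (2 * (e : ℝ) * (m : ℝ) ^ 2) ^ ((e : ℝ) * m * (m + 2) / 2)

/-- Exponent of `η` in the bound for the index. -/
noncomputable def indexEta (d e m : ℕ) : ℝ := if d = 1 then 0 else 14 * (e : ℝ) * m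

/-- Exponent of `|disc R|` in the bound for the index. -/
noncomputable def indexR (d m : ℕ) : ℝ :=
  if d = 1 then (m : ℝ) * (m + 2) / 8 else (m : ℝ) * (m + 16) / 4

/-- Exponent of `|disc L|` in the bound for the index. -/
noncomputable def indexL (d m : ℕ) : ℝ := if d = 1 then ((m : ℝ) - 2) / 4 else ((m : ℝ) - 1) / 2

/-- Multiplicative constant in the bound for `|ψ(v_i, v_j)|_D`. -/
noncomputable def psiMult (d e m : ℕ) : ℝ :=
  if d = 1 then ((e : ℝ) * (m : ℝ) ^ 2) ^ (((m : ℝ) * (m + 2) + 24) / 32)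
  else (2 * (e : ℝ) * (m : ℝ) ^ 2) ^ (((m : ℝ) * (m + 1) + 14) / 8)

/-- Exponent of `η` in the bound for `|ψ(v_i, v_j)|_D`. -/
noncomputable def psiEta (d : ℕ) : ℝ := if d = 1 then 0 else 7

/-- Exponent of `|disc R|` in the bound for `|ψ(v_i, v_j)|_D`. -/
noncomputable def psiR (d e m : ℕ) : ℝ :=
  if d = 1 then ((m : ℝ) * (m + 2) - 8) / (16 * (e : ℝ))
  else ((m : ℝ) * (m + 1) + 26) / (16 * (e : ℝ))

/-- Exponent of `|disc L|` in the bound for `|ψ(v_i, v_j)|_D`. -/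
noncomputable def psiL (d e m : ℕ) : ℝ :=
  if d = 1 then ((m : ℝ) + 2) / (8 * (e : ℝ)) else ((m : ℝ) + 1) / (8 * (e : ℝ))

end Constants

end SkewHermitianLattice

/-! At every real place of F the pair (D, †) becomes the d × d real matrices with transposition
(`Splitting`), so |a|_D² is a sum of squared Frobenius norms. In a D-basis of V the form ψ is given
at each place by an invertible skew matrix A. The polar decomposition A = P J Pᵀ with J orthogonal
puts a Euclidean norm on V ⊗ ℝ (`AdaptedNorm`) with two properties: |ψ(x, y)|_D ≤ |x| |y|, and |disc
L| is the square of the covolume of L. This turns the theorem into geometry of numbers.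

Minkowski's second theorem (`prod_sq_le_card_pow_mul_det_sq`, `IsFormLattice.prod_pow_le`) gives
D-independent w_1, ..., w_m in L the product of whose lengths is bounded in terms of |disc L|. By
Hall's theorem and non-degeneracy some permutation f has ψ(w_i, w_f(i)) ≠ 0 for all i, and for the
best i the product |w_i| |w_f(i)| is at most a geometric mean. So L contains a block with a small
value of ψ (`IsFormLattice.exists_block`): a non-isotropic vector, or a pair x, y with ψ(x, x) = 0 ≠
ψ(x, y). The inequalities of Hadamard and of arithmetic and geometric means bound the norm of that
value, hence the discriminant of the R-span of the block. The orthogonal complement of the block in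
L has discriminant at most |disc L| times that discriminant (`abs_gram_det_orthogonal_le`), and
induction on m applies. The index is read off at the end, since its square is a quotient of
discriminants.

For type I the involution is trivial and ψ is alternating, so every block is a pair and the basis is
weakly symplectic (`exists_symplectic_basis`). For type II a pair has to be replaced by an
orthogonal basis of its plane (`IsFormLattice.exists_nonisotropic`, `exists_unitary_basis`).
Stretching one isotropic direction and shrinking the other preserves the form, and a suitable
stretch yields an isotropic x and an independent y of controlled lengths. Either ψ(y, y) ≠ 0, or
some x + a y is non-isotropic with a ∈ R short; the latter needs ψ(x, y) a† not symmetric, which is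
possible because the symmetric elements have dimension at most 3e.

That dimension bound and the splitting for type II rest on a signature argument
(`finrank_skewElements_le`): Tr(ab) is negative semidefinite on skew elements, and positive definite
on the tuples of symmetric matrices in D ⊗ ℝ = M_2(ℝ)^e, which have codimension e. So the skew
elements form a line F j, and j together with a symmetric k anticommuting with it presents D as a
quaternion algebra (p, q). Positivity of † makes p totally negative and q totally positive, whence
explicit real matrices.

The inductions run on linear inequalities between logarithms. The involution has determinant ±1 on D
and preserves |·|_D, so R need not be stable under it. -/

namespace SkewHermitianLattice

open Module

/-! ### Minkowski's theorems for a lattice in ℝ^n. -/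

section Minkowski

open MeasureTheory in
/-- Minkowski's theorem for cubes: a lattice without nonzero vectors in the open unit ball has
covolume at least `n ^ (-n / 2)`. -/
theorem one_le_card_pow_mul_det_sq {ι : Type*} [Fintype ι] [DecidableEq ι] [Nonempty ι]
    (a : Basis ι ℝ (ι → ℝ))
    (h : ∀ x ∈ Submodule.span ℤ (Set.range a), x ≠ 0 → 1 ≤ ∑ i, x i ^ 2) :
    1 ≤ (Fintype.card ι : ℝ) ^ Fintype.card ι * (Matrix.of a).det ^ 2 := by
  set n := Fintype.card ι with hn
  have hnpos : 0 < n := Fintype.card_pos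
  set Δ : ℝ := |(Matrix.of a).det| with hΔ
  -- The cube of half-side `ρ` has volume exactly 2^n times the covolume; being compact, it contains
  -- a nonzero lattice vector even in this boundary case.
  set ρ : ℝ := Δ ^ ((n : ℝ)⁻¹) with hρ
  have hρ0 : 0 ≤ ρ := Real.rpow_nonneg (abs_nonneg _) _
  have hρn : ρ ^ n = Δ := Real.rpow_inv_natCast_pow (abs_nonneg _) hnpos.ne'
  have hvol : volume (ZSpan.fundamentalDomain a) * 2 ^ finrank ℝ (ι → ℝ) ≤
      volume (Metric.closedBall (0 : ι → ℝ) ρ) := by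
    rw [Real.volume_pi_closedBall _ hρ0, ZSpan.volume_fundamentalDomain, finrank_fintype_fun_eq_card,
      mul_pow, hρn, ENNReal.ofReal_mul (by positivity), mul_comm,
      ENNReal.ofReal_pow (by norm_num)]
    simp [hΔ]
  have hfund := ZSpan.isAddFundamentalDomain a (volume : Measure (ι → ℝ))
  have : Countable (Submodule.span ℤ (Set.range a)).toAddSubgroup :=
    inferInstanceAs (Countable (Submodule.span ℤ (Set.range a)))
  have : DiscreteTopology (Submodule.span ℤ (Set.range a)).toAddSubgroup :=
    inferInstanceAs (DiscreteTopology (Submodule.span ℤ (Set.range a)))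
  obtain ⟨x, hx0, hx⟩ := exists_ne_zero_mem_lattice_of_measure_mul_two_pow_le_measure
    (L := (Submodule.span ℤ (Set.range a)).toAddSubgroup) hfund
    (s := Metric.closedBall (0 : ι → ℝ) ρ) (by simp) (convex_closedBall _ _)
    (isCompact_closedBall _ _) hvol
  have h1 := h x x.2 (by simpa using hx0)
  have hle : ∀ i, (x : ι → ℝ) i ^ 2 ≤ ρ ^ 2 := by
    intro i
    have h2 : ‖(x : ι → ℝ) i‖ ≤ ρ := (norm_le_pi_norm _ i).trans (by simpa using hx)
    rw [← sq_abs, ← Real.norm_eq_abs]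
    exact pow_le_pow_left₀ (norm_nonneg _) h2 2
  have h3 : 1 ≤ (n : ℝ) * ρ ^ 2 := by
    refine h1.trans ((Finset.sum_le_sum fun i _ => hle i).trans ?_)
    simp [hn]
  calc (1 : ℝ) ≤ ((n : ℝ) * ρ ^ 2) ^ n := one_le_pow₀ h3
    _ = (n : ℝ) ^ n * (Matrix.of a).det ^ 2 := by
      rw [mul_pow, ← pow_mul, mul_comm 2 n, pow_mul, hρn, hΔ, sq_abs]

/-- Gram-Schmidt: a basis is triangular with respect to a suitable orthonormal system. -/
theorem exists_orthogonal_triangular {ι : Type*} [Fintype ι] [LinearOrder ι]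
    (b : Basis ι ℝ (ι → ℝ)) : ∃ G : Matrix ι ι ℝ, G.transpose * G = 1 ∧
      ∀ (x : ι → ℝ) (i : ι), G.mulVec x i ≠ 0 → ∃ j, i ≤ j ∧ b.repr x j ≠ 0 := by
  let : LocallyFiniteOrderBot ι := LocallyFiniteOrderBot.ofIic ι
    (fun a => Finset.univ.filter (· ≤ a)) (by simp)
  let T : EuclideanSpace ℝ ι ≃ₗ[ℝ] (ι → ℝ) := WithLp.linearEquiv 2 ℝ (ι → ℝ)
  obtain ⟨f, hf⟩ : ∃ f : ι → EuclideanSpace ℝ ι, ∀ i, f i = T.symm (b i) := ⟨_, fun _ => rfl⟩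
  have hcard : finrank ℝ (EuclideanSpace ℝ ι) = Fintype.card ι := by simp
  obtain ⟨g, hg⟩ : ∃ g : OrthonormalBasis ι ℝ (EuclideanSpace ℝ ι),
      ∀ i j, i < j → inner ℝ (g j) (f i) = 0 :=
    ⟨InnerProductSpace.gramSchmidtOrthonormalBasis hcard f, fun i j hij =>
      InnerProductSpace.gramSchmidtOrthonormalBasis_inv_triangular (𝕜 := ℝ) hcard f hij⟩
  have hin : ∀ (x : ι → ℝ) i, (Matrix.of fun i j => g i j).mulVec x i = inner ℝ (g i) (T.symm x) := by
    intro x i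
    simp [Matrix.mulVec, dotProduct, PiLp.inner_apply, T, mul_comm]
  refine ⟨Matrix.of fun i j => g i j, ?_, ?_⟩
  · rw [mul_eq_one_comm]
    ext i j
    have h1 := orthonormal_iff_ite.1 g.orthonormal i j
    rw [PiLp.inner_apply] at h1
    simp only [Matrix.mul_apply, Matrix.of_apply, Matrix.transpose_apply, Matrix.one_apply]
    rw [← h1]
    exact Finset.sum_congr rfl fun k _ => by simp [mul_comm]
  · intro x i hx
    by_contra! hcon
    apply hx
    rw [hin, ← b.sum_repr x, map_sum, inner_sum]
    refine Finset.sum_eq_zero fun j _ => ?_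
    rw [map_smul, inner_smul_right, ← hf]
    rcases le_or_gt i j with hij | hij
    · rw [hcon j hij, zero_mul]
    · rw [hg _ _ hij, mul_zero]

/-- Minkowski's second theorem for a flag: if `b` is a basis, `h` is a monotone system of weights,
and every vector of the lattice spanned by `a` is at least as long as all the weights belonging to
its nonzero coordinates in `b`, then the product of the weights is bounded by the covolume. -/
theorem prod_sq_le_card_pow_mul_det_sq {ι : Type*} [Fintype ι] [LinearOrder ι]
    (a : Basis ι ℝ (ι → ℝ)) (b : Basis ι ℝ (ι → ℝ)) (h : ι → ℝ)
    (hpos : ∀ i, 0 < h i) (hmono : Monotone h)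
    (hb : ∀ x ∈ Submodule.span ℤ (Set.range a), ∀ i, b.repr x i ≠ 0 → h i ^ 2 ≤ ∑ j, x j ^ 2) :
    ∏ i, h i ^ 2 ≤ (Fintype.card ι : ℝ) ^ Fintype.card ι * (Matrix.of a).det ^ 2 := by
  rcases isEmpty_or_nonempty ι with hι | hι
  · simp
  obtain ⟨G, hG, hGb⟩ := exists_orthogonal_triangular b
  have hnorm : ∀ x : ι → ℝ, ∑ j, G.mulVec x j ^ 2 = ∑ j, x j ^ 2 := by
    intro x
    have h1 : dotProduct (G.mulVec x) (G.mulVec x) = dotProduct x x := by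
      rw [Matrix.dotProduct_mulVec, ← Matrix.mulVec_transpose, Matrix.mulVec_mulVec, hG,
        Matrix.one_mulVec]
    simpa [dotProduct, ← sq] using h1
  -- Rotate the flag into coordinate position and divide the `i`-th coordinate by `h i`. Wherever
  -- the rotated vector has a nonzero coordinate, `h i` is at most its length, so every nonzero
  -- lattice vector becomes at least a unit vector, and the theorem for cubes applies.
  set C : Matrix ι ι ℝ := Matrix.diagonal (fun i => (h i)⁻¹) * G with hCdef
  have hCapp : ∀ x i, C.mulVec x i = (h i)⁻¹ * G.mulVec x i := by
    intro x i
    rw [hCdef, ← Matrix.mulVec_mulVec, Matrix.mulVec_diagonal]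
  have hGdet : G.det ^ 2 = 1 := by
    have := congrArg Matrix.det hG
    rwa [Matrix.det_mul, Matrix.det_transpose, Matrix.det_one, ← sq] at this
  have hCdet : C.det ^ 2 * ∏ i, h i ^ 2 = 1 := by
    rw [hCdef, Matrix.det_mul, mul_pow, hGdet, mul_one, Matrix.det_diagonal, ← Finset.prod_pow,
      ← Finset.prod_mul_distrib]
    exact Finset.prod_eq_one fun i _ => by have := (hpos i).ne'; field_simp
  have hCu : IsUnit C.det := by
    rw [isUnit_iff_ne_zero]
    intro h0
    rw [h0] at hCdet
    simp at hCdet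
  let e : (ι → ℝ) ≃ₗ[ℝ] (ι → ℝ) := C.toLinearEquiv' (C.invertibleOfIsUnitDet hCu)
  have he : ∀ x, e x = C.mulVec x := fun x => rfl
  have key := one_le_card_pow_mul_det_sq (a.map e) (by
    intro y hy hy0
    obtain ⟨x, hx, rfl⟩ : ∃ x ∈ Submodule.span ℤ (Set.range a), e x = y := by
      have : Set.range (a.map e) = (e.toLinearMap.restrictScalars ℤ) '' Set.range a := by
        rw [← Set.range_comp]; ext; simp
      rw [this, Submodule.span_image] at hy
      exact hy
    have hx0 : x ≠ 0 := by rintro rfl; simp at hy0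
    have hq : 0 < ∑ j, x j ^ 2 := by
      refine lt_of_le_of_ne (Finset.sum_nonneg fun _ _ => sq_nonneg _) fun h0 => hx0 ?_
      have := (Finset.sum_eq_zero_iff_of_nonneg (fun _ _ => sq_nonneg _)).1 h0.symm
      ext j
      simpa using this j (Finset.mem_univ j)
    calc (1 : ℝ) = (∑ j, G.mulVec x j ^ 2) / ∑ j, x j ^ 2 := by rw [hnorm, div_self hq.ne']
      _ = ∑ i, G.mulVec x i ^ 2 / ∑ j, x j ^ 2 := Finset.sum_div _ _ _
      _ ≤ ∑ i, e x i ^ 2 := by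
        refine Finset.sum_le_sum fun i _ => ?_
        rw [he, hCapp]
        by_cases h0 : G.mulVec x i = 0
        · simp [h0]
        · obtain ⟨j, hij, hj⟩ := hGb x i h0
          have h1 : h i ^ 2 ≤ ∑ j, x j ^ 2 :=
            (pow_le_pow_left₀ (hpos i).le (hmono hij) 2).trans (hb x hx j hj)
          have h2 : 0 < h i ^ 2 := pow_pos (hpos i) 2
          rw [mul_pow, inv_pow, div_eq_inv_mul]
          gcongr)
  have hmat : (Matrix.of (a.map e)).det = (Matrix.of a).det * C.det := by
    rw [← Matrix.det_transpose C, ← Matrix.det_mul]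
    congr 1
    ext i j
    simp [he, Matrix.mul_apply, Matrix.mulVec, dotProduct, mul_comm]
  rw [hmat, mul_pow] at key
  have hP : 0 ≤ ∏ i, h i ^ 2 := Finset.prod_nonneg fun i _ => sq_nonneg _
  calc ∏ i, h i ^ 2 ≤ ((Fintype.card ι : ℝ) ^ Fintype.card ι *
        ((Matrix.of a).det ^ 2 * C.det ^ 2)) * ∏ i, h i ^ 2 := le_mul_of_one_le_left hP key
    _ = (Fintype.card ι : ℝ) ^ Fintype.card ι * (Matrix.of a).det ^ 2 *
        (C.det ^ 2 * ∏ i, h i ^ 2) := by ring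
    _ = _ := by rw [hCdet, mul_one]

end Minkowski

/-! ### Gram determinants, indices of sublattices, and orthogonal complements. -/

section LatticeGram

variable {V : Type*} [AddCommGroup V] [Module ℚ V]

theorem exists_basis_span_eq (L : Submodule ℤ V) [Submodule.IsLattice ℚ L] {n : ℕ}
    (hn : finrank ℚ V = n) :
    ∃ a : Basis (Fin n) ℚ V, L = Submodule.span ℤ (Set.range a) := by
  have : Module.Free ℤ L := inferInstance
  let b := Module.Free.chooseBasis ℤ L
  let c := b.extendOfIsLattice ℚ
  have hcard : Fintype.card (Module.Free.ChooseBasisIndex ℤ L) = n := by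
    rw [← hn, finrank_eq_card_basis c]
  let e := Fintype.equivFinOfCardEq hcard
  refine ⟨c.reindex e, ?_⟩
  have hr : Set.range (c.reindex e) = L.subtype '' Set.range b := by
    rw [Basis.range_reindex, ← Set.range_comp]
    congr 1
    ext i
    simp [c]
  rw [hr, Submodule.span_image, b.span_eq, Submodule.map_top, Submodule.range_subtype]

/-- The Gram matrix of a family of vectors. -/
def gram {ι : Type*} (φ : LinearMap.BilinForm ℚ V) (a : ι → V) : Matrix ι ι ℚ :=
  Matrix.of fun i j => φ (a i) (a j)

theorem gram_det_reindex {ι κ : Type*} [Fintype ι] [Fintype κ] [DecidableEq ι] [DecidableEq κ]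
    (φ : LinearMap.BilinForm ℚ V) (a : ι → V) (e : κ ≃ ι) :
    (gram φ (a ∘ e)).det = (gram φ a).det :=
  Matrix.det_submatrix_equiv_self e (gram φ a)

theorem linearIndependent_of_restrictScalars_int {ι : Type*} {a : ι → V}
    (h : LinearIndependent ℚ a) : LinearIndependent ℤ a :=
  (LinearIndependent.iff_fractionRing (R := ℤ) (K := ℚ)).2 h

theorem disc_span_basis {ι : Type*} [Fintype ι] [DecidableEq ι] (φ : LinearMap.BilinForm ℚ V)
    (a : Basis ι ℚ V) : disc (Submodule.span ℤ (Set.range a)) φ = (gram φ a).det := by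
  let e := (Fintype.equivFin ι).symm
  have hli := linearIndependent_of_restrictScalars_int a.linearIndependent
  let c := (Basis.span hli).reindex e.symm
  rw [disc_eq _ φ c, ← gram_det_reindex φ a e]
  congr 1
  ext i j
  simp [gram, c, Basis.span_apply]

theorem gram_det_basis_change {ι : Type*} [Fintype ι] [DecidableEq ι]
    (φ : LinearMap.BilinForm ℚ V) (a u : Basis ι ℚ V) :
    (gram φ u).det = a.det u ^ 2 * (gram φ a).det := by
  have h : gram φ u = (a.toMatrix u).transpose * gram φ a * a.toMatrix u := by
    ext i j
    conv_lhs => rw [gram, Matrix.of_apply, ← a.sum_toMatrix_smul_self u i,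
      ← a.sum_toMatrix_smul_self u j]
    simp only [map_sum, map_smul, LinearMap.sum_apply, LinearMap.smul_apply, smul_eq_mul,
      Matrix.mul_apply, Matrix.transpose_apply, gram, Matrix.of_apply, Finset.mul_sum,
      Finset.sum_mul]
    refine Finset.sum_congr rfl fun k _ => Finset.sum_congr rfl fun l _ => ?_
    ring
  rw [h, Matrix.det_mul, Matrix.det_mul, Matrix.det_transpose, Basis.det_apply]
  ring

theorem relIndex_span_basis {ι : Type*} [Fintype ι] [DecidableEq ι] (a u : Basis ι ℚ V)
    (h : ∀ i, u i ∈ Submodule.span ℤ (Set.range a)) :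
    ((Submodule.span ℤ (Set.range u)).toAddSubgroup.relIndex
      (Submodule.span ℤ (Set.range a)).toAddSubgroup : ℚ) = |a.det u| := by
  have hle : Submodule.span ℤ (Set.range u) ≤ Submodule.span ℤ (Set.range a) :=
    Submodule.span_le.2 (by rintro _ ⟨i, rfl⟩; exact h i)
  refine AddSubgroup.relIndex_eq_abs_det _ _ hle u a ?_ ?_
  · rw [← Submodule.span_int_eq_addSubgroupClosure]
  · rw [← Submodule.span_int_eq_addSubgroupClosure]

/-- The square of the index of a sublattice is the quotient of the discriminants. -/
theorem relIndex_sq_mul_gram_det {ι : Type*} [Fintype ι] [DecidableEq ι]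
    (φ : LinearMap.BilinForm ℚ V) (a u : Basis ι ℚ V)
    (h : ∀ i, u i ∈ Submodule.span ℤ (Set.range a)) :
    ((Submodule.span ℤ (Set.range u)).toAddSubgroup.relIndex
      (Submodule.span ℤ (Set.range a)).toAddSubgroup : ℚ) ^ 2 * (gram φ a).det =
      (gram φ u).det := by
  rw [relIndex_span_basis a u h, sq_abs, gram_det_basis_change φ a u]

theorem relIndex_span_basis_ne_zero {ι : Type*} [Fintype ι] [DecidableEq ι] (a u : Basis ι ℚ V)
    (h : ∀ i, u i ∈ Submodule.span ℤ (Set.range a)) :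
    (Submodule.span ℤ (Set.range u)).toAddSubgroup.relIndex
      (Submodule.span ℤ (Set.range a)).toAddSubgroup ≠ 0 := by
  intro h0
  have h1 := relIndex_span_basis a u h
  rw [h0, Nat.cast_zero, eq_comm, abs_eq_zero] at h1
  exact (a.isUnit_det u).ne_zero h1

/-- A matrix of integers as a subgroup: its rows span a subgroup of index `|det|`. -/
theorem index_closure_rows {ι : Type*} [Fintype ι] [DecidableEq ι] (A : Matrix ι ι ℤ)
    (hA : A.det ≠ 0) : (Submodule.span ℤ (Set.range A.row)).toAddSubgroup.index = A.det.natAbs := by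
  have hli : LinearIndependent ℤ A.row := Matrix.linearIndependent_rows_of_det_ne_zero hA
  rw [AddSubgroup.index_eq_natAbs_det (Pi.basisFun ℤ ι) _ (Basis.span hli)]
  congr 1
  rw [Pi.basisFun_det]
  change (Matrix.of fun x => ((Basis.span hli x : _) : ι → ℤ)).det = _
  congr 1
  ext i j
  simp [Basis.span_apply]

/-- If `x` spans a nondegenerate sublattice of an integral lattice `L`, the discriminant of the
orthogonal complement of `x` in `L` is at most `|disc L|` times the discriminant of `x`. -/
theorem abs_gram_det_orthogonal_le {ι κ μ : Type*} [Fintype ι] [DecidableEq ι] [Fintype κ]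
    [DecidableEq κ] [Fintype μ] [DecidableEq μ] (φ : LinearMap.BilinForm ℚ V) (hφ : φ.IsRefl)
    (a : Basis μ ℚ V)
    (hint : ∀ x ∈ Submodule.span ℤ (Set.range a), ∀ y ∈ Submodule.span ℤ (Set.range a),
      ∃ z : ℤ, φ x y = z)
    (x : ι → V) (hx : ∀ i, x i ∈ Submodule.span ℤ (Set.range a)) (hxdet : (gram φ x).det ≠ 0)
    (y : κ → V) (hyli : LinearIndependent ℚ y)
    (hy : ∀ z, z ∈ Submodule.span ℤ (Set.range y) ↔
      z ∈ Submodule.span ℤ (Set.range a) ∧ ∀ i, φ z (x i) = 0)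
    (hcard : Fintype.card ι + Fintype.card κ = Fintype.card μ) :
    |(gram φ y).det| ≤ |(gram φ a).det| * |(gram φ x).det| := by
  set L := Submodule.span ℤ (Set.range a) with hL
  have hyx : ∀ k i, φ (y k) (x i) = 0 := fun k i =>
    ((hy (y k)).1 (Submodule.subset_span ⟨k, rfl⟩)).2 i
  have hyL : ∀ k, y k ∈ L := fun k => ((hy (y k)).1 (Submodule.subset_span ⟨k, rfl⟩)).1
  have hxy : ∀ k i, φ (x i) (y k) = 0 := fun k i => hφ _ _ (hyx k i)
  have hli : LinearIndependent ℚ (Sum.elim x y) := by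
    rw [Fintype.linearIndependent_iff]
    intro g hg
    rw [Fintype.sum_sum_type] at hg
    simp only [Sum.elim_inl, Sum.elim_inr] at hg
    have h0 : (fun i => g (Sum.inl i)) = 0 := by
      by_contra hne
      apply hxdet
      rw [← Matrix.exists_vecMul_eq_zero_iff]
      refine ⟨_, hne, ?_⟩
      ext j
      have h1 := congrArg (fun z => φ z (x j)) hg
      simp only [map_add, map_sum, map_smul, LinearMap.add_apply, LinearMap.sum_apply,
        LinearMap.smul_apply, smul_eq_mul, hyx, mul_zero, Finset.sum_const_zero, add_zero,
        map_zero, LinearMap.zero_apply] at h1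
      simpa [Matrix.vecMul, dotProduct, gram] using h1
    have h0' : ∀ i, g (Sum.inl i) = 0 := fun i => congrFun h0 i
    simp only [h0', zero_smul, Finset.sum_const_zero, zero_add] at hg
    have h2 := Fintype.linearIndependent_iff.1 hyli _ hg
    rintro (i | i)
    · exact h0' i
    · exact h2 i
  have hc : Fintype.card (ι ⊕ κ) = Fintype.card μ := by rw [Fintype.card_sum, hcard]
  let e := Fintype.equivOfCardEq hc
  have : FiniteDimensional ℚ V := a.finiteDimensional_of_finite
  rcases isEmpty_or_nonempty (ι ⊕ κ) with hemp | hne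
  · have h1 : IsEmpty ι := ⟨fun i => hemp.false (Sum.inl i)⟩
    have h2 : IsEmpty κ := ⟨fun i => hemp.false (Sum.inr i)⟩
    have h3 : IsEmpty μ := ⟨fun i => hemp.false (e.symm i)⟩
    simp
  let w : Basis (ι ⊕ κ) ℚ V := basisOfLinearIndependentOfCardEqFinrank hli
    (by rw [hc, finrank_eq_card_basis a])
  have hw : ⇑w = Sum.elim x y := coe_basisOfLinearIndependentOfCardEqFinrank _ _
  let a' := a.reindex e.symm
  have ha' : Set.range a' = Set.range a := Basis.range_reindex _ _
  have hwL : ∀ i, w i ∈ Submodule.span ℤ (Set.range a') := by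
    rw [ha', hw]
    rintro (i | i)
    · exact hx i
    · exact hyL i
  have hidx := relIndex_sq_mul_gram_det φ a' w hwL
  have hga : (gram φ a').det = (gram φ a).det := by
    rw [← gram_det_reindex φ a e]
    congr 2
    ext i
    simp [a']
  have hgw : (gram φ w).det = (gram φ x).det * (gram φ y).det := by
    rw [← Matrix.det_fromBlocks_zero₂₁ (gram φ x) 0 (gram φ y), hw]
    congr 1
    ext (i | i) (j | j) <;> simp [gram, hxy, hyx]
  -- the index is bounded by the discriminant of `x`
  choose! f hf using hint
  let F : L →ₗ[ℤ] (ι → ℤ) :=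
    { toFun := fun z i => f z (x i)
      map_add' := by
        intro z z'
        ext i
        have h1 := hf _ z.2 _ (hx i)
        have h2 := hf _ z'.2 _ (hx i)
        have h3 := hf _ (z + z').2 _ (hx i)
        rw [Submodule.coe_add, map_add, LinearMap.add_apply, h1, h2] at h3
        simp only [Submodule.coe_add, Pi.add_apply]
        exact_mod_cast h3.symm
      map_smul' := by
        intro c z
        ext i
        have h1 := hf _ z.2 _ (hx i)
        have h3 := hf _ (c • z).2 _ (hx i)
        rw [Submodule.coe_smul, map_zsmul, LinearMap.smul_apply, h1] at h3
        simp only [Submodule.coe_smul, Pi.smul_apply, eq_intCast, smul_eq_mul]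
        rw [zsmul_eq_mul] at h3
        exact_mod_cast h3.symm }
  have hF : ∀ (z : L) i, ((F z i : ℤ) : ℚ) = φ z (x i) := fun z i => (hf _ z.2 _ (hx i)).symm
  let A : Matrix ι ι ℤ := Matrix.of fun i => F ⟨x i, hx i⟩
  have hAdet : (A.det : ℚ) = (gram φ x).det := by
    rw [Int.cast_det]
    congr 1
    ext i j
    simp [A, gram, hF]
  have hA0 : A.det ≠ 0 := by
    intro h
    rw [h, Int.cast_zero] at hAdet
    exact hxdet hAdet.symm
  set H := (Submodule.span ℤ (Set.range A.row)).toAddSubgroup with hH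
  have hHi : H.index = A.det.natAbs := index_closure_rows A hA0
  set U := (Submodule.span ℤ (Set.range w)).toAddSubgroup with hU
  -- If the pairings of z with the `x i` agree with those of some integral combination of the `x i`,
  -- the difference is orthogonal to all of them, hence in the span of `y`. So the index of span x +
  -- span y in the lattice divides the index of the Gram rows in ℤ^ι.
  have hle : H.comap F.toAddMonoidHom ≤ U.addSubgroupOf L.toAddSubgroup := by
    intro z hz
    rw [AddSubgroup.mem_addSubgroupOf]
    have hz' : F z ∈ Submodule.span ℤ (Set.range A.row) := hz
    rw [Submodule.mem_span_range_iff_exists_fun] at hz'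
    obtain ⟨c, hc⟩ := hz'
    have hmem : (z : V) - ∑ i, c i • x i ∈ Submodule.span ℤ (Set.range y) := by
      rw [hy]
      refine ⟨L.sub_mem z.2 (L.sum_mem fun i _ => L.smul_mem _ (hx i)), fun j => ?_⟩
      have h1 := congrArg (fun v : ι → ℤ => ((v j : ℤ) : ℚ)) hc
      simp only [Finset.sum_apply, Pi.smul_apply, smul_eq_mul, Int.cast_sum, Int.cast_mul,
        hF, Matrix.row, A, Matrix.of_apply] at h1
      simp only [map_sub, map_sum, map_zsmul, LinearMap.sub_apply, LinearMap.sum_apply,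
        LinearMap.smul_apply, zsmul_eq_mul, h1.symm, sub_self]
    have hxU : ∀ i, x i ∈ Submodule.span ℤ (Set.range w) := fun i =>
      Submodule.subset_span ⟨Sum.inl i, by rw [hw]; rfl⟩
    have hyU : Submodule.span ℤ (Set.range y) ≤ Submodule.span ℤ (Set.range w) :=
      Submodule.span_mono (by rintro _ ⟨i, rfl⟩; exact ⟨Sum.inr i, by rw [hw]; rfl⟩)
    have := (Submodule.span ℤ (Set.range w)).add_mem (hyU hmem)
      (Submodule.sum_mem _ fun i (_ : i ∈ Finset.univ) => Submodule.smul_mem _ (c i) (hxU i))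
    rw [sub_add_cancel] at this
    exact this
  have hHne : (H.comap F.toAddMonoidHom).index ∣ H.index := by
    rw [AddSubgroup.index_comap]
    exact AddSubgroup.relIndex_dvd_index_of_normal _ _
  have hdvd : U.relIndex L.toAddSubgroup ∣ A.det.natAbs := by
    rw [← hHi]
    exact (AddSubgroup.index_dvd_of_le hle).trans hHne
  have hub : (U.relIndex L.toAddSubgroup : ℚ) ≤ |(gram φ x).det| := by
    rw [← hAdet, ← Int.cast_abs, ← Nat.cast_natAbs]
    exact_mod_cast Nat.le_of_dvd (Int.natAbs_pos.2 hA0) hdvd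
  rw [hga, hgw, ha'] at hidx
  have hpos : 0 < |(gram φ x).det| := abs_pos.2 hxdet
  -- disc x · disc y is the squared index times disc a; the index is at most |disc x|, and one
  -- factor |disc x| cancels.
  have h1 : |(gram φ x).det| * |(gram φ y).det| ≤
      |(gram φ x).det| ^ 2 * |(gram φ a).det| := by
    rw [← abs_mul, ← hidx, abs_mul, abs_pow, Nat.abs_cast]
    gcongr
  refine le_of_mul_le_mul_left (h1.trans_eq ?_) hpos
  ring

end LatticeGram

/-! ### Frobenius norms and determinants of trace forms. -/

section MatrixLemmas

/-- The square of the Frobenius norm of a real matrix. -/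
def frobSq {m n : Type*} [Fintype m] [Fintype n] (A : Matrix m n ℝ) : ℝ := ∑ p, ∑ q, A p q ^ 2

variable {m n p : Type*} [Fintype m] [Fintype n] [Fintype p]

theorem frobSq_nonneg (A : Matrix m n ℝ) : 0 ≤ frobSq A :=
  Finset.sum_nonneg fun _ _ => Finset.sum_nonneg fun _ _ => sq_nonneg _

theorem frobSq_eq_trace (A : Matrix m n ℝ) : frobSq A = (A * A.transpose).trace := by
  simp [frobSq, Matrix.trace, Matrix.mul_apply, sq]

theorem frobSq_eq_zero {A : Matrix m n ℝ} : frobSq A = 0 ↔ A = 0 := by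
  refine ⟨fun h => ?_, fun h => by simp [h, frobSq]⟩
  ext i j
  have h1 := (Finset.sum_eq_zero_iff_of_nonneg
    (fun _ _ => Finset.sum_nonneg fun _ _ => sq_nonneg _)).1 h i (Finset.mem_univ i)
  have h2 := (Finset.sum_eq_zero_iff_of_nonneg (fun _ _ => sq_nonneg _)).1 h1 j (Finset.mem_univ j)
  simpa using h2

theorem frobSq_transpose (A : Matrix m n ℝ) : frobSq A.transpose = frobSq A :=
  Finset.sum_comm

theorem frobSq_mul_le (A : Matrix m n ℝ) (B : Matrix n p ℝ) :
    frobSq (A * B) ≤ frobSq A * frobSq B := by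
  rw [← frobSq_transpose B, frobSq, frobSq, frobSq, Finset.sum_mul_sum]
  refine Finset.sum_le_sum fun i _ => Finset.sum_le_sum fun j _ => ?_
  rw [Matrix.mul_apply]
  exact Finset.sum_mul_sq_le_sq_mul_sq _ _ _

theorem frobSq_add_le (A B : Matrix m n ℝ) : frobSq (A + B) ≤ 2 * (frobSq A + frobSq B) := by
  simp only [frobSq, ← Finset.sum_add_distrib, Finset.mul_sum]
  refine Finset.sum_le_sum fun i _ => Finset.sum_le_sum fun j _ => ?_
  rw [Matrix.add_apply]
  nlinarith [sq_nonneg (A i j - B i j)]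

theorem frobSq_neg (A : Matrix m n ℝ) : frobSq (-A) = frobSq A := by
  simp [frobSq]

theorem frobSq_mul_orthogonal [DecidableEq n] (A : Matrix m n ℝ) (J : Matrix n n ℝ)
    (hJ : J * J.transpose = 1) : frobSq (A * J) = frobSq A := by
  rw [frobSq_eq_trace, frobSq_eq_trace, Matrix.transpose_mul, Matrix.mul_assoc,
    ← Matrix.mul_assoc J, hJ, Matrix.one_mul]

/-- Hadamard's inequality in dimensions one and two. -/
theorem det_sq_le_frobSq {d : ℕ} (hd : d = 1 ∨ d = 2) (A : Matrix (Fin d) (Fin d) ℝ) :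
    A.det ^ 2 ≤ (frobSq A / d) ^ d := by
  rcases hd with rfl | rfl
  · simp [frobSq]
  · have h : |A.det| ≤ frobSq A / 2 := by
      rw [Matrix.det_fin_two, abs_le]
      simp only [frobSq, Fin.sum_univ_two]
      constructor <;> nlinarith [sq_nonneg (A 0 0 - A 1 1), sq_nonneg (A 0 0 + A 1 1),
        sq_nonneg (A 0 1 - A 1 0), sq_nonneg (A 0 1 + A 1 0)]
    rw [← sq_abs]
    exact_mod_cast pow_le_pow_left₀ (abs_nonneg _) h 2

/-- The inequality of arithmetic and geometric means; for an empty index set both sides are 1. -/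
theorem prod_le_div_card_pow {ι : Type*} [Fintype ι] (x : ι → ℝ) (hx : ∀ i, 0 ≤ x i) :
    ∏ i, x i ≤ ((∑ i, x i) / Fintype.card ι) ^ Fintype.card ι := by
  rcases isEmpty_or_nonempty ι with h | h
  · simp
  have hc : 0 < Fintype.card ι := Fintype.card_pos
  have h1 := Real.geom_mean_le_arith_mean_weighted Finset.univ (fun _ : ι => (Fintype.card ι : ℝ)⁻¹)
    x (fun _ _ => by positivity) (by simp) (fun i _ => hx i)
  rw [← Finset.mul_sum, Real.finsetProd_rpow _ _ (fun i _ => hx i)] at h1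
  have h2 := pow_le_pow_left₀ (by
    exact Real.rpow_nonneg (Finset.prod_nonneg fun i _ => hx i) _) h1 (Fintype.card ι)
  rw [Real.rpow_inv_natCast_pow (Finset.prod_nonneg fun i _ => hx i) hc.ne'] at h2
  rwa [div_eq_inv_mul]

/-- The Gram determinant of a family of tuples of rectangular matrices with respect to a bilinear
form given by matrices `A s`. -/
theorem abs_det_trace_form {S ι κ : Type*} [Fintype S] [DecidableEq S] [Fintype ι]
    [DecidableEq ι] [Fintype κ] [DecidableEq κ] {d : ℕ} (x : ι → S → Matrix (Fin d) κ ℝ)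
    (A : S → Matrix κ κ ℝ) (hcard : Fintype.card ι = Fintype.card (κ × (S × Fin d))) :
    |(Matrix.of fun i j => ∑ s, (x i s * A s * (x j s).transpose).trace).det| =
      |(Matrix.of fun i j => ∑ s, (x i s * (x j s).transpose).trace).det| *
        ∏ s, |(A s).det| ^ d := by
  let e := Fintype.equivOfCardEq hcard.symm
  -- All entries of all the matrices of `x i`, written as one row. The form acts on these rows as a
  -- block diagonal matrix with d copies of each `A s`.
  let Θ : Matrix (κ × (S × Fin d)) (κ × (S × Fin d)) ℝ :=
    Matrix.of fun i k => x (e i) k.2.1 k.2.2 k.1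
  have key : ∀ B : S → Matrix κ κ ℝ,
      (Matrix.of fun i j => ∑ s, (x i s * B s * (x j s).transpose).trace).det =
        Θ.det ^ 2 * ∏ s, (B s).det ^ d := by
    intro B
    rw [← Matrix.det_submatrix_equiv_self e]
    have h : (Matrix.of fun i j => ∑ s, (x i s * B s * (x j s).transpose).trace).submatrix e e =
        Θ * Matrix.blockDiagonal (fun o : S × Fin d => B o.1) * Θ.transpose := by
      have hTB : ∀ i q s p, (Θ * Matrix.blockDiagonal (fun o : S × Fin d => B o.1)) i (q, (s, p)) =
          (x (e i) s * B s) p q := by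
        intro i q s p
        rw [Matrix.mul_apply, Matrix.mul_apply, Fintype.sum_prod_type]
        refine Finset.sum_congr rfl fun r _ => ?_
        rw [Finset.sum_eq_single (s, p)]
        · simp [Θ]
        · intro b _ hb
          rw [Matrix.blockDiagonal_apply_ne _ _ _ hb, mul_zero]
        · simp
      ext i j
      rw [Matrix.mul_apply]
      simp only [Matrix.submatrix_apply, Matrix.of_apply, Matrix.transpose_apply,
        Fintype.sum_prod_type, hTB, Matrix.trace, Matrix.diag_apply]
      conv_rhs => rw [Finset.sum_comm]
      refine Finset.sum_congr rfl fun s _ => ?_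
      conv_rhs => rw [Finset.sum_comm]
      refine Finset.sum_congr rfl fun p _ => ?_
      rw [Matrix.mul_apply]
      rfl
    rw [h, Matrix.det_mul, Matrix.det_mul, Matrix.det_transpose, Matrix.det_blockDiagonal,
      Fintype.prod_prod_type]
    simp only [Finset.prod_const, Finset.card_univ, Fintype.card_fin]
    ring
  -- Identity matrices identify `Θ.det ^ 2` with the Gram determinant of the Euclidean form.
  have h1 := key (fun _ => 1)
  simp only [Matrix.mul_one, Matrix.det_one, one_pow, Finset.prod_const_one, mul_one] at h1
  rw [key A, h1, abs_mul, Finset.abs_prod]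
  simp only [abs_pow]

end MatrixLemmas

/-! ### Real splittings of (D, †) and the norms on D. -/

section SplittingDefs

/-- A real splitting of `(D, †)`: representations of `D` by real `d × d` matrices, indexed by the
real places, which carry `†` to transposition and add up to the trace form `T`. -/
structure Splitting {D : Type v} [DivisionRing D] [CharZero D] [StarRing D] (T : D →ₗ[ℚ] ℚ)
    (d : ℕ) (S : Type u) [Fintype S] where
  /-- the representations -/
  ρ : S → D →+* Matrix (Fin d) (Fin d) ℝ
  ρ_star : ∀ s a, ρ s (star a) = (ρ s a).transpose
  trace_eq : ∀ a, (T a : ℝ) = ∑ s, (ρ s a).trace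
  fullTrace_eq : ∀ a, fullTrace ℚ D a = d * T a
  finrank_eq : finrank ℚ D = d * (Fintype.card S * d)
  d_pos : 0 < d
  card_pos : 0 < Fintype.card S

/-- The form `ψ` is sesquilinear with respect to the involution of `D`. -/
def IsSesquilinear {D : Type v} [DivisionRing D] [CharZero D] [StarRing D] {V : Type w}
    [AddCommGroup V] [Module ℚ V] [Module D V] (ψ : V →ₗ[ℚ] V →ₗ[ℚ] D) : Prop :=
  ∀ (a b : D) (x y : V), ψ (a • x) (b • y) = a * ψ x y * star b

namespace Splitting

variable {D : Type v} [DivisionRing D] [CharZero D] [StarRing D] {T : D →ₗ[ℚ] ℚ} {d : ℕ}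
  {S : Type u} [Fintype S] (σ : Splitting T d S)

/-- The square of the norm of `a` at the place `s`. -/
noncomputable def loc (s : S) (a : D) : ℝ := frobSq (σ.ρ s a)

/-- The square of the norm `|a|_D`. -/
noncomputable def normSq (a : D) : ℝ := ∑ s, σ.loc s a

/-- The absolute value of the norm `Nm_{D/ℚ}(a)`. -/
noncomputable def detProd (a : D) : ℝ := ∏ s, |(σ.ρ s a).det| ^ d

theorem loc_nonneg (s : S) (a : D) : 0 ≤ σ.loc s a := frobSq_nonneg _

theorem normSq_nonneg (a : D) : 0 ≤ σ.normSq a := Finset.sum_nonneg fun s _ => σ.loc_nonneg s a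

theorem loc_eq_trace (s : S) (a : D) : σ.loc s a = (σ.ρ s (a * star a)).trace := by
  rw [loc, frobSq_eq_trace, map_mul, σ.ρ_star]

theorem normSq_eq (a : D) : σ.normSq a = (T (a * star a) : ℝ) := by
  rw [σ.trace_eq, normSq]
  exact Finset.sum_congr rfl fun s _ => σ.loc_eq_trace s a

theorem loc_mul_le (s : S) (a b : D) : σ.loc s (a * b) ≤ σ.loc s a * σ.loc s b := by
  rw [loc, map_mul]
  exact frobSq_mul_le _ _

theorem loc_star (s : S) (a : D) : σ.loc s (star a) = σ.loc s a := by
  rw [loc, σ.ρ_star, frobSq_transpose, loc]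

theorem loc_neg (s : S) (a : D) : σ.loc s (-a) = σ.loc s a := by
  rw [loc, map_neg, frobSq_neg, loc]

theorem loc_add_le (s : S) (a b : D) : σ.loc s (a + b) ≤ 2 * (σ.loc s a + σ.loc s b) := by
  rw [loc, map_add]
  exact frobSq_add_le _ _

theorem det_ne_zero (s : S) {a : D} (ha : a ≠ 0) : (σ.ρ s a).det ≠ 0 := by
  intro h
  have h1 : (σ.ρ s a * σ.ρ s a⁻¹).det = 1 := by
    rw [← map_mul, mul_inv_cancel₀ ha, map_one, Matrix.det_one]
  rw [Matrix.det_mul, h, zero_mul] at h1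
  exact zero_ne_one h1

theorem detProd_pos {a : D} (ha : a ≠ 0) : 0 < σ.detProd a :=
  Finset.prod_pos fun s _ => pow_pos (abs_pos.2 (σ.det_ne_zero s ha)) _

theorem T_one_pos (σ : Splitting T d S) : 0 < T 1 := by
  have h := σ.trace_eq 1
  simp only [map_one, Matrix.trace_one, Fintype.card_fin, Finset.sum_const, Finset.card_univ,
    nsmul_eq_mul] at h
  have h1 : (0 : ℝ) < T 1 := by
    rw [h]
    have := σ.d_pos
    have := σ.card_pos
    positivity
  exact_mod_cast h1

theorem finiteDimensional (σ : Splitting T d S) : FiniteDimensional ℚ D := by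
  refine FiniteDimensional.of_finrank_pos ?_
  rw [σ.finrank_eq]
  have := σ.d_pos
  have := σ.card_pos
  positivity

theorem detProd_sq_le_prod (hd : d = 1 ∨ d = 2) (a : D) :
    σ.detProd a ^ 2 ≤ ∏ s, (σ.loc s a / d) ^ (d * d) := by
  rw [detProd, ← Finset.prod_pow]
  refine Finset.prod_le_prod (fun s _ => by positivity) fun s _ => ?_
  rw [← pow_mul, mul_comm d 2, pow_mul, sq_abs, pow_mul]
  exact pow_le_pow_left₀ (sq_nonneg _) (det_sq_le_frobSq hd _) _

/-- The inequality between the norm of an element and its Euclidean length. -/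
theorem detProd_sq_le (hd : d = 1 ∨ d = 2) (a : D) :
    σ.detProd a ^ 2 ≤ (σ.normSq a / (d * Fintype.card S)) ^ finrank ℚ D := by
  refine (σ.detProd_sq_le_prod hd a).trans ?_
  rw [Finset.prod_pow]
  have h := prod_le_div_card_pow (fun s => σ.loc s a / d)
    (fun s => div_nonneg (σ.loc_nonneg s a) (Nat.cast_nonneg _))
  rw [← Finset.sum_div, div_div] at h
  rw [σ.finrank_eq, show d * (Fintype.card S * d) = Fintype.card S * (d * d) by ring,
    pow_mul _ (Fintype.card S)]
  exact pow_le_pow_left₀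
    (Finset.prod_nonneg fun s _ => div_nonneg (σ.loc_nonneg s a) (Nat.cast_nonneg _)) h _

end Splitting

end SplittingDefs

/-! ### Euclidean norms on V ⊗ ℝ adapted to the form. -/

section AdaptedNormDefs

variable {D : Type v} [DivisionRing D] [CharZero D] [StarRing D] {T : D →ₗ[ℚ] ℚ} {d : ℕ}
  {S : Type u} [Fintype S] {V : Type w} [AddCommGroup V] [Module ℚ V]

/-- Coordinates on `V ⊗ ℝ` in which the form `ψ` is given by orthogonal matrices. -/
structure AdaptedNorm (σ : Splitting T d S) (ψ : V →ₗ[ℚ] V →ₗ[ℚ] D) (κ : Type*) [Fintype κ]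
    [DecidableEq κ] where
  /-- the coordinates -/
  X : V →ₗ[ℚ] (S → Matrix (Fin d) κ ℝ)
  /-- the matrices of the form -/
  J : S → Matrix κ κ ℝ
  J_orthogonal : ∀ s, J s * (J s).transpose = 1
  form_eq : ∀ x y s, σ.ρ s (ψ x y) = X x s * J s * (X y s).transpose
  finrank_eq : finrank ℚ V = Fintype.card κ * (Fintype.card S * d)

theorem gram_map_eq {σ : Splitting T d S} {ψ : V →ₗ[ℚ] V →ₗ[ℚ] D} {κ : Type*} [Fintype κ]
    {X : V → S → Matrix (Fin d) κ ℝ} {A : S → Matrix κ κ ℝ}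
    (h : ∀ x y s, σ.ρ s (ψ x y) = X x s * A s * (X y s).transpose) {ι : Type*} (a : ι → V) :
    (gram (ψ.compr₂ T) a).map (Rat.cast : ℚ → ℝ) =
      Matrix.of fun i j => ∑ s, (X (a i) s * A s * (X (a j) s).transpose).trace := by
  ext i j
  simp [gram, σ.trace_eq, h]

theorem Rat.abs_det_cast {ι : Type*} [Fintype ι] [DecidableEq ι] (A : Matrix ι ι ℚ) :
    ((|A.det| : ℚ) : ℝ) = |(A.map (Rat.cast : ℚ → ℝ)).det| := by
  rw [Rat.cast_abs]
  congr 1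
  exact RingHom.map_det (Rat.castHom ℝ) A

namespace AdaptedNorm

variable {σ : Splitting T d S} {ψ : V →ₗ[ℚ] V →ₗ[ℚ] D} {κ : Type*} [Fintype κ]
    [DecidableEq κ] (N : AdaptedNorm σ ψ κ)

/-- The square of the norm of `x` at the place `s`. -/
noncomputable def loc (s : S) (x : V) : ℝ := frobSq (N.X x s)

/-- The square of the norm of `x`. -/
noncomputable def normSq (x : V) : ℝ := ∑ s, N.loc s x

theorem loc_nonneg (s : S) (x : V) : 0 ≤ N.loc s x := frobSq_nonneg _

theorem normSq_nonneg (x : V) : 0 ≤ N.normSq x := Finset.sum_nonneg fun s _ => N.loc_nonneg s x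

/-- The Frobenius norm is submultiplicative and unaffected by an orthogonal factor. This is one of
the two reasons for asking that the matrices of the form be orthogonal. -/
theorem loc_form_le (s : S) (x y : V) : σ.loc s (ψ x y) ≤ N.loc s x * N.loc s y := by
  rw [Splitting.loc, N.form_eq]
  refine (frobSq_mul_le _ _).trans_eq ?_
  rw [frobSq_mul_orthogonal _ _ (N.J_orthogonal s), frobSq_transpose]
  rfl

theorem normSq_form_le (x y : V) : σ.normSq (ψ x y) ≤ N.normSq x * N.normSq y := by
  refine (Finset.sum_le_sum fun s _ => N.loc_form_le s x y).trans ?_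
  rw [normSq, Finset.sum_mul]
  refine Finset.sum_le_sum fun s _ => mul_le_mul_of_nonneg_left ?_ (N.loc_nonneg s x)
  exact Finset.single_le_sum (f := fun s => N.loc s y) (fun s _ => N.loc_nonneg s y)
    (Finset.mem_univ s)

/-- The coordinates as a vector. -/
noncomputable def coord (x : V) (k : κ × (S × Fin d)) : ℝ := N.X x k.2.1 k.2.2 k.1

theorem coord_sum_smul {ι : Type*} (t : Finset ι) (c : ι → ℚ) (x : ι → V) (k : κ × (S × Fin d)) :
    N.coord (∑ i ∈ t, c i • x i) k = ∑ i ∈ t, (c i : ℝ) * N.coord (x i) k := by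
  simp [coord, Matrix.sum_apply, Rat.smul_def]

theorem normSq_eq_sum (x : V) : N.normSq x = ∑ k, N.coord x k ^ 2 := by
  rw [Fintype.sum_prod_type, Finset.sum_comm, Fintype.sum_prod_type]
  simp only [normSq, loc, frobSq, coord]

/-- The other reason: orthogonal matrices have determinant ±1, so the trace form of ψ and the
Euclidean form have the same Gram determinant up to sign. For a basis of a lattice the right side is
the squared covolume. -/
theorem abs_gram_det_eq_sq {β : Type*} [Fintype β] [DecidableEq β]
    (e : β ≃ κ × (S × Fin d)) (a : β → V) :
    ((|(gram (ψ.compr₂ T) a).det| : ℚ) : ℝ) =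
      (Matrix.of fun i j => N.coord (a i) (e j)).det ^ 2 := by
  classical
  rw [Rat.abs_det_cast, gram_map_eq N.form_eq,
    abs_det_trace_form (fun i s => N.X (a i) s) N.J (Fintype.card_congr e)]
  have h1 : ∀ s, |(N.J s).det| = 1 := by
    intro s
    have := congrArg Matrix.det (N.J_orthogonal s)
    rw [Matrix.det_mul, Matrix.det_transpose, Matrix.det_one, ← sq, ← sq_abs] at this
    nlinarith [abs_nonneg (N.J s).det]
  simp only [h1, one_pow, Finset.prod_const_one, mul_one]
  have h2 : (Matrix.of fun i j => ∑ s, (N.X (a i) s * (N.X (a j) s).transpose).trace) =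
      (Matrix.of fun i j => N.coord (a i) (e j)) *
        (Matrix.of fun i j => N.coord (a i) (e j)).transpose := by
    ext i j
    rw [Matrix.mul_apply]
    simp only [Matrix.of_apply, Matrix.transpose_apply]
    rw [e.sum_comp (fun k => N.coord (a i) k * N.coord (a j) k), Fintype.sum_prod_type,
      Finset.sum_comm, Fintype.sum_prod_type]
    simp [Matrix.trace, Matrix.mul_apply, coord]
  rw [h2, Matrix.det_mul, Matrix.det_transpose, ← sq, abs_of_nonneg (sq_nonneg _)]

/-- A rational basis of `V` gives a basis of `V ⊗ ℝ`. -/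
theorem exists_real_basis {β : Type*} [Fintype β] [DecidableEq β]
    (e : β ≃ κ × (S × Fin d)) (b : Basis β ℚ V) (hb : (gram (ψ.compr₂ T) b).det ≠ 0) :
    ∃ B : Basis β ℝ (β → ℝ), (∀ i, B i = fun j => N.coord (b i) (e j)) ∧
      ∀ x i, B.repr (fun j => N.coord x (e j)) i = b.repr x i := by
  have hdet : (Matrix.of fun i j => N.coord (b i) (e j)).det ≠ 0 := by
    intro h0
    have h1 := N.abs_gram_det_eq_sq e b
    rw [h0, zero_pow two_ne_zero, Rat.cast_eq_zero, abs_eq_zero] at h1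
    exact hb h1
  have hli := Matrix.linearIndependent_rows_of_det_ne_zero hdet
  rcases isEmpty_or_nonempty β with hβ | hβ
  · exact ⟨Basis.empty _, fun i => hβ.elim i, fun _ i => hβ.elim i⟩
  let B : Basis β ℝ (β → ℝ) := basisOfLinearIndependentOfCardEqFinrank hli (by simp)
  have hB : ∀ i, B i = fun j => N.coord (b i) (e j) := fun i => by
    rw [coe_basisOfLinearIndependentOfCardEqFinrank]
    rfl
  refine ⟨B, hB, fun x i => ?_⟩
  have hx : (fun j => N.coord x (e j)) = ∑ i, (b.repr x i : ℝ) • B i := by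
    ext j
    conv_lhs => rw [← b.sum_repr x, coord_sum_smul]
    simp [hB]
  rw [hx, B.repr_sum_self]

theorem exists_mem_span_coord_eq {α β : Type*} (e : β ≃ κ × (S × Fin d)) (a : α → V)
    {A : α → β → ℝ} (hA : ∀ i, A i = fun j => N.coord (a i) (e j)) (y : β → ℝ) :
    y ∈ Submodule.span ℤ (Set.range A) ↔
      ∃ x ∈ Submodule.span ℤ (Set.range a), y = fun j => N.coord x (e j) := by
  let Φ : V →ₗ[ℤ] (β → ℝ) :=
    { toFun := fun x j => N.coord x (e j)
      map_add' := fun x y => by ext j; simp [coord]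
      map_smul' := fun c x => by
        ext j
        simp only [coord, Pi.smul_apply, map_zsmul]
        rfl }
  have h : Set.range A = Φ '' Set.range a := by
    rw [← Set.range_comp]
    congr 1
    ext i j
    simp [hA, Φ]
  rw [h, Submodule.span_image, Submodule.mem_map]
  exact ⟨fun ⟨x, hx, h⟩ => ⟨x, hx, h.symm⟩, fun ⟨x, hx, h⟩ => ⟨x, hx, h.symm⟩⟩

theorem gram_det_ne_zero_of_basis {α β : Type*} [Fintype α] [DecidableEq α] [Fintype β]
    [DecidableEq β] {φ : LinearMap.BilinForm ℚ V} (a : Basis α ℚ V) (b : Basis β ℚ V)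
    (ha : (gram φ a).det ≠ 0) : (gram φ b).det ≠ 0 := by
  let e := b.indexEquiv a
  have h1 : gram φ (b.reindex e) = gram φ (b ∘ e.symm) := by
    congr 1
    ext i
    simp
  have h2 := gram_det_basis_change φ a (b.reindex e)
  rw [h1, gram_det_reindex] at h2
  rw [h2]
  exact mul_ne_zero (pow_ne_zero _ (a.isUnit_det _).ne_zero) ha

/-- Minkowski's second theorem for a flag in the coordinates of an adapted norm. -/
theorem prod_sq_le {α β : Type*} [Fintype α] [DecidableEq α] [Fintype β] [LinearOrder β]
    (a : Basis α ℚ V) (ha : (gram (ψ.compr₂ T) a).det ≠ 0) (b : Basis β ℚ V) (h : β → ℝ)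
    (hpos : ∀ i, 0 < h i) (hmono : Monotone h)
    (hb : ∀ x ∈ Submodule.span ℤ (Set.range a), ∀ i, b.repr x i ≠ 0 → h i ^ 2 ≤ N.normSq x) :
    ∏ i, h i ^ 2 ≤ (Fintype.card β : ℝ) ^ Fintype.card β *
      ((|(gram (ψ.compr₂ T) a).det| : ℚ) : ℝ) := by
  have hcard : Fintype.card β = Fintype.card (κ × (S × Fin d)) := by
    rw [← finrank_eq_card_basis b, N.finrank_eq]
    simp
  let e := Fintype.equivOfCardEq hcard
  let a' := a.reindex (a.indexEquiv b)
  have ha' : (gram (ψ.compr₂ T) a').det ≠ 0 := gram_det_ne_zero_of_basis a a' ha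
  have haa : (gram (ψ.compr₂ T) a).det = (gram (ψ.compr₂ T) a').det := by
    rw [← gram_det_reindex _ a (a.indexEquiv b).symm]
    congr 2
    ext i
    simp [a']
  have hra : Set.range a' = Set.range a := Basis.range_reindex _ _
  obtain ⟨A, hA, -⟩ := N.exists_real_basis e a' ha'
  obtain ⟨B, hB, hBr⟩ := N.exists_real_basis e b (gram_det_ne_zero_of_basis a b ha)
  have key := prod_sq_le_card_pow_mul_det_sq A B h hpos hmono (by
    intro y hy i hi
    obtain ⟨x, hx, rfl⟩ := (N.exists_mem_span_coord_eq e a' hA y).1 hy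
    rw [hBr] at hi
    rw [e.sum_comp (fun k => N.coord x k ^ 2), ← N.normSq_eq_sum]
    exact hb x (by rwa [← hra]) i (by exact_mod_cast hi))
  rw [haa, N.abs_gram_det_eq_sq e a']
  convert key using 4
  ext i j
  simp [hA]

/-- A nonempty subset of a lattice contains a shortest vector. -/
theorem exists_min {α : Type*} [Fintype α] [DecidableEq α]
    (a : Basis α ℚ V) (ha : (gram (ψ.compr₂ T) a).det ≠ 0) (P : V → Prop)
    (hP : ∃ x ∈ Submodule.span ℤ (Set.range a), P x) :
    ∃ x ∈ Submodule.span ℤ (Set.range a), P x ∧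
      ∀ y ∈ Submodule.span ℤ (Set.range a), P y → N.normSq x ≤ N.normSq y := by
  have hcard : Fintype.card α = Fintype.card (κ × (S × Fin d)) := by
    rw [← finrank_eq_card_basis a, N.finrank_eq]
    simp
  let e := Fintype.equivOfCardEq hcard
  obtain ⟨A, hA, hAr⟩ := N.exists_real_basis e a ha
  obtain ⟨x₀, hx₀, hPx₀⟩ := hP
  have hinj : Function.Injective fun (x : V) j => N.coord x (e j) := by
    intro x y hxy
    apply a.repr.injective
    ext i
    have h1 := hAr x i
    have h2 := hAr y i
    simp only at hxy
    rw [hxy, h2] at h1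
    exact_mod_cast h1.symm
  have hfin : {x : V | x ∈ Submodule.span ℤ (Set.range a) ∧ P x ∧
      N.normSq x ≤ N.normSq x₀}.Finite := by
    refine Set.Finite.of_finite_image (f := fun x j => N.coord x (e j)) ?_ hinj.injOn
    refine (ZSpan.setFinite_inter A (s := Metric.closedBall 0 (Real.sqrt (N.normSq x₀)))
      Metric.isBounded_closedBall).subset ?_
    rintro _ ⟨x, ⟨hx, -, hle⟩, rfl⟩
    refine ⟨?_, (N.exists_mem_span_coord_eq e a hA _).2 ⟨x, hx, rfl⟩⟩
    rw [mem_closedBall_zero_iff, pi_norm_le_iff_of_nonneg (Real.sqrt_nonneg _)]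
    intro j
    refine Real.le_sqrt_of_sq_le (le_trans ?_ hle)
    rw [Real.norm_eq_abs, sq_abs, N.normSq_eq_sum]
    exact Finset.single_le_sum (f := fun k => N.coord x k ^ 2) (fun _ _ => sq_nonneg _)
      (Finset.mem_univ _)
  obtain ⟨x, ⟨hx, hPx, hle⟩, hmin⟩ := Set.exists_min_image _ N.normSq hfin ⟨x₀, hx₀, hPx₀, le_rfl⟩
  refine ⟨x, hx, hPx, fun y hy hPy => ?_⟩
  rcases le_total (N.normSq y) (N.normSq x₀) with h | h
  · exact hmin y ⟨hy, hPy, h⟩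
  · exact hle.trans h

theorem normSq_pos {α : Type*} [Fintype α] [DecidableEq α] (a : Basis α ℚ V)
    (ha : (gram (ψ.compr₂ T) a).det ≠ 0) {x : V} (hx : x ≠ 0) : 0 < N.normSq x := by
  have hcard : Fintype.card α = Fintype.card (κ × (S × Fin d)) := by
    rw [← finrank_eq_card_basis a, N.finrank_eq]
    simp
  let e := Fintype.equivOfCardEq hcard
  obtain ⟨A, hA, hAr⟩ := N.exists_real_basis e a ha
  refine lt_of_le_of_ne (N.normSq_nonneg x) fun h0 => hx ?_
  rw [N.normSq_eq_sum, eq_comm, Finset.sum_eq_zero_iff_of_nonneg (fun _ _ => sq_nonneg _)] at h0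
  apply a.repr.injective
  ext i
  have h1 := hAr x i
  have h2 : (fun j => N.coord x (e j)) = 0 := by
    ext j
    simpa using h0 (e j) (Finset.mem_univ _)
  rw [h2] at h1
  simpa using h1.symm

end AdaptedNorm

end AdaptedNormDefs

/-- Polar decomposition: an invertible skew-symmetric real matrix is congruent to an orthogonal
one. -/
theorem exists_orthogonal_congruent {κ : Type*} [Fintype κ] [DecidableEq κ] (A : Matrix κ κ ℝ)
    (hA : A.transpose = -A) (hdet : A.det ≠ 0) :
    ∃ P J : Matrix κ κ ℝ, J * J.transpose = 1 ∧ A = P * J * P.transpose := by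
  set B : Matrix κ κ ℝ := A.transpose * A with hB
  have hBpos : B.PosSemidef := by
    have := Matrix.posSemidef_conjTranspose_mul_self A
    rwa [Matrix.conjTranspose_eq_transpose_of_trivial] at this
  have hBsa : IsSelfAdjoint B := hBpos.isHermitian
  have hBunit : IsUnit B := by
    rw [Matrix.isUnit_iff_isUnit_det, hB, Matrix.det_mul, Matrix.det_transpose]
    exact (mul_ne_zero hdet hdet).isUnit
  have hspec : ∀ x ∈ spectrum ℝ B, 0 < x := by
    intro x hx
    refine lt_of_le_of_ne ?_ fun h0 => ?_
    · rw [hBpos.isHermitian.spectrum_real_eq_range_eigenvalues] at hx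
      obtain ⟨i, rfl⟩ := hx
      exact hBpos.eigenvalues_nonneg i
    · rw [← h0] at hx
      exact spectrum.zero_notMem ℝ hBunit hx
  -- P is the fourth root of B = AᵀA and Q its inverse. As B = -A², every function of B commutes
  -- with A. Hence J = Q A Q satisfies J Jᵀ = A Aᵀ Q⁴ = B B⁻¹ = 1, and P J P = A.
  set f : ℝ → ℝ := fun x => √(√x) with hf
  have hfc : ContinuousOn f (spectrum ℝ B) := by fun_prop
  have hfne : ∀ x ∈ spectrum ℝ B, f x ≠ 0 := fun x hx =>
    (Real.sqrt_pos.2 (Real.sqrt_pos.2 (hspec x hx))).ne'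
  have hgc : ContinuousOn (fun x => (f x)⁻¹) (spectrum ℝ B) := hfc.inv₀ hfne
  set P := cfc f B with hP
  set Q := cfc (fun x => (f x)⁻¹) B with hQ
  have hPQ : P * Q = 1 := by
    rw [hP, hQ, ← cfc_mul f (fun x => (f x)⁻¹) B hfc hgc, ← cfc_one ℝ B]
    exact cfc_congr fun x hx => mul_inv_cancel₀ (hfne x hx)
  have hQP : Q * P = 1 := mul_eq_one_comm.1 hPQ
  have hPsa : P.transpose = P := by
    have : IsSelfAdjoint P := cfc_predicate f B
    exact this
  have hQsa : Q.transpose = Q := by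
    have : IsSelfAdjoint Q := cfc_predicate _ B
    exact this
  have hBQ : B * Q ^ 4 = 1 := by
    conv_lhs => rw [← cfc_id' ℝ B]
    rw [hQ, ← cfc_pow _ 4 B hgc, ← cfc_mul (fun x => x) (fun x => (f x)⁻¹ ^ 4) B (by fun_prop)
      (hgc.pow 4), ← cfc_one ℝ B]
    refine cfc_congr fun x hx => ?_
    have h1 : f x ^ 4 = x := by
      have := hspec x hx
      rw [show f x ^ 4 = (f x ^ 2) ^ 2 by ring, hf]
      rw [Real.sq_sqrt (Real.sqrt_nonneg _), Real.sq_sqrt this.le]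
    rw [inv_pow, h1, Pi.one_apply, mul_inv_cancel₀ (hspec x hx).ne']
  have hcomm : Commute Q A := by
    refine Commute.cfc_real ?_ _
    rw [hB, hA]
    simp [Commute, SemiconjBy, Matrix.mul_assoc]
  refine ⟨P, Q * A * Q, ?_, ?_⟩
  · rw [Matrix.transpose_mul, Matrix.transpose_mul, hQsa, hcomm.eq]
    calc A * Q * Q * (Q * (A.transpose * Q)) = A * (Q * (Q * Q)) * A.transpose * Q := by
          simp only [Matrix.mul_assoc]
      _ = (A * A.transpose) * Q ^ 4 := by
        have h1 : Commute (Q * (Q * Q)) A.transpose := by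
          rw [hA]
          exact ((hcomm.mul_left (hcomm.mul_left hcomm))).neg_right
        rw [Matrix.mul_assoc A, h1.eq]
        simp only [Matrix.mul_assoc, pow_succ, pow_zero, Matrix.one_mul]
      _ = 1 := by
        rw [← hBQ, hB, hA]
        simp
  · rw [hPsa]
    calc A = (P * Q) * A * (Q * P) := by rw [hPQ, hQP]; simp
      _ = _ := by simp only [Matrix.mul_assoc]

/-! ### The form in a D-basis, and the existence of adapted norms. -/

section Forms

variable {D : Type v} [DivisionRing D] [CharZero D] [StarRing D] {T : D →ₗ[ℚ] ℚ} {d : ℕ}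
  {S : Type u} [Fintype S] {V : Type w} [AddCommGroup V] [Module ℚ V] [Module D V]
  (σ : Splitting T d S) {ψ : V →ₗ[ℚ] V →ₗ[ℚ] D}

theorem IsSesquilinear.smul_left (h : IsSesquilinear ψ) (a : D) (x y : V) :
    ψ (a • x) y = a * ψ x y := by
  have := h a 1 x y
  rwa [one_smul, star_one, mul_one] at this

theorem IsSesquilinear.smul_right (h : IsSesquilinear ψ) (a : D) (x y : V) :
    ψ x (a • y) = ψ x y * star a := by
  have := h 1 a x y
  rwa [one_smul, one_mul] at this

/-- The coordinates of a vector in a `D`-basis, represented by real matrices. -/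
noncomputable def Splitting.basisCoord {m : ℕ} (u : Basis (Fin m) D V) :
    V →ₗ[ℚ] (S → Matrix (Fin d) (Fin m × Fin d) ℝ) :=
  AddMonoidHom.toRatLinearMap
    { toFun := fun x s => Matrix.of fun p iq => σ.ρ s (u.repr x iq.1) p iq.2
      map_zero' := by ext; simp
      map_add' := fun x y => by ext; simp }

/-- The matrix of the form in a `D`-basis, represented by a real matrix. -/
noncomputable def Splitting.formMatrix {ι : Type*} (ψ : V →ₗ[ℚ] V →ₗ[ℚ] D)
    (x : ι → V) (s : S) : Matrix (ι × Fin d) (ι × Fin d) ℝ :=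
  Matrix.of fun ip jq => σ.ρ s (ψ (x ip.1) (x jq.1)) ip.2 jq.2

theorem Splitting.basisCoord_apply {m : ℕ} (u : Basis (Fin m) D V) (x : V) (s : S) (p : Fin d)
    (iq : Fin m × Fin d) : σ.basisCoord u x s p iq = σ.ρ s (u.repr x iq.1) p iq.2 := rfl

theorem Splitting.form_eq_basisCoord (hψ : IsSesquilinear ψ) {m : ℕ} (u : Basis (Fin m) D V)
    (x y : V) (s : S) :
    σ.ρ s (ψ x y) = σ.basisCoord u x s * σ.formMatrix ψ u s * (σ.basisCoord u y s).transpose := by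
  conv_lhs => rw [← u.sum_repr x, ← u.sum_repr y]
  simp only [map_sum, LinearMap.sum_apply, hψ _ _ _ _, map_mul, σ.ρ_star]
  ext p q
  simp only [Matrix.sum_apply, Matrix.mul_apply, Matrix.transpose_apply, Fintype.sum_prod_type,
    σ.basisCoord_apply, Splitting.formMatrix, Matrix.of_apply]
  refine Finset.sum_congr rfl fun j _ => ?_
  rw [Finset.sum_comm]
  exact Finset.sum_congr rfl fun t _ => (Finset.sum_mul _ _ _).symm

theorem Splitting.finrank_eq_card_mul (σ : Splitting T d S) [IsScalarTower ℚ D V] {m : ℕ} (u : Basis (Fin m) D V) :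
    finrank ℚ V = Fintype.card (Fin m × Fin d) * (Fintype.card S * d) := by
  have := σ.finiteDimensional
  have := u.finiteDimensional_of_finite
  rw [← finrank_mul_finrank ℚ D V, finrank_eq_card_basis u, σ.finrank_eq]
  simp
  ring

theorem gram_det_ne_zero_of_nondegenerate {φ : LinearMap.BilinForm ℚ V}
    (h : ∀ x, x ≠ 0 → ∃ y, φ x y ≠ 0) {α : Type*} [Fintype α] [DecidableEq α]
    (a : Basis α ℚ V) : (gram φ a).det ≠ 0 := by
  intro h0
  obtain ⟨c, hc0, hc⟩ := Matrix.exists_vecMul_eq_zero_iff.2 h0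
  have hx : ∑ i, c i • a i ≠ 0 := by
    intro hx
    apply hc0
    ext i
    exact Fintype.linearIndependent_iff.1 a.linearIndependent c hx i
  obtain ⟨y, hy⟩ := h _ hx
  apply hy
  rw [← a.sum_repr y, map_sum]
  refine Finset.sum_eq_zero fun j _ => ?_
  have h1 := congrFun hc j
  rw [map_smul, map_sum, LinearMap.sum_apply]
  simp only [map_smul, LinearMap.smul_apply]
  have h2 : ∑ i, c i • φ (a i) (a j) = 0 := by
    simpa [Matrix.vecMul, dotProduct, gram] using h1
  rw [h2, smul_zero]

/-- Scaling y turns the value ψ(x, y) into 1, whose trace is positive. So non-degeneracy, and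
orthogonality to a D-subspace, can be tested on the trace form. -/
theorem Splitting.exists_trace_form_ne_zero (σ : Splitting T d S) (hψ : IsSesquilinear ψ) {x y : V} (h : ψ x y ≠ 0) :
    ∃ a : D, ψ.compr₂ T x (a • y) ≠ 0 := by
  refine ⟨star (ψ x y)⁻¹, ?_⟩
  rw [LinearMap.compr₂_apply, hψ.smul_right, star_star, mul_inv_cancel₀ h]
  exact σ.T_one_pos.ne'

theorem Splitting.gram_det_ne_zero (σ : Splitting T d S) (hψ : IsSesquilinear ψ) (hnd : IsNondegenerate ψ) {α : Type*}
    [Fintype α] [DecidableEq α] (a : Basis α ℚ V) : (gram (ψ.compr₂ T) a).det ≠ 0 := by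
  refine gram_det_ne_zero_of_nondegenerate (fun x hx => ?_) a
  obtain ⟨y, hy⟩ := hnd x hx
  obtain ⟨a, ha⟩ := σ.exists_trace_form_ne_zero hψ hy
  exact ⟨_, ha⟩

theorem Splitting.abs_gram_det_eq [IsScalarTower ℚ D V] (hψ : IsSesquilinear ψ) {m : ℕ}
    (u : Basis (Fin m) D V)
    {α : Type*} [Fintype α] [DecidableEq α] (a : Basis α ℚ V) :
    ((|(gram (ψ.compr₂ T) a).det| : ℚ) : ℝ) =
      |(Matrix.of fun i j => ∑ s, (σ.basisCoord u (a i) s *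
        (σ.basisCoord u (a j) s).transpose).trace).det| * ∏ s, |(σ.formMatrix ψ u s).det| ^ d := by
  classical
  rw [Rat.abs_det_cast, gram_map_eq (σ.form_eq_basisCoord hψ u)]
  refine abs_det_trace_form (fun i s => σ.basisCoord u (a i) s) _ ?_
  rw [← finrank_eq_card_basis a, σ.finrank_eq_card_mul u]
  simp

/-- A nondegenerate skew-Hermitian form has an adapted norm. -/
theorem Splitting.exists_adaptedNorm [IsScalarTower ℚ D V] (hψ : IsSkewHermitian ψ)
    (hnd : IsNondegenerate ψ) {m : ℕ} (u : Basis (Fin m) D V) :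
    Nonempty (AdaptedNorm σ ψ (Fin m × Fin d)) := by
  have := σ.finiteDimensional
  have hse : IsSesquilinear ψ := hψ.2
  -- A singular matrix at a single place would already make the rational trace form degenerate.
  have hdet : ∀ s, (σ.formMatrix ψ u s).det ≠ 0 := by
    intro s h0
    let a := (finBasis ℚ D).smulTower u
    have h1 := σ.abs_gram_det_eq hse u a
    have h2 : ∏ s, |(σ.formMatrix ψ u s).det| ^ d = 0 := by
      refine Finset.prod_eq_zero (Finset.mem_univ s) ?_
      rw [h0, abs_zero, zero_pow σ.d_pos.ne']
    rw [h2, mul_zero, Rat.cast_eq_zero, abs_eq_zero] at h1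
    exact σ.gram_det_ne_zero hse hnd a h1
  have hskew : ∀ s, (σ.formMatrix ψ u s).transpose = -σ.formMatrix ψ u s := by
    intro s
    ext ⟨i, p⟩ ⟨j, q⟩
    simp only [formMatrix, Matrix.transpose_apply, Matrix.of_apply, Matrix.neg_apply]
    rw [hψ.1 (u i) (u j), map_neg, σ.ρ_star]
    rfl
  choose P J hJ hPJ using fun s => exists_orthogonal_congruent _ (hskew s) (hdet s)
  exact ⟨{
    X := AddMonoidHom.toRatLinearMap
      { toFun := fun x s => σ.basisCoord u x s * P s
        map_zero' := by ext; simp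
        map_add' := fun x y => by
          funext s
          simp only [map_add, Pi.add_apply, Matrix.add_mul] }
    J := J
    J_orthogonal := hJ
    form_eq := fun x y s => by
      rw [σ.form_eq_basisCoord hse u x y s, hPJ s]
      simp [Matrix.mul_assoc, Matrix.transpose_mul]
    finrank_eq := σ.finrank_eq_card_mul u }⟩

/-- The discriminant of the lattice `∑ R vᵢ` spanned by a basis over an order `R`. -/
theorem Splitting.abs_gram_det_smulTower [IsScalarTower ℚ D V] (hψ : IsSesquilinear ψ) {m : ℕ}
    (v : Basis (Fin m) D V) {α : Type*} [Fintype α] [DecidableEq α] (r : Basis α ℚ D) :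
    ((|(gram (ψ.compr₂ T) (r.smulTower v)).det| : ℚ) : ℝ) =
      |((Matrix.of fun i j => T (r i * star (r j))).det : ℝ)| ^ m *
        ∏ s, |(σ.formMatrix ψ v s).det| ^ d := by
  rw [σ.abs_gram_det_eq hψ v]
  congr 1
  -- The vectors r_i v_k with fixed k only have a k-th coordinate, so the Euclidean Gram matrix
  -- consists of m copies of that of T(a b†) on R.
  have h : (Matrix.of fun i j => ∑ s, (σ.basisCoord v (r.smulTower v i) s *
      (σ.basisCoord v (r.smulTower v j) s).transpose).trace) =
      Matrix.blockDiagonal fun _ : Fin m =>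
        (Matrix.of fun i j => T (r i * star (r j))).map (Rat.cast : ℚ → ℝ) := by
    ext ⟨i, k⟩ ⟨j, l⟩
    rw [Matrix.of_apply, Matrix.blockDiagonal_apply]
    have h1 : ∀ (i : α) (k : Fin m) s, σ.basisCoord v (r.smulTower v (i, k)) s =
        Matrix.of fun p iq => if k = iq.1 then σ.ρ s (r i) p iq.2 else 0 := by
      intro i k s
      ext p ⟨a, q⟩
      rw [σ.basisCoord_apply]
      simp only [Basis.smulTower_apply, map_smul, Basis.repr_self, Finsupp.smul_apply,
        Finsupp.single_apply, Matrix.of_apply]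
      split_ifs <;> simp
    simp only [h1]
    split_ifs with hkl
    · subst hkl
      simp only [Matrix.map_apply, Matrix.of_apply, σ.trace_eq, map_mul, σ.ρ_star]
      refine Finset.sum_congr rfl fun s _ => ?_
      simp [Matrix.trace, Matrix.mul_apply, Fintype.sum_prod_type]
    · refine Finset.sum_eq_zero fun s _ => ?_
      simp only [Matrix.trace, Matrix.mul_apply, Matrix.diag_apply, Matrix.transpose_apply,
        Matrix.of_apply, Fintype.sum_prod_type]
      refine Finset.sum_eq_zero fun p _ => Finset.sum_eq_zero fun a _ =>
        Finset.sum_eq_zero fun q _ => ?_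
      by_cases hk : k = a
      · subst hk
        simp [Ne.symm hkl]
      · simp [hk]
  rw [h, Matrix.det_blockDiagonal, Finset.prod_const, Finset.card_univ, Fintype.card_fin, abs_pow]
  congr 2
  exact (RingHom.map_det (Rat.castHom ℝ) _).symm

end Forms

/-! ### Discriminants of orders and lower bounds for their elements. -/

section OrderDisc

variable {D : Type v} [DivisionRing D] [CharZero D] [StarRing D] {T : D →ₗ[ℚ] ℚ} {d : ℕ}
  {S : Type u} [Fintype S] (σ : Splitting T d S)

theorem Splitting.T_star (σ : Splitting T d S) (a : D) : T (star a) = T a := by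
  have h : (T (star a) : ℝ) = T a := by
    rw [σ.trace_eq, σ.trace_eq]
    exact Finset.sum_congr rfl fun s _ => by rw [σ.ρ_star, Matrix.trace_transpose]
  exact_mod_cast h

/-- The form `(a, b) ↦ T (a b)` on `D`. -/
noncomputable def mulForm (T : D →ₗ[ℚ] ℚ) : LinearMap.BilinForm ℚ D :=
  (LinearMap.mul ℚ D).compr₂ T

/-- The absolute value of the discriminant of the trace form of a `ℚ`-basis of `D`. -/
noncomputable def redDisc (T : D →ₗ[ℚ] ℚ) {α : Type*} [Fintype α] [DecidableEq α]
    (r : Basis α ℚ D) : ℝ := ((|(gram (mulForm T) r).det| : ℚ) : ℝ)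

variable {α : Type*} [Fintype α] [DecidableEq α] (r : Basis α ℚ D)

/-- The involution is ℚ-linear with square one, so its determinant is ±1. Passing between T(a b†)
and T(a b) therefore costs nothing, even if R is not stable under †. -/
theorem abs_det_star_eq_redDisc :
    |((Matrix.of fun i j => T (r i * star (r j))).det : ℝ)| = redDisc T r := by
  let st : D →ₗ[ℚ] D := (AddMonoidHom.toRatLinearMap
    { toFun := fun a => star a, map_zero' := star_zero D, map_add' := star_add })
  have hst : ∀ a, st a = star a := fun a => rfl
  set Q := LinearMap.toMatrix r r st with hQ
  have hQQ : Q * Q = 1 := by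
    rw [hQ, ← LinearMap.toMatrix_comp, ← LinearMap.toMatrix_id r]
    congr 1
    ext a
    simp [hst]
  have hdet : |Q.det| = 1 := by
    have := congrArg Matrix.det hQQ
    rw [Matrix.det_mul, Matrix.det_one, ← sq, ← sq_abs] at this
    nlinarith [abs_nonneg Q.det]
  have h : (Matrix.of fun i j => T (r i * star (r j))) = gram (mulForm T) r * Q := by
    ext i j
    rw [Matrix.of_apply, ← hst, ← r.sum_repr (st (r j)), Finset.mul_sum, map_sum,
      Matrix.mul_apply]
    refine Finset.sum_congr rfl fun k _ => ?_
    rw [mul_smul_comm, map_smul, hQ, LinearMap.toMatrix_apply, smul_eq_mul, mul_comm]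
    rfl
  rw [redDisc, h, Matrix.det_mul, ← Rat.cast_abs, abs_mul, hdet, mul_one]

/-- The norm form `(x, y) ↦ x y†` of `D`. -/
noncomputable def hermForm (D : Type v) [DivisionRing D] [CharZero D] [StarRing D] :
    D →ₗ[ℚ] D →ₗ[ℚ] D :=
  AddMonoidHom.toRatLinearMap
    { toFun := fun x => AddMonoidHom.toRatLinearMap
        { toFun := fun y => x * star y
          map_zero' := by simp
          map_add' := fun y z => by simp [mul_add] }
      map_zero' := by ext; simp
      map_add' := fun x y => by ext; simp [add_mul] }

theorem hermForm_apply (x y : D) : hermForm D x y = x * star y := rfl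

theorem isSesquilinear_hermForm : IsSesquilinear (hermForm D) := by
  intro a b x y
  simp [hermForm_apply, mul_assoc]

/-- The adapted norm of `D` with its norm form. -/
noncomputable def Splitting.adaptedNorm : AdaptedNorm σ (hermForm D) (Fin d) where
  X := AddMonoidHom.toRatLinearMap
    { toFun := fun x s => σ.ρ s x
      map_zero' := by funext; simp
      map_add' := fun x y => by funext; simp }
  J := fun _ => 1
  J_orthogonal := fun _ => by simp
  form_eq := fun x y s => by
    rw [hermForm_apply, map_mul, σ.ρ_star, Matrix.mul_one]
    rfl
  finrank_eq := by simp [σ.finrank_eq]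

theorem Splitting.adaptedNorm_normSq (a : D) : σ.adaptedNorm.normSq a = σ.normSq a := rfl

theorem Splitting.hermForm_nondegenerate : IsNondegenerate (hermForm D) := by
  intro x hx
  exact ⟨1, by simpa [hermForm_apply] using hx⟩

theorem Splitting.abs_gram_hermForm :
    ((|(gram ((hermForm D).compr₂ T) r).det| : ℚ) : ℝ) = redDisc T r := by
  rw [← abs_det_star_eq_redDisc r, Rat.cast_abs]
  rfl

theorem Splitting.gram_hermForm_ne_zero (σ : Splitting T d S) :
    (gram ((hermForm D).compr₂ T) r).det ≠ 0 :=
  σ.gram_det_ne_zero isSesquilinear_hermForm Splitting.hermForm_nondegenerate r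

theorem Splitting.redDisc_pos (σ : Splitting T d S) : 0 < redDisc T r := by
  rw [← Splitting.abs_gram_hermForm r]
  exact_mod_cast abs_pos.2 (σ.gram_hermForm_ne_zero r)

theorem Splitting.detProd_mul (a b : D) : σ.detProd (a * b) = σ.detProd a * σ.detProd b := by
  simp only [detProd, map_mul, Matrix.det_mul, abs_mul, mul_pow, Finset.prod_mul_distrib]

theorem Splitting.detProd_star (a : D) : σ.detProd (star a) = σ.detProd a := by
  simp only [detProd, σ.ρ_star, Matrix.det_transpose]

theorem Splitting.prod_det_formMatrix_orthogonal {V : Type w} [AddCommGroup V] [Module ℚ V]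
    (ψ : V →ₗ[ℚ] V →ₗ[ℚ] D)
    {m : ℕ} (v : Fin m → V) (hv : ∀ i j, i ≠ j → ψ (v i) (v j) = 0) :
    ∏ s, |(σ.formMatrix ψ v s).det| ^ d = ∏ i, σ.detProd (ψ (v i) (v i)) := by
  have h : ∀ s, |(σ.formMatrix ψ v s).det| = ∏ i, |(σ.ρ s (ψ (v i) (v i))).det| := by
    intro s
    rw [← Matrix.det_reindex_self (Equiv.prodComm _ _),
      show Matrix.reindex (Equiv.prodComm _ _) (Equiv.prodComm _ _) (σ.formMatrix ψ v s) =
        Matrix.blockDiagonal fun i => σ.ρ s (ψ (v i) (v i)) from ?_, Matrix.det_blockDiagonal,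
      Finset.abs_prod]
    ext ⟨p, i⟩ ⟨q, j⟩
    rw [Matrix.blockDiagonal_apply]
    by_cases hij : i = j
    · subst hij
      simp [formMatrix]
    · simp [formMatrix, hij, hv i j hij]
  simp only [h, ← Finset.prod_pow]
  exact Finset.prod_comm

/-- In a hyperbolic pair the determinant of the form is the square of the off-diagonal entry. -/
theorem Splitting.prod_det_formMatrix_pair {V : Type w} [AddCommGroup V] [Module ℚ V]
    {ψ : V →ₗ[ℚ] V →ₗ[ℚ] D} (hskew : ∀ x y, ψ y x = -star (ψ x y))
    (v : Fin 2 → V) (h0 : ψ (v 0) (v 0) = 0) :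
    ∏ s, |(σ.formMatrix ψ v s).det| ^ d = σ.detProd (ψ (v 0) (v 1)) ^ 2 := by
  have h : ∀ s, |(σ.formMatrix ψ v s).det| = |(σ.ρ s (ψ (v 0) (v 1))).det| ^ 2 := by
    intro s
    -- Exchanging the two block columns makes the matrix block triangular because ψ(v 0, v 0) = 0;
    -- the value ψ(v 1, v 1) then plays no role.
    let e1 : Fin d ⊕ Fin d ≃ Fin 2 × Fin d :=
      (Equiv.boolProdEquivSum (Fin d)).symm.trans ((finTwoEquiv.symm).prodCongr (Equiv.refl _))
    have h1 := Matrix.abs_det_submatrix_equiv_equiv e1 ((Equiv.sumComm _ _).trans e1)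
      (σ.formMatrix ψ v s)
    rw [← h1, show (σ.formMatrix ψ v s).submatrix e1 ((Equiv.sumComm _ _).trans e1) =
        Matrix.fromBlocks (σ.ρ s (ψ (v 0) (v 1))) 0
          (σ.ρ s (ψ (v 1) (v 1))) (σ.ρ s (ψ (v 1) (v 0))) from ?_,
      Matrix.det_fromBlocks_zero₁₂, hskew (v 0) (v 1), map_neg, σ.ρ_star,
      Matrix.det_neg, Matrix.det_transpose]
    · simp [abs_mul, sq]
    · have hf : finTwoEquiv.symm false = 0 := rfl
      have ht : finTwoEquiv.symm true = 1 := rfl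
      ext (a | a) (b | b) <;> simp [formMatrix, e1, h0, hf, ht]
  simp only [h, detProd, ← Finset.prod_pow]
  exact Finset.prod_congr rfl fun s _ => by rw [← pow_mul, ← pow_mul, mul_comm]

/-- The non-reduced trace is d times T, so every entry of the Gram matrix acquires a factor d. -/
theorem abs_orderDisc_eq (σ : Splitting T d S) (R : Subalgebra ℤ D)
    (hr : Subalgebra.toSubmodule R = Submodule.span ℤ (Set.range r)) :
    |(orderDisc R : ℝ)| = (d : ℝ) ^ finrank ℚ D * redDisc T r := by
  have h : gram ((LinearMap.mul ℚ D).compr₂ (fullTrace ℚ D)) r = (d : ℚ) • gram (mulForm T) r := by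
    ext i j
    simp [gram, mulForm, σ.fullTrace_eq]
  rw [orderDisc, hr, disc_span_basis, h, Matrix.det_smul, ← finrank_eq_card_basis r, redDisc,
    Rat.cast_abs, Rat.cast_mul, abs_mul]
  simp

/-- A nonzero element of an order has norm at least one. -/
theorem Splitting.one_le_detProd (R : Subalgebra ℤ D)
    (hr : Subalgebra.toSubmodule R = Submodule.span ℤ (Set.range r)) {a : D} (ha : a ∈ R)
    (ha0 : a ≠ 0) : 1 ≤ σ.detProd a := by
  have hmem : ∀ x, x ∈ R ↔ x ∈ Submodule.span ℤ (Set.range r) := fun x => by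
    rw [← hr, Subalgebra.mem_toSubmodule]
  -- The lattice R a lies in R and its discriminant is `σ.detProd a ^ 2` times that of R. So
  -- `σ.detProd a` is the index of R a in R, a positive integer.
  let v : Basis (Fin 1) D D := (Basis.singleton (Fin 1) D).isUnitSMul (w := fun _ => a)
    (fun _ => isUnit_iff_ne_zero.2 ha0)
  have hv : ∀ i, v i = a := fun i => by simp [v, Basis.isUnitSMul_apply]
  let u' := r.smulTower v
  let u := u'.reindex (Equiv.prodUnique α (Fin 1))
  have hu : ∀ i, u i = r i * a := fun i => by simp [u, u', hv]
  have hidx := relIndex_sq_mul_gram_det ((hermForm D).compr₂ T) r u (fun i => by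
    rw [hu, ← hmem]
    exact R.mul_mem ((hmem _).2 (Submodule.subset_span ⟨i, rfl⟩)) ha)
  have hne := relIndex_span_basis_ne_zero r u (fun i => by
    rw [hu, ← hmem]
    exact R.mul_mem ((hmem _).2 (Submodule.subset_span ⟨i, rfl⟩)) ha)
  set k := (Submodule.span ℤ (Set.range u)).toAddSubgroup.relIndex
      (Submodule.span ℤ (Set.range r)).toAddSubgroup
  have h1 : (gram ((hermForm D).compr₂ T) u).det = (gram ((hermForm D).compr₂ T) u').det := by
    rw [← gram_det_reindex _ u' (Equiv.prodUnique α (Fin 1)).symm]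
    congr 2
    ext i
    simp [u]
  have h2 := σ.abs_gram_det_smulTower isSesquilinear_hermForm v r
  rw [abs_det_star_eq_redDisc, pow_one, σ.prod_det_formMatrix_orthogonal _ _
    (fun i j hij => (hij (Subsingleton.elim _ _)).elim)] at h2
  simp only [Finset.univ_unique, Finset.prod_singleton, hv, hermForm_apply, detProd_mul,
    detProd_star] at h2
  have h3 := congrArg (fun q : ℚ => ((|q| : ℚ) : ℝ)) hidx
  simp only [h1] at h3
  rw [show (|(gram ((hermForm D).compr₂ T) u').det| : ℚ) = ((|(gram ((hermForm D).compr₂ T)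
    (r.smulTower v)).det| : ℚ)) from rfl, h2, abs_mul, Rat.cast_mul, Splitting.abs_gram_hermForm,
    mul_comm] at h3
  have h4 := mul_left_cancel₀ (σ.redDisc_pos r).ne' h3
  rw [abs_pow, Nat.abs_cast, Rat.cast_pow, Rat.cast_natCast, ← sq] at h4
  have h5 : (k : ℝ) = σ.detProd a :=
    (pow_left_inj₀ (Nat.cast_nonneg _) (σ.detProd_pos ha0).le two_ne_zero).1 h4
  rw [← h5]
  exact_mod_cast Nat.one_le_iff_ne_zero.2 hne

/-- A nonzero element of an order is not too short. -/
theorem Splitting.le_normSq (hd : d = 1 ∨ d = 2) (R : Subalgebra ℤ D)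
    (hr : Subalgebra.toSubmodule R = Submodule.span ℤ (Set.range r)) {a : D} (ha : a ∈ R)
    (ha0 : a ≠ 0) : (d * Fintype.card S : ℝ) ≤ σ.normSq a := by
  have h1 := σ.one_le_detProd r R hr ha ha0
  have h2 := (one_le_pow₀ h1 (n := 2)).trans (σ.detProd_sq_le hd a)
  have := σ.d_pos
  have := σ.card_pos
  by_contra! hlt
  have h3 : σ.normSq a / (d * Fintype.card S) < 1 := by
    rw [div_lt_one (by positivity)]
    exact hlt
  have h4 : finrank ℚ D ≠ 0 := by
    rw [σ.finrank_eq]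
    positivity
  exact absurd h2 (not_le.2 (pow_lt_one₀ (div_nonneg (σ.normSq_nonneg a) (by positivity)) h3 h4))

end OrderDisc

theorem exists_smul_mem_of_isLattice {V : Type*} [AddCommGroup V] [Module ℚ V] (L : Submodule ℤ V)
    [hL : Submodule.IsLattice ℚ L] (x : V) : ∃ n : ℤ, n ≠ 0 ∧ n • x ∈ L := by
  have hx : x ∈ Submodule.span ℚ (L : Set V) := by
    rw [Submodule.IsLattice.span_eq_top]
    trivial
  induction hx using Submodule.span_induction with
  | mem x hx => exact ⟨1, one_ne_zero, by simpa using hx⟩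
  | zero => exact ⟨1, one_ne_zero, by simp⟩
  | add x y _ _ hx hy =>
    obtain ⟨n, hn, hnx⟩ := hx
    obtain ⟨k, hk, hky⟩ := hy
    refine ⟨n * k, mul_ne_zero hn hk, ?_⟩
    rw [smul_add]
    refine L.add_mem ?_ ?_
    · rw [mul_comm, mul_smul]
      exact L.smul_mem _ hnx
    · rw [mul_smul]
      exact L.smul_mem _ hky
  | smul q x _ hx =>
    obtain ⟨n, hn, hnx⟩ := hx
    refine ⟨q.den * n, mul_ne_zero (by exact_mod_cast q.den_nz) hn, ?_⟩
    have h : ((q.den * n : ℤ)) • q • x = q.num • n • x := by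
      simp only [← Int.cast_smul_eq_zsmul ℚ, smul_smul]
      congr 1
      push_cast
      rw [mul_right_comm, Rat.den_mul_eq_num]
    rw [h]
    exact L.smul_mem _ hnx

/-! ### Lattices with a form, their sublattices, and orthogonal complements. -/

section Restriction

variable {D : Type v} [DivisionRing D] [CharZero D] [StarRing D] {T : D →ₗ[ℚ] ℚ} {d : ℕ}
  {S : Type u} [Fintype S] {V : Type w} [AddCommGroup V] [Module ℚ V] [Module D V]

/-- A lattice, stable under an order, with an integral nondegenerate skew-Hermitian form. -/
structure IsFormLattice (T : D →ₗ[ℚ] ℚ) (R : Subalgebra ℤ D) (ψ : V →ₗ[ℚ] V →ₗ[ℚ] D)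
    (L : Submodule ℤ V) : Prop where
  skew : IsSkewHermitian ψ
  nondeg : IsNondegenerate ψ
  lattice : Submodule.IsLattice ℚ L
  integral : ∀ x ∈ L, ∀ y ∈ L, ∃ z : ℤ, T (ψ x y) = z
  stable : ∀ a ∈ R, ∀ x ∈ L, a • x ∈ L

/-- The restriction of the form to a subspace. -/
noncomputable def restrictForm (ψ : V →ₗ[ℚ] V →ₗ[ℚ] D) (W : Submodule D V) :
    W →ₗ[ℚ] W →ₗ[ℚ] D :=
  ψ.compl₁₂ (W.subtype.restrictScalars ℚ) (W.subtype.restrictScalars ℚ)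

@[simp]
theorem restrictForm_apply (ψ : V →ₗ[ℚ] V →ₗ[ℚ] D) (W : Submodule D V) (x y : W) :
    restrictForm ψ W x y = ψ x y := rfl

/-- The intersection of a lattice with a subspace. -/
def restrictLattice (L : Submodule ℤ V) (W : Submodule D V) : Submodule ℤ W :=
  L.comap (W.subtype.restrictScalars ℤ)

@[simp]
theorem mem_restrictLattice {L : Submodule ℤ V} {W : Submodule D V} {x : W} :
    x ∈ restrictLattice L W ↔ (x : V) ∈ L := Iff.rfl

theorem isLattice_restrictLattice (L : Submodule ℤ V) [Submodule.IsLattice ℚ L]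
    (W : Submodule D V) : Submodule.IsLattice ℚ (restrictLattice L W) where
  fg := by
    have : IsNoetherian ℤ L := inferInstance
    let f : restrictLattice L W →ₗ[ℤ] L :=
      ((W.subtype.restrictScalars ℤ).comp (restrictLattice L W).subtype).codRestrict L
        fun x => x.2
    have hf : Function.Injective f := by
      intro x y hxy
      have := congrArg (fun z : L => (z : V)) hxy
      exact Subtype.ext (Subtype.ext this)
    have := isNoetherian_of_injective f hf
    exact (Submodule.fg_top _).1 (IsNoetherian.noetherian _)
  span_eq_top := by
    rw [eq_top_iff]
    rintro x -
    obtain ⟨n, hn, hx⟩ := exists_smul_mem_of_isLattice L (x : V)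
    have h1 : n • x ∈ restrictLattice L W := by
      rw [mem_restrictLattice, Submodule.coe_smul_of_tower]
      exact hx
    have h2 := Submodule.smul_mem (Submodule.span ℚ (restrictLattice L W : Set W)) ((n : ℚ)⁻¹)
      (Submodule.subset_span h1)
    rwa [← Int.cast_smul_eq_zsmul ℚ, smul_smul, inv_mul_cancel₀ (by exact_mod_cast hn),
      one_smul] at h2

theorem IsFormLattice.restrict {R : Subalgebra ℤ D} {ψ : V →ₗ[ℚ] V →ₗ[ℚ] D} {L : Submodule ℤ V}
    (h : IsFormLattice T R ψ L) {W : Submodule D V} (hW : IsNondegenerate (restrictForm ψ W)) :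
    IsFormLattice T R (restrictForm ψ W) (restrictLattice L W) where
  skew := ⟨fun x y => h.skew.1 x y, fun a b x y => h.skew.2 a b x y⟩
  nondeg := hW
  lattice := have := h.lattice; isLattice_restrictLattice L W
  integral := fun x hx y hy => h.integral x hx y hy
  stable := fun a ha x hx => h.stable a ha x hx

/-- The orthogonal complement of a subspace. -/
def orthogonal {ψ : V →ₗ[ℚ] V →ₗ[ℚ] D} (hψ : IsSesquilinear ψ) (W : Submodule D V) :
    Submodule D V where
  carrier := {y | ∀ x ∈ W, ψ y x = 0}
  add_mem' := fun {a b} ha hb x hx => by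
    rw [map_add, LinearMap.add_apply, ha x hx, hb x hx, add_zero]
  zero_mem' := fun x _ => by rw [map_zero, LinearMap.zero_apply]
  smul_mem' := fun c y hy x hx => by rw [hψ.smul_left, hy x hx, mul_zero]

theorem IsSkewHermitian.eq_zero_comm {ψ : V →ₗ[ℚ] V →ₗ[ℚ] D} (hψ : IsSkewHermitian ψ) {x y : V}
    (h : ψ x y = 0) : ψ y x = 0 := by
  rw [hψ.1 x y, h, star_zero, neg_zero]

/-- On W the map x ↦ ψ(x, ·), read off on a basis, is injective by non-degeneracy, hence bijective
by dimension. So every vector of V has an orthogonal projection to W. -/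
theorem isCompl_orthogonal {ψ : V →ₗ[ℚ] V →ₗ[ℚ] D} (hψ : IsSkewHermitian ψ)
    {W : Submodule D V} (hW : IsNondegenerate (restrictForm ψ W)) [Module.Finite D W] :
    IsCompl W (orthogonal hψ.2 W) := by
  have hse : IsSesquilinear ψ := hψ.2
  let b := finBasis D W
  let f : W →ₗ[D] (Fin (finrank D W) → D) :=
    { toFun := fun x j => ψ x (b j)
      map_add' := fun x y => by ext; simp
      map_smul' := fun c x => by ext; simp [hse.smul_left] }
  have hext : ∀ y : V, (∀ j, ψ y (b j) = 0) → ∀ x ∈ W, ψ y x = 0 := by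
    intro y hy x hx
    have h1 : x = ∑ j, b.repr ⟨x, hx⟩ j • (b j : V) := by
      have := congrArg (fun z : W => (z : V)) (b.sum_repr ⟨x, hx⟩)
      simp only [AddSubmonoidClass.coe_finsetSum, Submodule.coe_smul] at this
      exact this.symm
    rw [h1, map_sum]
    exact Finset.sum_eq_zero fun j _ => by rw [hse.smul_right, hy, zero_mul]
  have hinj : Function.Injective f := by
    rw [injective_iff_map_eq_zero]
    intro x hx
    by_contra hne
    obtain ⟨y, hy⟩ := hW x hne
    exact hy (hext x (fun j => congrFun hx j) y y.2)
  have hsurj : Function.Surjective f :=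
    (LinearMap.injective_iff_surjective_of_finrank_eq_finrank (by simp)).1 hinj
  constructor
  · rw [Submodule.disjoint_def]
    intro x hx hx'
    by_contra hne
    obtain ⟨y, hy⟩ := hW ⟨x, hx⟩ (fun h => hne (congrArg Subtype.val h))
    exact hy (hx' y y.2)
  · rw [codisjoint_iff, eq_top_iff]
    rintro x -
    obtain ⟨y, hy⟩ := hsurj fun j => ψ x (b j)
    rw [show x = (y : V) + (x - y) by abel]
    refine Submodule.add_mem_sup y.2 (hext _ fun j => ?_)
    have := congrFun hy j
    rw [map_sub, LinearMap.sub_apply, sub_eq_zero]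
    exact this.symm

theorem nondegenerate_orthogonal {ψ : V →ₗ[ℚ] V →ₗ[ℚ] D} (hψ : IsSkewHermitian ψ)
    (hnd : IsNondegenerate ψ) {W : Submodule D V} (hW : IsCompl W (orthogonal hψ.2 W)) :
    IsNondegenerate (restrictForm ψ (orthogonal hψ.2 W)) := by
  intro x hx
  obtain ⟨y, hy⟩ := hnd x (fun h => hx (Subtype.ext h))
  have hy' : y ∈ W ⊔ orthogonal hψ.2 W := by rw [hW.sup_eq_top]; trivial
  obtain ⟨a, ha, c, hc, rfl⟩ := Submodule.mem_sup.1 hy'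
  refine ⟨⟨c, hc⟩, ?_⟩
  have := x.2 a ha
  rw [map_add, this, zero_add] at hy
  exact hy

theorem IsFormLattice.finite {R : Subalgebra ℤ D} {ψ : V →ₗ[ℚ] V →ₗ[ℚ] D} {L : Submodule ℤ V}
    (h : IsFormLattice T R ψ L) : Module.Finite D V := by
  have hfg := h.lattice.fg
  obtain ⟨s, hs⟩ := hfg
  have h1 : Submodule.span ℚ (s : Set V) = ⊤ := by
    rw [← h.lattice.span_eq_top, ← hs, Submodule.span_span_of_tower]
  have : Module.Finite ℚ V := ⟨⟨s, h1⟩⟩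
  exact Module.Finite.of_restrictScalars_finite ℚ D V

theorem traceForm_isRefl (σ : Splitting T d S) {ψ : V →ₗ[ℚ] V →ₗ[ℚ] D} (hψ : IsSkewHermitian ψ) :
    (ψ.compr₂ T).IsRefl := by
  intro x y hxy
  rw [LinearMap.compr₂_apply] at hxy ⊢
  rw [hψ.1 x y, map_neg, σ.T_star, hxy, neg_zero]

variable (σ : Splitting T d S) {R : Subalgebra ℤ D} {ψ : V →ₗ[ℚ] V →ₗ[ℚ] D} {L : Submodule ℤ V}
  {α : Type*} [Fintype α] [DecidableEq α] (r : Basis α ℚ D)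

/-- The absolute value of the discriminant of the lattice `L`. -/
noncomputable def absDisc (T : D →ₗ[ℚ] ℚ) (ψ : V →ₗ[ℚ] V →ₗ[ℚ] D) (L : Submodule ℤ V) : ℝ :=
  |(disc L (ψ.compr₂ T) : ℝ)|

theorem absDisc_eq {β : Type*} [Fintype β] [DecidableEq β] (a : Basis β ℚ V)
    (ha : L = Submodule.span ℤ (Set.range a)) :
    absDisc T ψ L = ((|(gram (ψ.compr₂ T) a).det| : ℚ) : ℝ) := by
  rw [absDisc, ha, disc_span_basis, Rat.cast_abs]

/-- The absolute value of the discriminant of a nondegenerate integral lattice is at least one. -/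
theorem IsFormLattice.one_le_absDisc (σ : Splitting T d S) (h : IsFormLattice T R ψ L) :
    1 ≤ absDisc T ψ L := by
  have := h.lattice
  obtain ⟨a, ha⟩ := exists_basis_span_eq L rfl
  have hmem : ∀ i, a i ∈ L := fun i => ha ▸ Submodule.subset_span ⟨i, rfl⟩
  choose z hz using fun i j => h.integral _ (hmem i) _ (hmem j)
  have hdet : (gram (ψ.compr₂ T) a).det = ((Matrix.of z).det : ℤ) := by
    rw [Int.cast_det]
    congr 1
    ext i j
    exact hz i j
  have hne := σ.gram_det_ne_zero h.skew.2 h.nondeg a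
  rw [absDisc_eq a ha, hdet]
  rw [hdet] at hne
  have h1 : (Matrix.of z).det ≠ 0 := by exact_mod_cast hne
  exact_mod_cast Int.one_le_abs h1

theorem IsFormLattice.smulTower_mem (h : IsFormLattice T R ψ L) {m : ℕ} {v : Fin m → V}
    (hv : ∀ i, v i ∈ L) (hr : Subalgebra.toSubmodule R = Submodule.span ℤ (Set.range r)) (j : α)
    (i : Fin m) : r j • v i ∈ L := by
  refine h.stable _ ?_ _ (hv i)
  rw [← Subalgebra.mem_toSubmodule, hr]
  exact Submodule.subset_span ⟨j, rfl⟩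

/-- The discriminant of a lattice spanned by a basis over an order. -/
noncomputable def latticeDisc (σ : Splitting T d S) (r : Basis α ℚ D) (ψ : V →ₗ[ℚ] V →ₗ[ℚ] D)
    {m : ℕ} (v : Fin m → V) : ℝ :=
  redDisc T r ^ m * ∏ s, |(σ.formMatrix ψ v s).det| ^ d

theorem abs_gram_det_smulTower' (hψ : IsSesquilinear ψ) {m : ℕ} (v : Basis (Fin m) D V) :
    ((|(gram (ψ.compr₂ T) (r.smulTower v)).det| : ℚ) : ℝ) = latticeDisc σ r ψ v := by
  rw [σ.abs_gram_det_smulTower hψ v r, abs_det_star_eq_redDisc]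
  rfl

/-- The index of `∑ R vᵢ` in `L` is finite and determined by the discriminants. -/
theorem IsFormLattice.spanIndex_sq (h : IsFormLattice T R ψ L) {m : ℕ} (v : Basis (Fin m) D V)
    (hv : ∀ i, v i ∈ L) (hr : Subalgebra.toSubmodule R = Submodule.span ℤ (Set.range r)) :
    spanIndex L R v ≠ 0 ∧
      (spanIndex L R v : ℝ) ^ 2 * absDisc T ψ L = latticeDisc σ r ψ v := by
  classical
  have := h.lattice
  have := h.finite
  have := σ.finiteDimensional
  have hn : finrank ℚ V = Fintype.card (α × Fin m) := finrank_eq_card_basis (r.smulTower v)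
  obtain ⟨a', ha'⟩ := exists_basis_span_eq L hn
  let a := a'.reindex (Fintype.equivFin (α × Fin m)).symm
  have ha : L = Submodule.span ℤ (Set.range a) := by
    rw [ha', Basis.range_reindex]
  have hspan : (Submodule.span R (Set.range v)).toAddSubgroup =
      (Submodule.span ℤ (Set.range (r.smulTower v))).toAddSubgroup := by
    apply le_antisymm
    · let M : Submodule R V :=
        { carrier := Submodule.span ℤ (Set.range (r.smulTower v))
          add_mem' := fun ha hb => Submodule.add_mem _ ha hb
          zero_mem' := Submodule.zero_mem _
          smul_mem' := by
            rintro ⟨c, hc⟩ x hx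
            change c • x ∈ Submodule.span ℤ (Set.range (r.smulTower v))
            induction hx using Submodule.span_induction with
            | mem x hx =>
              obtain ⟨⟨j, i⟩, rfl⟩ := hx
              have hcr : c * r j ∈ Submodule.span ℤ (Set.range r) := by
                rw [← hr]
                refine R.mul_mem hc ?_
                rw [← Subalgebra.mem_toSubmodule, hr]
                exact Submodule.subset_span ⟨j, rfl⟩
              rw [Basis.smulTower_apply, smul_smul]
              obtain ⟨g, hg⟩ := (Submodule.mem_span_range_iff_exists_fun ℤ).1 hcr
              simp only at hg ⊢
              rw [← hg, Finset.sum_smul]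
              refine Submodule.sum_mem _ fun k _ => ?_
              rw [smul_assoc]
              exact Submodule.smul_mem _ _ (Submodule.subset_span ⟨(k, i), by simp⟩)
            | zero => rw [smul_zero]; exact Submodule.zero_mem _
            | add x y _ _ hx hy => rw [smul_add]; exact Submodule.add_mem _ hx hy
            | smul n x _ hx => rw [smul_comm]; exact Submodule.smul_mem _ _ hx }
      have hle : Submodule.span R (Set.range v) ≤ M := by
        rw [Submodule.span_le]
        rintro _ ⟨i, rfl⟩
        have h1 : (1 : D) ∈ Submodule.span ℤ (Set.range r) := by
          rw [← hr]
          exact R.one_mem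
        obtain ⟨g, hg⟩ := (Submodule.mem_span_range_iff_exists_fun ℤ).1 h1
        change v i ∈ Submodule.span ℤ (Set.range (r.smulTower v))
        rw [← one_smul D (v i), ← hg, Finset.sum_smul]
        refine Submodule.sum_mem _ fun k _ => ?_
        rw [smul_assoc]
        exact Submodule.smul_mem _ _ (Submodule.subset_span ⟨(k, i), by simp⟩)
      exact hle
    · have hle : Submodule.span ℤ (Set.range (r.smulTower v)) ≤
          (Submodule.span R (Set.range v)).restrictScalars ℤ := by
        rw [Submodule.span_le]
        rintro _ ⟨⟨j, i⟩, rfl⟩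
        rw [Basis.smulTower_apply]
        have hj : r j ∈ R := by
          rw [← Subalgebra.mem_toSubmodule, hr]
          exact Submodule.subset_span ⟨j, rfl⟩
        exact Submodule.smul_mem (Submodule.span R (Set.range v)) (⟨r j, hj⟩ : R)
          (Submodule.subset_span ⟨i, rfl⟩)
      exact hle
  have hmem : ∀ ji, r.smulTower v ji ∈ Submodule.span ℤ (Set.range a) := by
    rintro ⟨j, i⟩
    rw [← ha, Basis.smulTower_apply]
    exact h.smulTower_mem r hv hr j i
  have hidx : spanIndex L R v = (Submodule.span ℤ (Set.range (r.smulTower v))).toAddSubgroup.relIndex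
      (Submodule.span ℤ (Set.range a)).toAddSubgroup := by
    rw [spanIndex, hspan, ha]
  refine ⟨?_, ?_⟩
  · rw [hidx]
    exact relIndex_span_basis_ne_zero a (r.smulTower v) hmem
  · have h1 := relIndex_sq_mul_gram_det (ψ.compr₂ T) a (r.smulTower v) hmem
    rw [← hidx] at h1
    have h2 := congrArg (fun q : ℚ => ((|q| : ℚ) : ℝ)) h1
    simp only [abs_mul, Rat.cast_mul] at h2
    rw [abs_gram_det_smulTower' σ r h.skew.2 v, ← absDisc_eq a ha] at h2
    rw [← h2]
    simp

/-- The discriminant of a lattice is at most the discriminant of the sublattice `∑ R vᵢ`. -/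
theorem IsFormLattice.absDisc_le (h : IsFormLattice T R ψ L) {m : ℕ} (v : Basis (Fin m) D V)
    (hv : ∀ i, v i ∈ L) (hr : Subalgebra.toSubmodule R = Submodule.span ℤ (Set.range r)) :
    absDisc T ψ L ≤ latticeDisc σ r ψ v := by
  obtain ⟨h0, h1⟩ := h.spanIndex_sq σ r v hv hr
  rw [← h1]
  refine le_mul_of_one_le_left (abs_nonneg _) (one_le_pow₀ ?_)
  exact_mod_cast Nat.one_le_iff_ne_zero.2 h0

/-- The orthogonal complement of a nondegenerate subspace in a lattice. -/
theorem IsFormLattice.orthogonal_lattice (h : IsFormLattice T R ψ L)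
    (hr : Subalgebra.toSubmodule R = Submodule.span ℤ (Set.range r)) {W : Submodule D V}
    (hW : IsNondegenerate (restrictForm ψ W)) {p : ℕ} (v : Basis (Fin p) D W)
    (hv : ∀ i, (v i : V) ∈ L) :
    IsFormLattice T R (restrictForm ψ (orthogonal h.skew.2 W))
        (restrictLattice L (orthogonal h.skew.2 W)) ∧
      p + finrank D (orthogonal h.skew.2 W) = finrank D V ∧
      absDisc T (restrictForm ψ (orthogonal h.skew.2 W))
          (restrictLattice L (orthogonal h.skew.2 W)) ≤
        absDisc T ψ L * latticeDisc σ r (restrictForm ψ W) v := by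
  classical
  have := h.lattice
  have := h.finite
  have := σ.finiteDimensional
  have : FiniteDimensional ℚ V := Module.Finite.trans D V
  have hcompl := isCompl_orthogonal h.skew hW
  set W' := orthogonal h.skew.2 W with hW'
  have hres : IsFormLattice T R (restrictForm ψ W') (restrictLattice L W') :=
    h.restrict (nondegenerate_orthogonal h.skew h.nondeg hcompl)
  have hdim : p + finrank D W' = finrank D V := by
    rw [← Submodule.finrank_add_eq_of_isCompl hcompl, finrank_eq_card_basis v, Fintype.card_fin]
  refine ⟨hres, hdim, ?_⟩
  have := hres.lattice
  obtain ⟨a, ha⟩ := exists_basis_span_eq L rfl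
  obtain ⟨y, hy⟩ := exists_basis_span_eq (restrictLattice L W') rfl
  have hWf := h.restrict hW
  let x : α × Fin p → V := fun k => ((r.smulTower v k : W) : V)
  have hxgram : gram (ψ.compr₂ T) x = gram ((restrictForm ψ W).compr₂ T) (r.smulTower v) := rfl
  have hxL : ∀ k, x k ∈ L := fun ⟨j, i⟩ => by
    have := hWf.smulTower_mem r (v := v) hv hr j i
    rw [← Basis.smulTower_apply r v (j, i)] at this
    exact this
  have hyL : ∀ i, ((y i : W') : V) ∈ L := fun i => by
    have : y i ∈ restrictLattice L W' := hy ▸ Submodule.subset_span ⟨i, rfl⟩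
    exact this
  have hyspan : Submodule.span ℤ (Set.range fun i => ((y i : W') : V)) =
      (restrictLattice L W').map (W'.subtype.restrictScalars ℤ) := by
    rw [hy, Submodule.map_span, ← Set.range_comp]
    rfl
  have key := abs_gram_det_orthogonal_le (ψ.compr₂ T) (traceForm_isRefl σ h.skew) a
    (by rw [← ha]; exact h.integral) x (by rw [← ha]; exact hxL)
    (by rw [hxgram]; exact σ.gram_det_ne_zero hWf.skew.2 hWf.nondeg _)
    (fun i => ((y i : W') : V))
    (y.linearIndependent.map' (W'.subtype.restrictScalars ℚ)
      (LinearMap.ker_eq_bot.2 Subtype.val_injective))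
    (by
      intro z
      rw [hyspan, ← ha]
      constructor
      · rintro ⟨z', hz', rfl⟩
        refine ⟨hz', fun i => ?_⟩
        rw [LinearMap.compr₂_apply]
        change T (ψ (z' : V) (x i)) = 0
        rw [z'.2 _ (r.smulTower v i).2, map_zero]
      · rintro ⟨hzL, hz⟩
        -- Only the traces against the r_j v_i are known to vanish. A nonzero value ψ(z, y') could
        -- be given nonzero trace by scaling y' inside W, but the scaled vector is a rational
        -- combination of the r_j v_i.
        have hzW : z ∈ W' := by
          intro y' hy'
          by_contra hne
          obtain ⟨c, hc⟩ := σ.exists_trace_form_ne_zero h.skew.2 hne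
          apply hc
          have h1 : (c • y' : V) = ∑ k, (r.smulTower v).repr (c • ⟨y', hy'⟩) k • x k := by
            have := congrArg (fun z : W => (z : V)) ((r.smulTower v).sum_repr (c • ⟨y', hy'⟩))
            simp only [AddSubmonoidClass.coe_finsetSum, Submodule.coe_smul] at this
            rw [← this]
            rfl
          rw [h1, map_sum]
          exact Finset.sum_eq_zero fun k _ => by rw [map_smul, hz, smul_zero]
        exact ⟨⟨z, hzW⟩, hzL, rfl⟩)
    (by
      have e1 : Fintype.card (α × Fin p) = finrank ℚ W := (finrank_eq_card_basis (r.smulTower v)).symm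
      rw [e1, Fintype.card_fin, Fintype.card_fin]
      have := Submodule.finrank_add_eq_of_isCompl (K := ℚ)
        (U := W.restrictScalars ℚ) (W := W'.restrictScalars ℚ)
        (by
          constructor
          · rw [Submodule.disjoint_def]
            intro x hx hx'
            exact (Submodule.disjoint_def.1 hcompl.disjoint) x hx hx'
          · rw [codisjoint_iff, eq_top_iff]
            rintro x -
            have hx : x ∈ W ⊔ W' := by rw [hcompl.sup_eq_top]; trivial
            obtain ⟨a, ha, c, hc, rfl⟩ := Submodule.mem_sup.1 hx
            exact Submodule.add_mem_sup ha hc)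
      exact this)
  have hR : ((|(gram (ψ.compr₂ T) fun i => ((y i : W') : V)).det| : ℚ) : ℝ) ≤
      ((|(gram (ψ.compr₂ T) a).det| : ℚ) : ℝ) * ((|(gram (ψ.compr₂ T) x).det| : ℚ) : ℝ) := by
    exact_mod_cast key
  rw [absDisc_eq y hy, absDisc_eq a ha, ← abs_gram_det_smulTower' σ r hWf.skew.2 v]
  exact hR

end Restriction

/-! ### Successive minima over D and the existence of small blocks. -/

section Minima

variable {D : Type v} [DivisionRing D] [CharZero D] [StarRing D] {T : D →ₗ[ℚ] ℚ} {d : ℕ}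
  {S : Type u} [Fintype S] {V : Type w} [AddCommGroup V] [Module ℚ V] [Module D V]
  {σ : Splitting T d S} {R : Subalgebra ℤ D} {ψ : V →ₗ[ℚ] V →ₗ[ℚ] D} {L : Submodule ℤ V}
  {κ : Type*} [Fintype κ] [DecidableEq κ]

theorem IsFormLattice.exists_basis (σ : Splitting T d S) (h : IsFormLattice T R ψ L) :
    ∃ a : Basis (Fin (finrank ℚ V)) ℚ V, L = Submodule.span ℤ (Set.range a) ∧
      (gram (ψ.compr₂ T) a).det ≠ 0 := by
  have := h.lattice
  obtain ⟨a, ha⟩ := exists_basis_span_eq L rfl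
  exact ⟨a, ha, σ.gram_det_ne_zero h.skew.2 h.nondeg a⟩

theorem IsFormLattice.exists_notMem (h : IsFormLattice T R ψ L) {W : Submodule D V}
    (hW : W ≠ ⊤) : ∃ x ∈ L, x ∉ W := by
  by_contra hcon
  push Not at hcon
  apply hW
  rw [eq_top_iff]
  rintro x -
  have hx : x ∈ Submodule.span ℚ (L : Set V) := by
    rw [h.lattice.span_eq_top]
    trivial
  have hle : Submodule.span ℚ (L : Set V) ≤ W.restrictScalars ℚ := Submodule.span_le.2 hcon
  exact hle hx

/-- Successive minima of a lattice over a division algebra. -/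
theorem IsFormLattice.exists_minima (h : IsFormLattice T R ψ L) (N : AdaptedNorm σ ψ κ) {m : ℕ}
    (hm : finrank D V = m) :
    ∃ w : Basis (Fin m) D V, (∀ i, w i ∈ L) ∧ (Monotone fun i => N.normSq (w i)) ∧
      ∀ i, ∀ x ∈ L, w.repr x i ≠ 0 → N.normSq (w i) ≤ N.normSq x := by
  classical
  have := h.finite
  obtain ⟨a, ha, hdet⟩ := h.exists_basis σ
  have hmin : ∀ W : Submodule D V, ∃ x, W ≠ ⊤ → (x ∈ L ∧ x ∉ W ∧
      ∀ y ∈ L, y ∉ W → N.normSq x ≤ N.normSq y) := by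
    intro W
    by_cases hW : W = ⊤
    · exact ⟨0, fun h => absurd hW h⟩
    · obtain ⟨x, hx, hxW⟩ := h.exists_notMem hW
      obtain ⟨y, hy, hyW, hyx⟩ := N.exists_min a hdet (fun x => x ∉ W) ⟨x, ha ▸ hx, hxW⟩
      rw [← ha] at hy hyx
      exact ⟨y, fun _ => ⟨hy, hyW, hyx⟩⟩
  choose f hf using hmin
  -- `f W` is a shortest vector of L outside W, and is unconstrained for W = ⊤. Adjoining it
  -- repeatedly raises the dimension by one each time up to step m, so the value at ⊤ never enters
  -- the basis.
  obtain ⟨U, hU0, hU⟩ : ∃ U : ℕ → Submodule D V, U 0 = ⊥ ∧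
      ∀ k, U (k + 1) = U k ⊔ Submodule.span D {f (U k)} :=
    ⟨fun k => Nat.rec ⊥ (fun _ W => W ⊔ Submodule.span D {f W}) k, rfl, fun _ => rfl⟩
  have hmono : Monotone U := monotone_nat_of_le_succ fun k => by rw [hU]; exact le_sup_left
  have hspan : ∀ k, U k = Submodule.span D ((fun i => f (U i)) '' Set.Iio k) := by
    intro k
    induction k with
    | zero => simp [hU0]
    | succ k ih =>
      have hins : Set.Iio (k + 1) = insert k (Set.Iio k) := by
        ext i
        simp only [Set.mem_Iio, Set.mem_insert_iff]
        omega
      rw [hU, hins, Set.image_insert_eq, Submodule.span_insert, sup_comm, ← ih]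
  have hupper : ∀ k : ℕ, finrank D (U k) ≤ k := by
    intro k
    rw [hspan]
    refine (finrank_span_le_card _).trans ?_
    rw [Set.toFinset_card, ← Nat.card_eq_fintype_card]
    refine (Nat.card_image_le (Set.finite_Iio k)).trans ?_
    simp
  have hne : ∀ k < m, U k ≠ ⊤ := by
    intro k hk htop
    have := hupper k
    rw [htop, finrank_top] at this
    omega
  have hlower : ∀ k ≤ m, k ≤ finrank D (U k) := by
    intro k
    induction k with
    | zero => intro _; exact Nat.zero_le _
    | succ k ih =>
      intro hk
      refine Nat.succ_le_of_lt (lt_of_le_of_lt (ih (by omega)) (Submodule.finrank_lt_finrank_of_lt ?_))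
      refine lt_of_le_of_ne (hmono (Nat.le_succ k)) fun heq => (hf _ (hne k (by omega))).2.1 ?_
      have hle := heq.ge
      rw [hU] at hle
      refine hle ?_
      exact Submodule.mem_sup_right (Submodule.mem_span_singleton_self _)
  have hrange : Set.range (fun i : Fin m => f (U i)) = (fun i => f (U i)) '' Set.Iio m := by
    ext x
    constructor
    · rintro ⟨i, rfl⟩
      exact ⟨i, i.2, rfl⟩
    · rintro ⟨i, hi, rfl⟩
      exact ⟨⟨i, hi⟩, rfl⟩
  have htop : ⊤ ≤ Submodule.span D (Set.range fun i : Fin m => f (U i)) := by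
    rw [hrange, ← hspan, top_le_iff]
    exact Submodule.eq_top_of_finrank_eq (le_antisymm ((hupper m).trans hm.ge)
      (hm.le.trans (hlower m le_rfl)))
  let w : Basis (Fin m) D V := basisOfTopLeSpanOfCardEqFinrank _ htop (by simp [hm])
  have hw : ∀ i : Fin m, w i = f (U i) := fun i => by
    simp [w, coe_basisOfTopLeSpanOfCardEqFinrank]
  have hwf : ∀ i : Fin m, w i ∈ L ∧ w i ∉ U i ∧ ∀ y ∈ L, y ∉ U i → N.normSq (w i) ≤ N.normSq y :=
    fun i => by rw [hw]; exact hf _ (hne i i.2)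
  refine ⟨w, fun i => (hwf i).1, fun i j hij => ?_, fun i x hx hxi => ?_⟩
  · exact (hwf i).2.2 _ (hwf j).1 fun hmem => (hwf j).2.1 (hmono hij hmem)
  · refine (hwf i).2.2 x hx fun hmem => hxi ?_
    have himage : (fun k : ℕ => f (U k)) '' Set.Iio (i : ℕ) = w '' Set.Iio i := by
      ext y
      constructor
      · rintro ⟨k, hk, rfl⟩
        exact ⟨⟨k, lt_trans hk i.2⟩, hk, hw _⟩
      · rintro ⟨k, hk, rfl⟩
        exact ⟨k, hk, (hw k).symm⟩
    rw [hspan, himage, Basis.mem_span_image] at hmem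
    by_contra hne
    exact lt_irrefl i (hmem (Finset.mem_coe.2 (Finsupp.mem_support_iff.2 hne)))

/-- Minkowski's theorem for weights attached to a basis over a division algebra. -/
theorem IsFormLattice.prod_pow_le (h : IsFormLattice T R ψ L) (N : AdaptedNorm σ ψ κ) {m : ℕ}
    (w : Basis (Fin m) D V) (c : Fin m → ℝ) (hpos : ∀ i, 0 < c i) (hmono : Monotone c)
    (hc : ∀ i, ∀ x ∈ L, w.repr x i ≠ 0 → c i ≤ N.normSq x) :
    (∏ i, c i) ^ finrank ℚ D ≤ (finrank ℚ V : ℝ) ^ finrank ℚ V * absDisc T ψ L := by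
  classical
  have := σ.finiteDimensional
  obtain ⟨a, ha, hdet⟩ := h.exists_basis σ
  -- The lexicographic order keeps the ℚ-basis of each line D w_i together. All its members get the
  -- weight of w_i, so the weights stay monotone.
  let b : Basis (Fin m ×ₗ Fin (finrank ℚ D)) ℚ V :=
    ((finBasis ℚ D).smulTower w).reindex ((Equiv.prodComm _ _).trans toLex)
  have hcard : Fintype.card (Fin m ×ₗ Fin (finrank ℚ D)) = finrank ℚ V :=
    (finrank_eq_card_basis b).symm
  have key := N.prod_sq_le a hdet b (fun k => Real.sqrt (c (ofLex k).1))
    (fun k => Real.sqrt_pos.2 (hpos _))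
    (fun k l hkl => Real.sqrt_le_sqrt (hmono (Prod.Lex.monotone_fst _ _ hkl)))
    (by
      intro x hx k hk
      rw [Real.sq_sqrt (hpos _).le]
      refine hc _ x (ha ▸ hx) fun h0 => hk ?_
      simp only [b, Basis.repr_reindex, Finsupp.mapDomain_equiv_apply]
      change ((finBasis ℚ D).smulTower w).repr x ((ofLex k).2, (ofLex k).1) = 0
      rw [Basis.smulTower_repr, h0, map_zero, Finsupp.zero_apply])
  rw [hcard, ← absDisc_eq a ha] at key
  refine le_trans (le_of_eq ?_) key
  rw [← (toLex (α := Fin m × Fin (finrank ℚ D))).prod_comp, Fintype.prod_prod_type,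
    ← Finset.prod_pow]
  refine Finset.prod_congr rfl fun i _ => ?_
  simp [Real.sq_sqrt (hpos i).le]

/-- Hall's marriage theorem. If the indices in A had fewer partners than elements, a nontrivial
D-combination of the w_i with i ∈ A would be orthogonal to every w_j, hence to V. -/
theorem exists_injective_form_ne_zero (hψ : IsSesquilinear ψ) (hnd : IsNondegenerate ψ) {m : ℕ}
    (w : Basis (Fin m) D V) :
    ∃ f : Fin m → Fin m, Function.Injective f ∧ ∀ i, ψ (w i) (w (f i)) ≠ 0 := by
  classical
  let t : Fin m → Finset (Fin m) := fun i => Finset.univ.filter fun j => ψ (w i) (w j) ≠ 0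
  have hall : ∀ A : Finset (Fin m), A.card ≤ (A.biUnion t).card := by
    intro A
    by_contra! hlt
    let g : (A → D) →ₗ[D] (A.biUnion t → D) :=
      { toFun := fun z j => ∑ i, z i * ψ (w i) (w j)
        map_add' := fun y z => by ext j; simp [add_mul, Finset.sum_add_distrib]
        map_smul' := fun c z => by ext j; simp [mul_assoc, Finset.mul_sum] }
    have hker : LinearMap.ker g ≠ ⊥ := by
      apply LinearMap.ker_ne_bot_of_finrank_lt
      rw [finrank_fintype_fun_eq_card, finrank_fintype_fun_eq_card, Fintype.card_coe,
        Fintype.card_coe]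
      exact hlt
    obtain ⟨z, hz, hz0⟩ := (Submodule.ne_bot_iff _).1 hker
    set x : V := ∑ i, z i • w i with hx
    have hx0 : x ≠ 0 := by
      intro h0
      apply hz0
      have hli := w.linearIndependent.comp (fun i : A => (i : Fin m)) Subtype.val_injective
      funext i
      exact Fintype.linearIndependent_iff.1 hli z h0 i
    have hψx : ∀ j, ψ x (w j) = 0 := by
      intro j
      rw [hx, map_sum, LinearMap.sum_apply]
      simp only [hψ.smul_left]
      by_cases hj : j ∈ A.biUnion t
      · exact congrFun hz ⟨j, hj⟩
      · refine Finset.sum_eq_zero fun i _ => ?_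
        have : ψ (w i) (w j) = 0 := by
          by_contra hne
          exact hj (Finset.mem_biUnion.2 ⟨i, i.2, by simp [t, hne]⟩)
        rw [this, mul_zero]
    obtain ⟨y, hy⟩ := hnd x hx0
    apply hy
    rw [← w.sum_repr y, map_sum]
    exact Finset.sum_eq_zero fun j _ => by rw [hψ.smul_right, hψx, zero_mul]
  obtain ⟨f, hf, hft⟩ := (Finset.all_card_le_biUnion_card_iff_exists_injective t).1 hall
  exact ⟨f, hf, fun i => by simpa [t] using hft i⟩

/-- A lattice contains a nonisotropic vector, or a hyperbolic pair, on which the form is small. -/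
theorem IsFormLattice.exists_block (σ : Splitting T d S) (h : IsFormLattice T R ψ L) {m : ℕ}
    (hm : finrank D V = m) (hm0 : 0 < m) :
    ∃ x ∈ L, ∃ y ∈ L, ψ x y ≠ 0 ∧ (x = y ∨ ψ x x = 0) ∧
      σ.normSq (ψ x y) ^ finrank ℚ V ≤
        ((finrank ℚ V : ℝ) ^ finrank ℚ V * absDisc T ψ L) ^ 2 := by
  classical
  have := h.finite
  have := σ.finiteDimensional
  obtain ⟨a, ha, hdet⟩ := h.exists_basis σ
  let u : Basis (Fin m) D V := finBasisOfFinrankEq D V hm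
  obtain ⟨N⟩ := σ.exists_adaptedNorm h.skew h.nondeg u
  obtain ⟨w, hwL, hwm, hwmin⟩ := h.exists_minima N hm
  have hwpos : ∀ i, 0 < N.normSq (w i) := fun i => N.normSq_pos a hdet (w.ne_zero i)
  have hprod := h.prod_pow_le N w _ hwpos hwm hwmin
  obtain ⟨f, hf, hfne⟩ := exists_injective_form_ne_zero h.skew.2 h.nondeg w
  have hfb : Function.Bijective f := Finite.injective_iff_bijective.1 hf
  have : Nonempty (Fin m) := ⟨⟨0, hm0⟩⟩
  -- Since f is a permutation, the products |w_j| |w_f(j)| together contain each length twice; the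
  -- smallest one is at most their geometric mean.
  obtain ⟨i, -, hi⟩ := Finset.exists_min_image Finset.univ
    (fun i => N.normSq (w i) * N.normSq (w (f i))) Finset.univ_nonempty
  have hle : (N.normSq (w i) * N.normSq (w (f i))) ^ m ≤ (∏ i, N.normSq (w i)) ^ 2 := by
    calc (N.normSq (w i) * N.normSq (w (f i))) ^ m
        = ∏ _j : Fin m, N.normSq (w i) * N.normSq (w (f i)) := by simp
      _ ≤ ∏ j, N.normSq (w j) * N.normSq (w (f j)) :=
          Finset.prod_le_prod (fun j _ => (mul_pos (hwpos _) (hwpos _)).le)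
            fun j _ => hi j (Finset.mem_univ _)
      _ = _ := by
          rw [Finset.prod_mul_distrib, sq, hfb.prod_comp (fun j => N.normSq (w j))]
  have hdim : finrank ℚ V = m * finrank ℚ D := by
    rw [← hm, mul_comm, finrank_mul_finrank]
  have hfin : ∀ c : ℝ, 0 ≤ c → c ≤ N.normSq (w i) * N.normSq (w (f i)) →
      c ^ finrank ℚ V ≤ ((finrank ℚ V : ℝ) ^ finrank ℚ V * absDisc T ψ L) ^ 2 := by
    intro c hc0 hc
    calc c ^ finrank ℚ V
        ≤ (N.normSq (w i) * N.normSq (w (f i))) ^ finrank ℚ V := pow_le_pow_left₀ hc0 hc _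
      _ = ((N.normSq (w i) * N.normSq (w (f i))) ^ m) ^ finrank ℚ D := by rw [hdim, pow_mul]
      _ ≤ ((∏ i, N.normSq (w i)) ^ 2) ^ finrank ℚ D :=
          pow_le_pow_left₀ (pow_nonneg (mul_pos (hwpos _) (hwpos _)).le _) hle _
      _ = ((∏ i, N.normSq (w i)) ^ finrank ℚ D) ^ 2 := by rw [← pow_mul, mul_comm, pow_mul]
      _ ≤ _ := pow_le_pow_left₀ (pow_nonneg (Finset.prod_nonneg fun j _ => (hwpos j).le) _) hprod _
  have hcases : ∀ x ∈ L, ∀ y ∈ L, ψ x y ≠ 0 → N.normSq x * N.normSq y ≤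
      N.normSq (w i) * N.normSq (w (f i)) → N.normSq x ≤ N.normSq y →
      ∃ x ∈ L, ∃ y ∈ L, ψ x y ≠ 0 ∧ (x = y ∨ ψ x x = 0) ∧
      σ.normSq (ψ x y) ^ finrank ℚ V ≤
        ((finrank ℚ V : ℝ) ^ finrank ℚ V * absDisc T ψ L) ^ 2 := by
    intro x hx y hy hxy hle1 hle2
    -- x is the shorter of the two vectors: if it is not isotropic, it may replace y without
    -- increasing the product of lengths.
    by_cases h0 : ψ x x = 0
    · exact ⟨x, hx, y, hy, hxy, Or.inr h0,
        hfin _ (σ.normSq_nonneg _) ((N.normSq_form_le x y).trans hle1)⟩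
    · exact ⟨x, hx, x, hx, h0, Or.inl rfl, hfin _ (σ.normSq_nonneg _)
        ((N.normSq_form_le x x).trans ((mul_le_mul_of_nonneg_left hle2 (N.normSq_nonneg x)).trans
          hle1))⟩
  rcases le_total (N.normSq (w i)) (N.normSq (w (f i))) with hij | hij
  · exact hcases _ (hwL i) _ (hwL _) (hfne i) le_rfl hij
  · exact hcases _ (hwL _) _ (hwL _) (fun h0 => hfne i (h.skew.eq_zero_comm h0))
      (mul_comm _ _).le hij

end Minima

/-! ### Hyperbolic planes and their balanced norms. -/

section Frames

variable {D : Type v} [DivisionRing D] [CharZero D] [StarRing D] {T : D →ₗ[ℚ] ℚ} {d : ℕ}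
  {S : Type u} [Fintype S] {V : Type w} [AddCommGroup V] [Module ℚ V]
  {σ : Splitting T d S} {R : Subalgebra ℤ D} {ψ : V →ₗ[ℚ] V →ₗ[ℚ] D} {L : Submodule ℤ V}
  {κ : Type*} [Fintype κ] [DecidableEq κ]

/-- Minkowski's theorem for a flag with one intermediate step. -/
theorem AdaptedNorm.pow_mul_pow_le [FiniteDimensional ℚ V] (N : AdaptedNorm σ ψ κ) {α : Type*}
    [Fintype α] [DecidableEq α]
    (a : Basis α ℚ V) (ha : (gram (ψ.compr₂ T) a).det ≠ 0) (W : Submodule ℚ V) {lo hi : ℝ}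
    (hlo : 0 < lo) (hle : lo ≤ hi)
    (h1 : ∀ x ∈ Submodule.span ℤ (Set.range a), x ≠ 0 → lo ≤ N.normSq x)
    (h2 : ∀ x ∈ Submodule.span ℤ (Set.range a), x ∉ W → hi ≤ N.normSq x) :
    lo ^ finrank ℚ W * hi ^ (finrank ℚ V - finrank ℚ W) ≤
      (finrank ℚ V : ℝ) ^ finrank ℚ V * ((|(gram (ψ.compr₂ T) a).det| : ℚ) : ℝ) := by
  obtain ⟨W', hW'⟩ := W.exists_isCompl
  have hdim := Submodule.finrank_add_eq_of_isCompl hW'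
  let b : Basis (Fin (finrank ℚ W + finrank ℚ W')) ℚ V :=
    (((finBasis ℚ W).prod (finBasis ℚ W')).map
      (Submodule.prodEquivOfIsCompl W W' hW')).reindex finSumFinEquiv
  have hcard : Fintype.card (Fin (finrank ℚ W + finrank ℚ W')) = finrank ℚ V := by
    rw [Fintype.card_fin, hdim]
  let g : Fin (finrank ℚ W + finrank ℚ W') → ℝ := fun i => if (i : ℕ) < finrank ℚ W then lo else hi
  have hg : ∀ i, 0 < g i := fun i => by
    simp only [g]
    split_ifs
    exacts [hlo, hlo.trans_le hle]
  have key := N.prod_sq_le a ha b (fun i => Real.sqrt (g i)) (fun i => Real.sqrt_pos.2 (hg i))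
    (by
      intro i j hij
      apply Real.sqrt_le_sqrt
      simp only [g]
      have : (i : ℕ) ≤ j := hij
      split_ifs
      exacts [le_rfl, hle, by omega, le_rfl])
    (by
      intro x hx i hi
      rw [Real.sq_sqrt (hg i).le]
      simp only [g]
      split_ifs with hlt
      · exact h1 x hx fun h0 => hi (by simp [h0])
      · refine h2 x hx fun hxW => hi ?_
        obtain ⟨j, rfl⟩ : ∃ j, Fin.natAdd (finrank ℚ W) j = i :=
          ⟨⟨i - finrank ℚ W, by omega⟩, by ext; simp; omega⟩
        have h3 : (Submodule.prodEquivOfIsCompl W W' hW').symm x = (⟨x, hxW⟩, 0) :=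
          Submodule.prodEquivOfIsCompl_symm_apply_left W W' hW' ⟨x, hxW⟩
        simp [b, Basis.repr_reindex, Finsupp.mapDomain_equiv_apply, h3])
  rw [hcard] at key
  refine le_trans (le_of_eq ?_) key
  simp only [Real.sq_sqrt (hg _).le]
  rw [Fin.prod_univ_add, ← hdim, Nat.add_sub_cancel_left]
  simp [g]

variable [Module D V]

/-- An isotropic vector is part of a hyperbolic pair. -/
theorem exists_hyperbolic_pair (hψ : IsSkewHermitian ψ) (hnd : IsNondegenerate ψ) {x : V}
    (hx : x ≠ 0) (hxx : ψ x x = 0) : ∃ f : V, ψ f f = 0 ∧ ψ x f = 1 := by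
  have hse : IsSesquilinear ψ := hψ.2
  obtain ⟨y, hy⟩ := hnd x hx
  set z : V := star (ψ x y)⁻¹ • y with hz
  have hxz : ψ x z = 1 := by rw [hz, hse.smul_right, star_star, mul_inv_cancel₀ hy]
  have hzx : ψ z x = -1 := by rw [hψ.1 x z, hxz, star_one]
  -- Since ψ(z, z) is skew, so is its half a. Subtracting a x changes ψ(z, z) by -2a and leaves ψ(x,
  -- z) alone, because x is isotropic.
  set a : D := (2 : D)⁻¹ * ψ z z with ha
  have hstar : star a = -a := by
    have h2 : ψ z z * (2 : D)⁻¹ = (2 : D)⁻¹ * ψ z z :=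
      ((Commute.ofNat_right (ψ z z) 2).inv_right₀).eq
    have h3 : star (2 : D) = 2 := by simp
    have h4 : star (ψ z z) = -ψ z z := by
      rw [eq_neg_iff_add_eq_zero, add_comm, ← eq_neg_iff_add_eq_zero]
      exact hψ.1 z z
    rw [ha, star_mul, star_inv₀, h3, h4, neg_mul, h2]
  refine ⟨z - a • x, ?_, ?_⟩
  · simp only [map_sub, LinearMap.sub_apply, hse.smul_left, hse.smul_right, hxz, hzx, hxx, hstar]
    have : ψ z z = a + a := by
      rw [ha, ← mul_add, ← two_mul, inv_mul_cancel_left₀ two_ne_zero]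
    rw [this]
    simp
  · rw [map_sub, hxz, hse.smul_right, hxx, zero_mul, sub_zero]

theorem exists_hyperbolic_basis (hψ : IsSkewHermitian ψ) (hnd : IsNondegenerate ψ)
    (hdim : finrank D V = 2) {x : V} (hx : x ≠ 0) (hxx : ψ x x = 0) :
    ∃ b : Basis (Fin 2) D V, b 0 = x ∧ ∀ y z, ψ y z =
      b.repr y 0 * star (b.repr z 1) - b.repr y 1 * star (b.repr z 0) := by
  have hse : IsSesquilinear ψ := hψ.2
  obtain ⟨f, hff, hxf⟩ := exists_hyperbolic_pair hψ hnd hx hxx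
  have hfx : ψ f x = -1 := by rw [hψ.1 x f, hxf, star_one]
  have hli : LinearIndependent D ![x, f] := by
    rw [LinearIndependent.pair_iff]
    intro α β h0
    have h1 : ψ (α • x + β • f) f = 0 := by rw [h0, map_zero, LinearMap.zero_apply]
    have h2 : ψ (α • x + β • f) x = 0 := by rw [h0, map_zero, LinearMap.zero_apply]
    rw [map_add, LinearMap.add_apply, hse.smul_left, hse.smul_left, hxf, hff] at h1
    rw [map_add, LinearMap.add_apply, hse.smul_left, hse.smul_left, hfx, hxx] at h2
    simp only [mul_one, mul_zero, add_zero] at h1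
    simp only [mul_zero, mul_neg, mul_one, zero_add, neg_eq_zero] at h2
    exact ⟨h1, h2⟩
  let b : Basis (Fin 2) D V := basisOfLinearIndependentOfCardEqFinrank hli (by simp [hdim])
  have hb0 : b 0 = x := by simp [b]
  have hb1 : b 1 = f := by simp [b]
  refine ⟨b, hb0, fun y z => ?_⟩
  conv_lhs => rw [← b.sum_repr y, ← b.sum_repr z]
  simp only [Fin.sum_univ_two, map_add, LinearMap.add_apply, hse.smul_left, hse.smul_right, hb0,
    hb1, hxx, hff, hxf, hfx]
  simp
  abel

/-- The adapted norm of a hyperbolic plane in which the isotropic vector has length `√t`. -/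
theorem exists_adaptedNorm_hyperbolic (σ : Splitting T d S) (hψ : IsSkewHermitian ψ)
    (hnd : IsNondegenerate ψ)
    (hdim : finrank D V = 2) {x : V} (hx : x ≠ 0) (hxx : ψ x x = 0) {t : ℝ} (ht : 0 < t) :
    ∃ N : AdaptedNorm σ ψ (Fin d ⊕ Fin d), ∀ a : D, N.normSq (a • x) = t * σ.normSq a := by
  obtain ⟨b, hb0, hb⟩ := exists_hyperbolic_basis hψ hnd hdim hx hxx
  have htt : Real.sqrt t * (Real.sqrt t)⁻¹ = 1 := mul_inv_cancel₀ (Real.sqrt_pos.2 ht).ne'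
  -- In a hyperbolic basis the form pairs the first coordinate with the second only, so scaling them
  -- by √t and 1/√t preserves its matrix, which is already orthogonal.
  let N : AdaptedNorm σ ψ (Fin d ⊕ Fin d) :=
    { X := AddMonoidHom.toRatLinearMap
        { toFun := fun y s => Matrix.fromCols (Real.sqrt t • σ.ρ s (b.repr y 0))
            ((Real.sqrt t)⁻¹ • σ.ρ s (b.repr y 1))
          map_zero' := by
            funext s
            ext p (q | q) <;> simp
          map_add' := fun y z => by
            funext s
            ext p (q | q) <;> simp }
      J := fun _ => Matrix.fromBlocks 0 1 (-1) 0
      J_orthogonal := fun _ => by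
        rw [Matrix.fromBlocks_transpose, Matrix.fromBlocks_multiply, ← Matrix.fromBlocks_one]
        simp
      form_eq := fun y z s => by
        rw [hb, map_sub, map_mul, map_mul, σ.ρ_star, σ.ρ_star]
        change _ = Matrix.fromCols _ _ * _ * (Matrix.fromCols _ _).transpose
        rw [Matrix.fromCols_mul_fromBlocks, Matrix.transpose_fromCols,
          Matrix.fromCols_mul_fromRows]
        simp [smul_smul, htt, mul_comm (Real.sqrt t)⁻¹]
        abel
      finrank_eq := by
        rw [← finrank_mul_finrank ℚ D V, hdim, σ.finrank_eq]
        simp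
        ring }
  refine ⟨N, fun a => ?_⟩
  rw [AdaptedNorm.normSq, Splitting.normSq, Finset.mul_sum]
  refine Finset.sum_congr rfl fun s _ => ?_
  change frobSq (Matrix.fromCols _ _) = t * frobSq _
  have h0 : b.repr (a • x) 0 = a := by rw [← hb0]; simp
  have h1 : b.repr (a • x) 1 = 0 := by rw [← hb0]; simp
  rw [h0, h1]
  simp only [frobSq, Finset.mul_sum, Fintype.sum_sum_type]
  simp [mul_pow, Real.sq_sqrt ht.le]

/-- In a lattice in a hyperbolic plane, two independent vectors, one of them isotropic, are
controlled by the discriminant. -/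
theorem IsFormLattice.exists_isotropic_pair (σ : Splitting T d S) (h : IsFormLattice T R ψ L)
    (hdim : finrank D V = 2) {x₀ : V} (hx₀ : x₀ ≠ 0) (hx₀L : x₀ ∈ L) (hxx₀ : ψ x₀ x₀ = 0)
    {K : ℝ} (hK : 0 < K) (hKn : K ^ finrank ℚ V =
      (finrank ℚ V : ℝ) ^ finrank ℚ V * absDisc T ψ L) :
    ∃ (N : AdaptedNorm σ ψ (Fin d ⊕ Fin d)), ∃ x ∈ L, ∃ y ∈ L, x ≠ 0 ∧ ψ x x = 0 ∧
      y ∉ Submodule.span D {x} ∧ N.normSq x ≤ K ∧ N.normSq y ≤ K := by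
  have := h.finite
  have := σ.finiteDimensional
  have : FiniteDimensional ℚ V := Module.Finite.trans D V
  obtain ⟨a, ha, hdet⟩ := h.exists_basis σ
  obtain ⟨N₁, hN₁⟩ := exists_adaptedNorm_hyperbolic σ h.skew h.nondeg hdim hx₀ hxx₀ one_pos
  obtain ⟨x, hxL, ⟨hx, hxs⟩, hxmin⟩ := N₁.exists_min a hdet
    (fun x => x ≠ 0 ∧ x ∈ Submodule.span D {x₀})
    ⟨x₀, ha ▸ hx₀L, hx₀, Submodule.mem_span_singleton_self x₀⟩
  obtain ⟨c, rfl⟩ := Submodule.mem_span_singleton.1 hxs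
  have hc : c ≠ 0 := fun h0 => hx (by rw [h0, zero_smul])
  have hcpos : 0 < σ.normSq c := by
    have := N₁.normSq_pos a hdet hx
    rwa [hN₁, one_mul] at this
  -- Having found the shortest lattice vector on the isotropic line, choose the stretch that gives
  -- it squared length exactly K; it stays the shortest there, as all squared lengths on the line
  -- scale alike.
  obtain ⟨N, hN⟩ := exists_adaptedNorm_hyperbolic σ h.skew h.nondeg hdim hx₀ hxx₀
    (div_pos hK hcpos)
  have hNc : N.normSq (c • x₀) = K := by rw [hN, div_mul_cancel₀ _ hcpos.ne']
  have hne : Submodule.span D {x₀} ≠ ⊤ := by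
    intro htop
    have := finrank_span_singleton (K := D) hx₀
    rw [htop, finrank_top] at this
    omega
  obtain ⟨y₀, hy₀L, hy₀⟩ := h.exists_notMem hne
  obtain ⟨y, hyL, hy, hymin⟩ := N.exists_min a hdet (fun y => y ∉ Submodule.span D {x₀})
    ⟨y₀, ha ▸ hy₀L, hy₀⟩
  refine ⟨N, c • x₀, ha ▸ hxL, y, ha ▸ hyL, hx, ?_, ?_, hNc.le, ?_⟩
  · rw [h.skew.2, hxx₀, mul_zero, zero_mul]
  · rw [Submodule.span_singleton_smul_eq hc.isUnit]
    exact hy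
  -- If the shortest vector off the line had squared length above K, the weights K on the line and
  -- that length off it would have a product exceeding K ^ dim V, which is Minkowski's bound.
  · by_contra! hlt
    have key := N.pow_mul_pow_le a hdet ((Submodule.span D {x₀}).restrictScalars ℚ) hK hlt.le
      (by
        intro z hz hz0
        by_cases hzs : z ∈ Submodule.span D {x₀}
        · have h1 := hxmin z hz ⟨hz0, hzs⟩
          obtain ⟨c', rfl⟩ := Submodule.mem_span_singleton.1 hzs
          rw [hN₁, hN₁, one_mul, one_mul] at h1
          rw [← hNc, hN, hN]
          exact mul_le_mul_of_nonneg_left h1 (div_pos hK hcpos).le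
        · exact hlt.le.trans (hymin z hz hzs))
      (fun z hz hzs => hymin z hz hzs)
    rw [← absDisc_eq a ha, ← hKn] at key
    have hfr : finrank ℚ ((Submodule.span D {x₀}).restrictScalars ℚ) < finrank ℚ V := by
      refine Submodule.finrank_lt ?_
      intro htop
      exact hne (Submodule.restrictScalars_injective ℚ D V (by rw [htop]; rfl))
    have h2 : K ^ finrank ℚ V = K ^ finrank ℚ ((Submodule.span D {x₀}).restrictScalars ℚ) *
        K ^ (finrank ℚ V - finrank ℚ ((Submodule.span D {x₀}).restrictScalars ℚ)) := by
      rw [← pow_add]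
      congr 1
      omega
    rw [h2] at key
    have h3 := le_of_mul_le_mul_left key (pow_pos hK _)
    exact absurd h3 (not_le.2 (pow_lt_pow_left₀ hlt hK.le (by omega)))

end Frames

/-! ### Type II: short non-isotropic vectors in lines and hyperbolic planes. -/

section Quaternionic

variable {D : Type v} [DivisionRing D] [CharZero D] [StarRing D] {T : D →ₗ[ℚ] ℚ}
  {S : Type u} [Fintype S] {V : Type w} [AddCommGroup V] [Module ℚ V]
  {R : Subalgebra ℤ D} {ψ : V →ₗ[ℚ] V →ₗ[ℚ] D} {L : Submodule ℤ V}
  {α : Type*} [Fintype α] [DecidableEq α] {r : Basis α ℚ D}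

/-- The involution of `D` as a linear map. -/
noncomputable def starLinearMap (D : Type v) [DivisionRing D] [CharZero D] [StarRing D] :
    D →ₗ[ℚ] D :=
  AddMonoidHom.toRatLinearMap
    { toFun := fun a => star a, map_zero' := star_zero D, map_add' := star_add }

/-- The subspace of symmetric elements. -/
noncomputable def symmetric (D : Type v) [DivisionRing D] [CharZero D] [StarRing D] :
    Submodule ℚ D :=
  LinearMap.eqLocus (starLinearMap D) LinearMap.id

theorem mem_symmetric {a : D} : a ∈ symmetric D ↔ star a = a := Iff.rfl

theorem Splitting.card_finrank (σ : Splitting T 2 S) : finrank ℚ D = 4 * Fintype.card S := by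
  rw [σ.finrank_eq]
  ring

/-- An order contains small elements outside a subspace of codimension at least `[F : ℚ]`. -/
theorem exists_small_notMem (σ : Splitting T 2 S) (R : Subalgebra ℤ D)
    (hr : Subalgebra.toSubmodule R = Submodule.span ℤ (Set.range r)) (hr1 : 1 ≤ redDisc T r)
    (H : Submodule ℚ D) (hH : finrank ℚ H ≤ 3 * Fintype.card S) :
    ∃ a ∈ R, a ∉ H ∧ σ.normSq a ^ Fintype.card S ≤
      (32 * Fintype.card S : ℝ) ^ Fintype.card S * redDisc T r := by
  have := σ.finiteDimensional
  have hD := σ.card_finrank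
  have he := σ.card_pos
  set e := Fintype.card S
  have heR : (0 : ℝ) < e := by exact_mod_cast he
  have hex : ∃ x ∈ Submodule.span ℤ (Set.range r), x ∉ H := by
    by_contra hcon
    push Not at hcon
    have hle : Submodule.span ℚ (Set.range r) ≤ H := by
      rw [Submodule.span_le]
      rintro _ ⟨i, rfl⟩
      exact hcon _ (Submodule.subset_span ⟨i, rfl⟩)
    rw [r.span_eq, top_le_iff] at hle
    rw [hle, finrank_top] at hH
    omega
  obtain ⟨a, haR, haH, hmin⟩ := σ.adaptedNorm.exists_min r (σ.gram_hermForm_ne_zero r) _ hex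
  have hmemR : ∀ x, x ∈ Submodule.span ℤ (Set.range r) → x ∈ R := fun x hx => by
    rwa [← hr, Subalgebra.mem_toSubmodule] at hx
  refine ⟨a, hmemR a haR, haH, ?_⟩
  simp only [σ.adaptedNorm_normSq] at hmin
  rcases le_total (2 * e : ℝ) (σ.normSq a) with hle | hle
  · have key := σ.adaptedNorm.pow_mul_pow_le r (σ.gram_hermForm_ne_zero r) H
      (lo := 2 * e) (by positivity) hle
      (fun x hx hx0 => by
        have := σ.le_normSq r (Or.inr rfl) R hr (hmemR x hx) hx0
        rw [σ.adaptedNorm_normSq]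
        exact_mod_cast this)
      (fun x hx hxH => hmin x hx hxH)
    rw [Splitting.abs_gram_hermForm r, hD] at key
    -- Every nonzero element of R has squared length at least 2e, the weight used on H. As the
    -- length of a is the larger weight, the dimension of H may be pretended to be 3e; the constant
    -- 32 e then comes from (4e)⁴ = (2e)³ · 32e.
    have h1 : (2 * e : ℝ) ^ (3 * e) * σ.normSq a ^ e ≤
        (2 * e : ℝ) ^ finrank ℚ H * σ.normSq a ^ (4 * e - finrank ℚ H) := by
      rw [show 3 * e = finrank ℚ H + (3 * e - finrank ℚ H) by omega,
        show 4 * e - finrank ℚ H = (3 * e - finrank ℚ H) + e by omega, pow_add, pow_add, mul_assoc]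
      refine mul_le_mul_of_nonneg_left ?_ (by positivity)
      exact mul_le_mul_of_nonneg_right (pow_le_pow_left₀ (by positivity) hle _)
        (pow_nonneg (σ.normSq_nonneg a) _)
    have h2 : ((4 * e : ℕ) : ℝ) ^ (4 * e) = (2 * e : ℝ) ^ (3 * e) * (32 * e : ℝ) ^ e := by
      rw [pow_mul, pow_mul, ← mul_pow]
      congr 1
      push_cast
      ring
    rw [h2, mul_assoc] at key
    exact le_of_mul_le_mul_left (h1.trans key) (by positivity)
  · calc σ.normSq a ^ e ≤ (32 * e : ℝ) ^ e :=
          pow_le_pow_left₀ (σ.normSq_nonneg a) (hle.trans (by linarith)) _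
      _ ≤ (32 * e : ℝ) ^ e * redDisc T r := le_mul_of_one_le_right (by positivity) hr1

/-- The excluded a form the preimage of the symmetric elements under the injection a ↦ c a†, a
subspace of dimension at most 3e. The expression c a† - (c a†)† is the value of ψ at x + a y when x
and y are isotropic and c = ψ(x, y). -/
theorem exists_small_not_symmetric (σ : Splitting T 2 S) (R : Subalgebra ℤ D)
    (hr : Subalgebra.toSubmodule R = Submodule.span ℤ (Set.range r)) (hr1 : 1 ≤ redDisc T r)
    (hsym : finrank ℚ (symmetric D) ≤ 3 * Fintype.card S) {c : D} (hc : c ≠ 0) :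
    ∃ a ∈ R, c * star a - star (c * star a) ≠ 0 ∧ σ.normSq a ^ Fintype.card S ≤
      (32 * Fintype.card S : ℝ) ^ Fintype.card S * redDisc T r := by
  have := σ.finiteDimensional
  let f : D →ₗ[ℚ] D := LinearMap.mulLeft ℚ c ∘ₗ starLinearMap D
  have hf : ∀ a, f a = c * star a := fun a => rfl
  have hfi : Function.Injective f := by
    intro x y hxy
    rw [hf, hf] at hxy
    exact star_injective (mul_left_cancel₀ hc hxy)
  have hle : finrank ℚ ((symmetric D).comap f) ≤ finrank ℚ (symmetric D) := by
    let g : (symmetric D).comap f →ₗ[ℚ] symmetric D :=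
      (f ∘ₗ ((symmetric D).comap f).subtype).codRestrict _ fun x => x.2
    refine LinearMap.finrank_le_finrank_of_injective (f := g) fun x y hxy => ?_
    exact Subtype.ext (hfi (congrArg Subtype.val hxy))
  obtain ⟨a, haR, haH, ha⟩ := exists_small_notMem σ R hr hr1 _ (hle.trans hsym)
  refine ⟨a, haR, fun h0 => haH ?_, ha⟩
  rw [Submodule.mem_comap, mem_symmetric, hf]
  exact (sub_eq_zero.1 h0).symm

theorem AdaptedNorm.prod_loc_le {d : ℕ} {σ : Splitting T d S} {κ : Type*} [Fintype κ]
    [DecidableEq κ] (N : AdaptedNorm σ ψ κ)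
    (x : V) {K : ℝ} (hK : N.normSq x ≤ K) :
    ∏ s, N.loc s x ≤ (K / Fintype.card S) ^ Fintype.card S :=
  (prod_le_div_card_pow _ fun s => N.loc_nonneg s x).trans
    (pow_le_pow_left₀ (div_nonneg (Finset.sum_nonneg fun s _ => N.loc_nonneg s x)
      (Nat.cast_nonneg _)) (div_le_div_of_nonneg_right hK (Nat.cast_nonneg _)) _)

theorem Splitting.detProd_sq_le_of_loc_le (σ : Splitting T 2 S) {a : D} {g : S → ℝ}
    (h : ∀ s, σ.loc s a ≤ 2 * g s) : σ.detProd a ^ 2 ≤ (∏ s, g s) ^ 4 := by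
  refine (σ.detProd_sq_le_prod (Or.inr rfl) a).trans ?_
  rw [← Finset.prod_pow]
  refine Finset.prod_le_prod (fun s _ => ?_) fun s _ => ?_
  · exact pow_nonneg (div_nonneg (σ.loc_nonneg s a) (by norm_num)) _
  · refine pow_le_pow_left₀ (div_nonneg (σ.loc_nonneg s a) (by norm_num)) ?_ 4
    have := h s
    push_cast
    linarith

variable [Module D V]

/-- A lattice in a line contains a vector on which the form is small. -/
theorem IsFormLattice.exists_small_of_finrank_eq_one (σ : Splitting T 2 S)
    (h : IsFormLattice T R ψ L) (hdim : finrank D V = 1) :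
    ∃ x ∈ L, ψ x x ≠ 0 ∧
      σ.detProd (ψ x x) ^ 2 ≤ 2 ^ (12 * Fintype.card S) * absDisc T ψ L ^ 2 ∧
      σ.normSq (ψ x x) ^ (4 * Fintype.card S) ≤
        (4 * Fintype.card S : ℝ) ^ (8 * Fintype.card S) * absDisc T ψ L ^ 2 := by
  have := h.finite
  have := σ.finiteDimensional
  have he := σ.card_pos
  have hD := σ.card_finrank
  obtain ⟨a, ha, hdet⟩ := h.exists_basis σ
  obtain ⟨N⟩ := σ.exists_adaptedNorm h.skew h.nondeg (finBasisOfFinrankEq D V hdim)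
  obtain ⟨w, hwL, hwm, hwmin⟩ := h.exists_minima N hdim
  have key := h.prod_pow_le N w _ (fun i => N.normSq_pos a hdet (w.ne_zero i)) hwm hwmin
  have hV : finrank ℚ V = 4 * Fintype.card S := by
    rw [← finrank_mul_finrank ℚ D V, hdim, mul_one, hD]
  simp only [Fin.prod_univ_one, hD, hV] at key
  set x := w 0
  set e := Fintype.card S
  have heR : (0 : ℝ) < e := by exact_mod_cast he
  have hxx : ψ x x ≠ 0 := by
    intro h0
    obtain ⟨y, hy⟩ := h.nondeg x (w.ne_zero 0)
    apply hy
    have hse : IsSesquilinear ψ := h.skew.2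
    rw [← w.sum_repr y, Fin.sum_univ_one, hse.smul_right, h0, zero_mul]
  have hX : 0 ≤ absDisc T ψ L := abs_nonneg _
  refine ⟨x, hwL 0, hxx, ?_, ?_⟩
  · have h1 := σ.detProd_sq_le_of_loc_le (a := ψ x x) (g := fun s => (1 / 2) * N.loc s x ^ 2)
      fun s => by
        have := N.loc_form_le s x x
        nlinarith
    rw [Finset.prod_mul_distrib, Finset.prod_pow] at h1
    simp only [Finset.prod_const, Finset.card_univ] at h1
    have h2 := N.prod_loc_le x le_rfl
    have h3 : (∏ s, N.loc s x) ^ 8 ≤ 4 ^ (8 * e) * absDisc T ψ L ^ 2 := by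
      calc (∏ s, N.loc s x) ^ 8 ≤ ((N.normSq x / e) ^ e) ^ 8 :=
            pow_le_pow_left₀ (Finset.prod_nonneg fun s _ => N.loc_nonneg s x) h2 _
        _ = (N.normSq x ^ (4 * e)) ^ 2 / (e : ℝ) ^ (8 * e) := by
            rw [div_pow, div_pow]
            congr 1 <;> ring
        _ ≤ (((4 * e : ℕ) : ℝ) ^ (4 * e) * absDisc T ψ L) ^ 2 / (e : ℝ) ^ (8 * e) := by
            refine div_le_div_of_nonneg_right ?_ (by positivity)
            exact pow_le_pow_left₀ (pow_nonneg (N.normSq_nonneg x) _) key 2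
        _ = _ := by
            rw [div_eq_iff (by positivity)]
            push_cast
            ring
    calc σ.detProd (ψ x x) ^ 2 ≤ _ := h1
      _ = (1 / 2) ^ (4 * e) * (∏ s, N.loc s x) ^ 8 := by
          change ((1 / 2 : ℝ) ^ e * _) ^ 4 = _
          ring
      _ ≤ (1 / 2) ^ (4 * e) * (4 ^ (8 * e) * absDisc T ψ L ^ 2) :=
          mul_le_mul_of_nonneg_left h3 (by positivity)
      _ = _ := by
          rw [← mul_assoc]
          congr 1
          rw [show (4 : ℝ) ^ (8 * e) = 2 ^ (4 * e) * 2 ^ (12 * e) by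
            rw [← pow_add, show (4 : ℝ) = 2 ^ 2 by norm_num, ← pow_mul]
            congr 1
            ring, ← mul_assoc, ← mul_pow]
          norm_num
  · calc σ.normSq (ψ x x) ^ (4 * e) ≤ (N.normSq x * N.normSq x) ^ (4 * e) :=
          pow_le_pow_left₀ (σ.normSq_nonneg _) (N.normSq_form_le x x) _
      _ = (N.normSq x ^ (4 * e)) ^ 2 := by ring
      _ ≤ (((4 * e : ℕ) : ℝ) ^ (4 * e) * absDisc T ψ L) ^ 2 :=
          pow_le_pow_left₀ (pow_nonneg (N.normSq_nonneg x) _) key 2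
      _ = _ := by
          push_cast
          ring

/-- A lattice in a hyperbolic plane contains a nonisotropic vector on which the form is small. -/
theorem IsFormLattice.exists_nonisotropic (σ : Splitting T 2 S) (h : IsFormLattice T R ψ L)
    (hr : Subalgebra.toSubmodule R = Submodule.span ℤ (Set.range r)) (hr1 : 1 ≤ redDisc T r)
    (hsym : finrank ℚ (symmetric D) ≤ 3 * Fintype.card S)
    (hdim : finrank D V = 2) {x₀ : V} (hx₀ : x₀ ≠ 0) (hx₀L : x₀ ∈ L) (hxx₀ : ψ x₀ x₀ = 0) :
    ∃ x ∈ L, ψ x x ≠ 0 ∧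
      σ.detProd (ψ x x) ^ 2 ≤
        2 ^ (48 * Fintype.card S) * redDisc T r ^ 4 * absDisc T ψ L ∧
      σ.normSq (ψ x x) ^ (4 * Fintype.card S) ≤
        (2 ^ 13 * Fintype.card S ^ 3 : ℝ) ^ (4 * Fintype.card S) * redDisc T r ^ 4 *
          absDisc T ψ L := by
  have := h.finite
  have := σ.finiteDimensional
  have he := σ.card_pos
  have hD := σ.card_finrank
  have hV : finrank ℚ V = 8 * Fintype.card S := by
    rw [← finrank_mul_finrank ℚ D V, hdim, hD]
    omega
  set e := Fintype.card S with he'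
  have he1 : (1 : ℝ) ≤ e := by exact_mod_cast he
  have heR : (0 : ℝ) < e := by linarith
  set X := absDisc T ψ L with hX
  set Δ := redDisc T r with hΔ
  have hX1 : 1 ≤ X := h.one_le_absDisc σ
  have hX0 : 0 < X := by linarith
  -- The normalisation K ^ (8e) = (8e) ^ (8e) |disc L| is Minkowski's bound in dimension 8e = dim V.
  set K : ℝ := 8 * e * X ^ ((8 * e : ℝ)⁻¹) with hKdef
  have hK : 0 < K := by positivity
  have hKn : K ^ (8 * e) = (8 * e : ℝ) ^ (8 * e) * X := by
    rw [hKdef, mul_pow, ← Real.rpow_natCast (X ^ _), ← Real.rpow_mul hX0.le]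
    push_cast
    rw [inv_mul_cancel₀ (by positivity), Real.rpow_one]
  clear_value K
  obtain ⟨N, x, hxL, y, hyL, hx0, hxx, hyx, hxK, hyK⟩ :=
    h.exists_isotropic_pair σ hdim hx₀ hx₀L hxx₀ hK (by rw [hV, hKn]; push_cast; rfl)
  have hPK : ((K / e) ^ e) ^ 8 = 2 ^ (24 * e) * X := by
    rw [← pow_mul, mul_comm e 8, div_pow, hKn, mul_pow, div_eq_iff (by positivity),
      show (2 : ℝ) ^ (24 * e) = 8 ^ (8 * e) by
        rw [show (8 : ℝ) = 2 ^ 3 by norm_num, ← pow_mul]; congr 1; ring]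
    ring
  have hPx := N.prod_loc_le x hxK
  have hPy := N.prod_loc_le y hyK
  have hPx0 : 0 ≤ ∏ s, N.loc s x := Finset.prod_nonneg fun s _ => N.loc_nonneg s x
  have hPy0 : 0 ≤ ∏ s, N.loc s y := Finset.prod_nonneg fun s _ => N.loc_nonneg s y
  have hΔ4 : 1 ≤ Δ ^ 4 := one_le_pow₀ hr1
  by_cases hyy : ψ y y = 0
  -- x and y span the plane and x is isotropic, so ψ(x, y) = 0 would put x in the radical.
  · have hxy : ψ x y ≠ 0 := by
      intro h0
      have hle : ∀ z, ψ x z = 0 := by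
        have hspan : Submodule.span D {x, y} = ⊤ := by
          have := h.finite
          have hlt : Submodule.span D {x} < Submodule.span D {x, y} := by
            refine lt_of_le_of_ne (Submodule.span_mono (by simp)) fun heq => hyx ?_
            rw [heq]
            exact Submodule.subset_span (by simp)
          have h1 := Submodule.finrank_lt_finrank_of_lt hlt
          rw [finrank_span_singleton hx0] at h1
          exact Submodule.eq_top_of_finrank_eq
            (le_antisymm (Submodule.finrank_le _) (by omega))
        intro z
        have hz : z ∈ Submodule.span D {x, y} := by rw [hspan]; trivial
        obtain ⟨p, q, rfl⟩ := Submodule.mem_span_pair.1 hz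
        have hse : IsSesquilinear ψ := h.skew.2
        rw [map_add, hse.smul_right, hse.smul_right, hxx, h0, zero_mul, zero_mul,
          add_zero]
      obtain ⟨z, hz⟩ := h.nondeg x hx0
      exact hz (hle z)
    -- Both vectors are isotropic: perturb x by a short multiple of y. At each place the new value
    -- is controlled by the lengths of x, y and a, a† having the length of a.
    obtain ⟨a, haR, ha, haΔ⟩ := exists_small_not_symmetric σ R hr hr1 hsym hxy
    have hb : ψ (x + a • y) (x + a • y) = ψ x y * star a - star (ψ x y * star a) := by
      have hse : IsSesquilinear ψ := h.skew.2
      simp only [map_add, LinearMap.add_apply, hse.smul_left, hse.smul_right, hxx, hyy,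
        h.skew.1 x y, star_mul, star_star]
      simp [sub_eq_add_neg, add_comm]
    have hloc : ∀ s, σ.loc s (ψ (x + a • y) (x + a • y)) ≤
        4 * (N.loc s x * N.loc s y * σ.loc s a) := by
      intro s
      rw [hb, sub_eq_add_neg]
      refine (σ.loc_add_le s _ _).trans ?_
      rw [σ.loc_neg, σ.loc_star]
      have h1 := σ.loc_mul_le s (ψ x y) (star a)
      rw [σ.loc_star] at h1
      have h2 := mul_le_mul_of_nonneg_right (N.loc_form_le s x y) (σ.loc_nonneg s a)
      linarith
    have hPa : ∏ s, σ.loc s a ≤ 32 ^ e * Δ := by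
      have h1 := σ.adaptedNorm.prod_loc_le a le_rfl
      rw [← he'] at h1
      refine h1.trans ?_
      rw [div_pow, div_le_iff₀ (by positivity)]
      refine haΔ.trans_eq ?_
      rw [mul_pow]
      ring
    have hPa0 : 0 ≤ ∏ s, σ.loc s a := Finset.prod_nonneg fun s _ => σ.loc_nonneg s a
    refine ⟨x + a • y, L.add_mem hxL (h.stable a haR y hyL), hb ▸ ha, ?_, ?_⟩
    · have h1 := σ.detProd_sq_le_of_loc_le (a := ψ (x + a • y) (x + a • y))
        (g := fun s => 2 * (N.loc s x * N.loc s y * σ.loc s a)) fun s => by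
          have := hloc s
          linarith
      simp only [Finset.prod_mul_distrib, Finset.prod_const, Finset.card_univ] at h1
      calc _ ≤ _ := h1
        _ ≤ (2 ^ e * ((K / e) ^ e * (K / e) ^ e * (32 ^ e * Δ))) ^ 4 := by
            rw [← he']
            gcongr
        _ = 2 ^ (4 * e) * ((K / e) ^ e) ^ 8 * 32 ^ (4 * e) * Δ ^ 4 := by ring
        _ = _ := by
            rw [hPK, show (32 : ℝ) ^ (4 * e) = 2 ^ (20 * e) by
              rw [show (32 : ℝ) = 2 ^ 5 by norm_num, ← pow_mul]; congr 1; ring,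
              show 48 * e = 4 * e + 24 * e + 20 * e by ring, pow_add, pow_add]
            ring
    · have h1 : σ.normSq (ψ (x + a • y) (x + a • y)) ≤ 4 * (K * K * σ.normSq a) := by
        calc _ ≤ ∑ s, 4 * (N.loc s x * N.loc s y * σ.loc s a) :=
              Finset.sum_le_sum fun s _ => hloc s
          _ ≤ ∑ s, 4 * (N.loc s x * K * σ.normSq a) := by
              refine Finset.sum_le_sum fun s _ => ?_
              have h2 : N.loc s y ≤ K := le_trans (Finset.single_le_sum
                (f := fun s => N.loc s y) (fun s _ => N.loc_nonneg s y) (Finset.mem_univ s)) hyK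
              have h3 : σ.loc s a ≤ σ.normSq a := Finset.single_le_sum
                (f := fun s => σ.loc s a) (fun s _ => σ.loc_nonneg s a) (Finset.mem_univ s)
              have := N.loc_nonneg s x
              have := σ.loc_nonneg s a
              gcongr
          _ = 4 * (N.normSq x * K * σ.normSq a) := by
              rw [AdaptedNorm.normSq, Finset.sum_mul, Finset.sum_mul, Finset.mul_sum]
          _ ≤ _ := by
              have := σ.normSq_nonneg a
              gcongr
      calc _ ≤ (4 * (K * K * σ.normSq a)) ^ (4 * e) :=
            pow_le_pow_left₀ (σ.normSq_nonneg _) h1 _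
        _ = 4 ^ (4 * e) * K ^ (8 * e) * (σ.normSq a ^ e) ^ 4 := by ring
        _ ≤ 4 ^ (4 * e) * K ^ (8 * e) * ((32 * e : ℝ) ^ e * Δ) ^ 4 := by
            have := σ.normSq_nonneg a
            gcongr
        _ = (4 * (8 * e) ^ 2 * (32 * e) : ℝ) ^ (4 * e) * Δ ^ 4 * X := by
            rw [hKn, show 8 * e = 2 * (4 * e) by ring, pow_mul (8 * (e : ℝ)), mul_pow _ Δ,
              ← pow_mul (32 * (e : ℝ)), mul_comm e 4, mul_pow (4 * (8 * e : ℝ) ^ 2), mul_pow 4]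
            ring
        _ = _ := by
            congr 3
            ring
  · refine ⟨y, hyL, hyy, ?_, ?_⟩
    · have h1 := σ.detProd_sq_le_of_loc_le (a := ψ y y) (g := fun s => N.loc s y ^ 2)
        fun s => by
          have := N.loc_form_le s y y
          nlinarith [sq_nonneg (N.loc s y)]
      rw [Finset.prod_pow] at h1
      calc _ ≤ _ := h1
        _ = (∏ s, N.loc s y) ^ 8 := by ring
        _ ≤ ((K / e) ^ e) ^ 8 := pow_le_pow_left₀ hPy0 hPy _
        _ = 2 ^ (24 * e) * 1 * X := by rw [hPK, mul_one]
        _ ≤ _ := by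
            gcongr
            · norm_num
            · omega
    · calc σ.normSq (ψ y y) ^ (4 * e) ≤ (K * K) ^ (4 * e) :=
            pow_le_pow_left₀ (σ.normSq_nonneg _) ((N.normSq_form_le y y).trans
              (mul_le_mul hyK hyK (N.normSq_nonneg y) hK.le)) _
        _ = K ^ (8 * e) := by ring
        _ = ((8 * e : ℝ) ^ 2) ^ (4 * e) * 1 * X := by
            rw [hKn, mul_one, ← pow_mul, show 2 * (4 * e) = 8 * e by ring]
        _ ≤ _ := by
            gcongr
            nlinarith [pow_le_pow_right₀ he1 (show 2 ≤ 3 by norm_num)]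

end Quaternionic

/-! ### Discriminants of orthogonal sums, and logarithmic bounds for one block. -/

section Gluing

variable {D : Type v} [DivisionRing D] [CharZero D] [StarRing D] {T : D →ₗ[ℚ] ℚ} {d : ℕ}
  {S : Type u} [Fintype S] {V : Type w} [AddCommGroup V] [Module ℚ V] [Module D V]
  (σ : Splitting T d S) {R : Subalgebra ℤ D} {ψ : V →ₗ[ℚ] V →ₗ[ℚ] D} {L : Submodule ℤ V}
  {α : Type*} [Fintype α] [DecidableEq α] (r : Basis α ℚ D)

theorem prod_det_formMatrix_append {p q : ℕ} (u : Fin (p + q) → V)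
    (h12 : ∀ i j, ψ (u (Fin.castAdd q i)) (u (Fin.natAdd p j)) = 0) :
    ∏ s, |(σ.formMatrix ψ u s).det| ^ d =
      (∏ s, |(σ.formMatrix ψ (fun i => u (Fin.castAdd q i)) s).det| ^ d) *
        ∏ s, |(σ.formMatrix ψ (fun i => u (Fin.natAdd p i)) s).det| ^ d := by
  rw [← Finset.prod_mul_distrib]
  refine Finset.prod_congr rfl fun s _ => ?_
  rw [← mul_pow, ← abs_mul, ← Matrix.det_fromBlocks_zero₁₂ _
    (Matrix.of fun (a : Fin q × Fin d) (b : Fin p × Fin d) =>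
      σ.ρ s (ψ (u (Fin.natAdd p a.1)) (u (Fin.castAdd q b.1))) a.2 b.2)]
  let e : (Fin p × Fin d) ⊕ (Fin q × Fin d) ≃ Fin (p + q) × Fin d :=
    (Equiv.sumProdDistrib _ _ _).symm.trans (finSumFinEquiv.prodCongr (Equiv.refl _))
  rw [← Matrix.det_submatrix_equiv_self e]
  congr 3
  ext (a | a) (b | b) <;> simp [Splitting.formMatrix, e, h12]

/-- Bases of two complementary orthogonal subspaces form a basis. -/
theorem exists_basis_append (hψ : IsSkewHermitian ψ) {W W' : Submodule D V} (hW : IsCompl W W')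
    (horth : ∀ x ∈ W', ∀ y ∈ W, ψ x y = 0) {p q : ℕ} (v : Basis (Fin p) D W)
    (v' : Basis (Fin q) D W') :
    ∃ u : Basis (Fin (p + q)) D V, (∀ i, u (Fin.castAdd q i) = v i) ∧
      (∀ i, u (Fin.natAdd p i) = v' i) ∧
      latticeDisc σ r ψ u =
        latticeDisc σ r (restrictForm ψ W) v * latticeDisc σ r (restrictForm ψ W') v' := by
  let u : Basis (Fin (p + q)) D V :=
    ((v.prod v').map (Submodule.prodEquivOfIsCompl W W' hW)).reindex finSumFinEquiv
  have h1 : ∀ i, u (Fin.castAdd q i) = v i := fun i => by simp [u]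
  have h2 : ∀ i, u (Fin.natAdd p i) = v' i := fun i => by simp [u]
  refine ⟨u, h1, h2, ?_⟩
  rw [latticeDisc, prod_det_formMatrix_append σ u fun i j => by
    rw [h1, h2]
    exact hψ.eq_zero_comm (horth _ (v' j).2 _ (v i).2)]
  simp only [h1, h2, latticeDisc, pow_add]
  rw [mul_mul_mul_comm]
  rfl

theorem latticeDisc_single (v : Fin 1 → V) :
    latticeDisc σ r ψ v = redDisc T r * σ.detProd (ψ (v 0) (v 0)) := by
  rw [latticeDisc, σ.prod_det_formMatrix_orthogonal ψ v
    fun i j hij => (hij (Subsingleton.elim _ _)).elim]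
  simp

theorem latticeDisc_pair (hψ : IsSkewHermitian ψ) (v : Fin 2 → V) (h0 : ψ (v 0) (v 0) = 0) :
    latticeDisc σ r ψ v = (redDisc T r * σ.detProd (ψ (v 0) (v 1))) ^ 2 := by
  rw [latticeDisc, σ.prod_det_formMatrix_pair hψ.1 v h0, mul_pow]

theorem nondegenerate_of_basis_single (hψ : IsSesquilinear ψ) (v : Basis (Fin 1) D V)
    (h : ψ (v 0) (v 0) ≠ 0) : IsNondegenerate ψ := by
  intro x hx
  refine ⟨v 0, ?_⟩
  rw [← v.sum_repr x, Fin.sum_univ_one, hψ.smul_left]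
  refine mul_ne_zero (fun h0 => hx ?_) h
  rw [← v.sum_repr x, Fin.sum_univ_one, h0, zero_smul]

theorem nondegenerate_of_basis_pair (hψ : IsSkewHermitian ψ) (v : Basis (Fin 2) D V)
    (h0 : ψ (v 0) (v 0) = 0) (h : ψ (v 0) (v 1) ≠ 0) : IsNondegenerate ψ := by
  have hse : IsSesquilinear ψ := hψ.2
  intro x hx
  by_cases h1 : v.repr x 1 = 0
  · refine ⟨v 1, ?_⟩
    rw [← v.sum_repr x, Fin.sum_univ_two, h1, zero_smul, add_zero, hse.smul_left]
    refine mul_ne_zero (fun h2 => hx ?_) h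
    rw [← v.sum_repr x, Fin.sum_univ_two, h1, h2, zero_smul, zero_smul, add_zero]
  · refine ⟨v 0, ?_⟩
    rw [← v.sum_repr x, Fin.sum_univ_two, map_add, LinearMap.add_apply, hse.smul_left,
      hse.smul_left, h0, mul_zero, zero_add]
    exact mul_ne_zero h1 fun h2 => h (hψ.eq_zero_comm h2)

theorem exists_basis_single {x : V} (hx : x ≠ 0) :
    ∃ (W : Submodule D V) (v : Basis (Fin 1) D W), (v 0 : V) = x := by
  have hli : LinearIndependent D ![x] := LinearIndependent.of_subsingleton 0 hx
  exact ⟨_, Basis.span hli, by simp [Basis.span_apply]⟩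

theorem exists_basis_pair (hψ : IsSkewHermitian ψ) {x y : V} (hxx : ψ x x = 0)
    (hxy : ψ x y ≠ 0) :
    ∃ (W : Submodule D V) (v : Basis (Fin 2) D W), (v 0 : V) = x ∧ (v 1 : V) = y := by
  have hse : IsSesquilinear ψ := hψ.2
  have hli : LinearIndependent D ![x, y] := by
    rw [LinearIndependent.pair_iff]
    intro a b h0
    have h1 : ψ (a • x + b • y) x = 0 := by rw [h0, map_zero, LinearMap.zero_apply]
    have h2 : ψ (a • x + b • y) y = 0 := by rw [h0, map_zero, LinearMap.zero_apply]
    rw [map_add, LinearMap.add_apply, hse.smul_left, hse.smul_left, hxx, mul_zero,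
      zero_add] at h1
    have hb : b = 0 := (mul_eq_zero.1 h1).resolve_right fun h3 => hxy (hψ.eq_zero_comm h3)
    rw [hb, zero_smul, add_zero, hse.smul_left] at h2
    exact ⟨(mul_eq_zero.1 h2).resolve_right hxy, hb⟩
  exact ⟨_, Basis.span hli, by simp [Basis.span_apply], by simp [Basis.span_apply]⟩

theorem latticeDisc_pos (hψ : IsSesquilinear ψ) (hnd : IsNondegenerate ψ) {m : ℕ}
    (v : Basis (Fin m) D V) : 0 < latticeDisc σ r ψ v := by
  classical
  rw [← abs_gram_det_smulTower' σ r hψ v]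
  have := σ.gram_det_ne_zero hψ hnd (r.smulTower v)
  exact_mod_cast abs_pos.2 this

/-- Logarithmic bound for the discriminant of an order. -/
noncomputable def orderBound (σ : Splitting T d S) (r : Basis α ℚ D) (m₀ : ℕ) : ℝ :=
  Real.log |(d : ℝ) ^ finrank ℚ D * redDisc T r| +
    (finrank ℚ D : ℝ) / 2 * Real.log (d * Fintype.card S * (m₀ : ℝ) ^ 2)

theorem orderBound_nonneg (hr1 : 1 ≤ redDisc T r) {m₀ : ℕ} (hm₀ : 0 < m₀) :
    0 ≤ orderBound σ r m₀ := by
  have hd : (1 : ℝ) ≤ d := by exact_mod_cast σ.d_pos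
  have he : (1 : ℝ) ≤ Fintype.card S := by exact_mod_cast σ.card_pos
  have hm : (1 : ℝ) ≤ m₀ := by exact_mod_cast hm₀
  have h1 : (1 : ℝ) ≤ (d : ℝ) ^ finrank ℚ D := one_le_pow₀ hd
  refine add_nonneg (Real.log_nonneg ?_) (mul_nonneg (by positivity) (Real.log_nonneg ?_))
  · exact (by nlinarith : (1 : ℝ) ≤ (d : ℝ) ^ finrank ℚ D * redDisc T r).trans (le_abs_self _)
  · have h2 : (1 : ℝ) ≤ (m₀ : ℝ) ^ 2 := one_le_pow₀ hm
    have h3 : (1 : ℝ) ≤ d * Fintype.card S := by nlinarith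
    nlinarith

/-- The logarithmic form of the bounds for the value of the form on a small block. -/
theorem log_bounds_of_normSq_pow_le (hd : d = 1 ∨ d = 2) {c : D} (hc : c ≠ 0) {m m₀ : ℕ}
    (hm : 0 < m) (hmm : m ≤ m₀) {X : ℝ} (hX : 1 ≤ X)
    (h : σ.normSq c ^ (m * finrank ℚ D) ≤
      (((m * finrank ℚ D : ℕ) : ℝ) ^ (m * finrank ℚ D) * X) ^ 2) :
    (finrank ℚ D : ℝ) / 2 * Real.log (σ.normSq c) ≤
        finrank ℚ D * Real.log (m * finrank ℚ D) + Real.log X / m ∧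
      Real.log (redDisc T r * σ.detProd c) ≤ orderBound σ r m₀ + Real.log X / m := by
  have hdp := σ.d_pos
  have hep := σ.card_pos
  have hdR : (0 : ℝ) < d := by exact_mod_cast hdp
  have heR : (0 : ℝ) < Fintype.card S := by exact_mod_cast hep
  have hmR : (0 : ℝ) < m := by exact_mod_cast hm
  have hD0 : 0 < finrank ℚ D := by
    rw [σ.finrank_eq]
    positivity
  have hDR : (0 : ℝ) < finrank ℚ D := by exact_mod_cast hD0
  have hcpos : 0 < σ.normSq c := by
    have h1 := σ.detProd_sq_le hd c
    refine lt_of_le_of_ne (σ.normSq_nonneg c) fun h0 => ?_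
    rw [← h0, zero_div, zero_pow hD0.ne'] at h1
    exact absurd h1 (not_le.2 (pow_pos (σ.detProd_pos hc) 2))
  have hΔ := σ.redDisc_pos r
  have hP := σ.detProd_pos hc
  have h1 : (finrank ℚ D : ℝ) / 2 * Real.log (σ.normSq c) ≤
        finrank ℚ D * Real.log (m * finrank ℚ D) + Real.log X / m := by
    have h2 := Real.log_le_log (pow_pos hcpos _) h
    rw [Real.log_pow, Real.log_pow, Real.log_mul (by positivity) (by positivity),
      Real.log_pow] at h2
    push_cast at h2
    rw [← sub_nonneg] at h2 ⊢
    have h3 : finrank ℚ D * Real.log (m * finrank ℚ D) + Real.log X / m -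
        (finrank ℚ D : ℝ) / 2 * Real.log (σ.normSq c) = (2 * (m * finrank ℚ D *
          Real.log (m * finrank ℚ D) + Real.log X) - m * finrank ℚ D * Real.log (σ.normSq c)) /
            (2 * m) := by
      field_simp
    rw [h3]
    exact div_nonneg h2 (by positivity)
  refine ⟨h1, ?_⟩
  have h2 := Real.log_le_log (pow_pos hP 2) (σ.detProd_sq_le hd c)
  rw [Real.log_pow, Real.log_pow, Real.log_div hcpos.ne' (by positivity),
    Real.log_mul hdR.ne' heR.ne'] at h2
  push_cast at h2
  rw [orderBound, abs_of_pos (by positivity), Real.log_mul (by positivity) hΔ.ne', Real.log_pow,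
    Real.log_mul hΔ.ne' hP.ne']
  have hD' : (finrank ℚ D : ℝ) = d * (Fintype.card S * d) := by exact_mod_cast σ.finrank_eq
  have h3 : Real.log (m * finrank ℚ D) = Real.log m + 2 * Real.log d + Real.log (Fintype.card S) := by
    rw [hD', Real.log_mul hmR.ne' (by positivity), Real.log_mul hdR.ne' (by positivity),
      Real.log_mul heR.ne' hdR.ne']
    ring
  have hm₀ : (0 : ℝ) < m₀ := by exact_mod_cast hm.trans_le hmm
  have h4 : Real.log m ≤ Real.log m₀ := Real.log_le_log hmR (by exact_mod_cast hmm)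
  have h5 : Real.log (d * Fintype.card S * (m₀ : ℝ) ^ 2) =
      Real.log d + Real.log (Fintype.card S) + 2 * Real.log m₀ := by
    rw [Real.log_mul (by positivity) (by positivity), Real.log_mul hdR.ne' heR.ne', Real.log_pow]
    push_cast
    ring
  rw [h3] at h1
  rw [h5]
  -- With n = d² e one has n log(m n) - (n/2) log(d e) = n log d + (n/2) log(d e m²). So
  -- `orderBound` is exactly what the block requires at m = m₀; keeping m₀ fixed lets one quantity
  -- serve the whole induction.
  nlinarith [mul_le_mul_of_nonneg_left h4 hDR.le]

end Gluing

/-! ### Type I: induction over hyperbolic pairs. -/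

section TypeOneBasis

variable {D : Type v} [DivisionRing D] [CharZero D] [StarRing D] {T : D →ₗ[ℚ] ℚ} {d : ℕ}
  {S : Type u} [Fintype S] {α : Type*} [Fintype α] [DecidableEq α]

theorem Splitting.normSq_star (σ : Splitting T d S) (a : D) : σ.normSq (star a) = σ.normSq a :=
  Finset.sum_congr rfl fun s _ => σ.loc_star s a

theorem Splitting.normSq_neg (σ : Splitting T d S) (a : D) : σ.normSq (-a) = σ.normSq a :=
  Finset.sum_congr rfl fun s _ => σ.loc_neg s a

theorem latticeDisc_zero (σ : Splitting T d S) (r : Basis α ℚ D) {V : Type w} [AddCommGroup V]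
    [Module ℚ V] (ψ : V →ₗ[ℚ] V →ₗ[ℚ] D) (v : Fin 0 → V) : latticeDisc σ r ψ v = 1 := by
  simp [latticeDisc]

/-- The prepended block has two vectors, so the pairing {2k - 1, 2k} of the remaining ones is
carried to the pairing with k + 1. -/
theorem isWeaklySymplectic_of_append {V : Type w} [AddCommGroup V] [Module ℚ V] [Module D V]
    {ψ : V →ₗ[ℚ] V →ₗ[ℚ] D} {q : ℕ} (u : Fin (2 + q) → V) (halt : ∀ x, ψ x x = 0)
    (h12 : ∀ i j, ψ (u (Fin.castAdd q i)) (u (Fin.natAdd 2 j)) = 0)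
    (h21 : ∀ i j, ψ (u (Fin.natAdd 2 j)) (u (Fin.castAdd q i)) = 0)
    (h22 : IsWeaklySymplectic ψ fun j => u (Fin.natAdd 2 j)) : IsWeaklySymplectic ψ u := by
  intro i j hij
  induction i using Fin.addCases with
  | left i =>
    induction j using Fin.addCases with
    | left j =>
      by_cases h : i = j
      · rw [h, halt]
      · exfalso
        apply hij
        refine ⟨1, ?_⟩
        fin_cases i <;> fin_cases j <;> simp_all [Set.pair_comm]
    | right j => exact h12 i j
  | right i =>
    induction j using Fin.addCases with
    | left j => exact h21 j i
    | right j =>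
      refine h22 i j fun ⟨k, hk⟩ => hij ⟨k + 1, ?_⟩
      rw [Set.pair_eq_pair_iff] at hk ⊢
      simp only [Fin.val_natAdd]
      push_cast
      omega

/-- Bounds for weakly symplectic bases, when the involution is trivial. -/
theorem exists_symplectic_basis (σ : Splitting T 1 S) {R : Subalgebra ℤ D} (r : Basis α ℚ D)
    (hr : Subalgebra.toSubmodule R = Submodule.span ℤ (Set.range r)) (hr1 : 1 ≤ redDisc T r)
    (hstar : ∀ a : D, star a = a) {m₀ : ℕ} (m : ℕ) :
    ∀ (V : Type w) [AddCommGroup V] [Module ℚ V] [Module D V] (ψ : V →ₗ[ℚ] V →ₗ[ℚ] D)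
      (L : Submodule ℤ V), IsFormLattice T R ψ L → finrank D V = m → m ≤ m₀ →
      ∃ b : Basis (Fin m) D V, (∀ i, b i ∈ L) ∧ IsWeaklySymplectic ψ b ∧
        Real.log (latticeDisc σ r ψ b) ≤ m / 2 * Real.log (absDisc T ψ L) +
          m * (m + 2) / 4 * orderBound σ r m₀ ∧
        ∀ i j, ψ (b i) (b j) ≠ 0 →
          (finrank ℚ D : ℝ) / 2 * Real.log (σ.normSq (ψ (b i) (b j))) ≤
            (m + 2) / 8 * Real.log (absDisc T ψ L) +
              (m * (m + 2) - 8) / 16 * orderBound σ r m₀ +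
              finrank ℚ D * Real.log (finrank ℚ D * (m₀ : ℝ) ^ 2) := by
  induction m using Nat.strong_induction_on with
  | _ m ih =>
  intro V _ _ _ ψ L h hdim hmm
  have := h.finite
  have hX1 := h.one_le_absDisc σ
  have hx0 := Real.log_nonneg hX1
  set x := Real.log (absDisc T ψ L) with hx
  rcases Nat.eq_zero_or_pos m with rfl | hm
  · refine ⟨finBasisOfFinrankEq D V hdim, fun i => i.elim0, fun i => i.elim0, ?_, fun i => i.elim0⟩
    rw [latticeDisc_zero]
    simp
  have hse : IsSesquilinear ψ := h.skew.2
  have halt : ∀ x, ψ x x = 0 := fun x => by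
    have := h.skew.1 x x
    rwa [hstar, self_eq_neg] at this
  obtain ⟨y, hyL, z, hzL, hyz, -, hsmall⟩ := h.exists_block σ hdim hm
  obtain ⟨W, v, hv0, hv1⟩ := exists_basis_pair h.skew (halt y) hyz
  have hWskew : IsSkewHermitian (restrictForm ψ W) := ⟨fun x y => h.skew.1 x y,
    fun a b x y => h.skew.2 a b x y⟩
  have hWnd : IsNondegenerate (restrictForm ψ W) := nondegenerate_of_basis_pair hWskew v
    (halt _) (by rw [restrictForm_apply, hv0, hv1]; exact hyz)
  have hvL : ∀ i, (v i : V) ∈ L := by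
    intro i
    fin_cases i
    · exact hv0 ▸ hyL
    · exact hv1 ▸ hzL
  obtain ⟨h', hdim', hdisc⟩ := h.orthogonal_lattice σ r hr hWnd v hvL
  set W' := orthogonal h.skew.2 W with hW'
  obtain ⟨q, hq⟩ : ∃ q, finrank D W' = q := ⟨_, rfl⟩
  rw [hq, hdim] at hdim'
  subst hdim'
  obtain ⟨b', hb'L, hb's, hb'd, hb'n⟩ := ih q (by omega) W' _ _ h' hq (by omega)
  have hcompl := isCompl_orthogonal h.skew hWnd
  obtain ⟨u, hu1, hu2, hu⟩ := exists_basis_append σ r h.skew hcompl (fun x hx => hx) v b'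
  have h21 : ∀ i j, ψ (u (Fin.natAdd 2 j)) (u (Fin.castAdd q i)) = 0 := fun i j => by
    rw [hu1, hu2]
    exact (b' j).2 _ (v i).2
  have h12 : ∀ i j, ψ (u (Fin.castAdd q i)) (u (Fin.natAdd 2 j)) = 0 := fun i j =>
    h.skew.eq_zero_comm (h21 i j)
  have hdimV : finrank ℚ V = (2 + q) * finrank ℚ D := by
    rw [← hdim, mul_comm, finrank_mul_finrank]
  rw [hdimV] at hsmall
  obtain ⟨hc1, hc2⟩ := log_bounds_of_normSq_pow_le σ r (Or.inl rfl) hyz hm hmm hX1 hsmall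
  rw [← hx] at hc1 hc2
  have hE := orderBound_nonneg σ r hr1 (hm.trans_le hmm)
  set E := orderBound σ r m₀
  have hdv : latticeDisc σ r (restrictForm ψ W) v = (redDisc T r * σ.detProd (ψ y z)) ^ 2 := by
    rw [latticeDisc_pair σ r hWskew v (halt _), restrictForm_apply, hv0, hv1]
  have hpos1 := latticeDisc_pos σ r hWskew.2 hWnd v
  have hpos2 := latticeDisc_pos σ r h'.skew.2 h'.nondeg b'
  have hX'1 := h'.one_le_absDisc σ
  set g := Real.log (redDisc T r * σ.detProd (ψ y z)) with hg
  have hlogv : Real.log (latticeDisc σ r (restrictForm ψ W) v) = 2 * g := by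
    rw [hdv, Real.log_pow]
    push_cast
    rfl
  have hx' : Real.log (absDisc T (restrictForm ψ W') (restrictLattice L W')) ≤ x + 2 * g := by
    rw [hx, ← hlogv, ← Real.log_mul (by linarith) hpos1.ne']
    exact Real.log_le_log (by linarith) hdisc
  set x' := Real.log (absDisc T (restrictForm ψ W') (restrictLattice L W'))
  have hq0 : (0 : ℝ) ≤ q := Nat.cast_nonneg q
  have hKg : (2 + q : ℝ) * g ≤ (2 + q) * E + x := by
    have := mul_le_mul_of_nonneg_left hc2 (by positivity : (0 : ℝ) ≤ 2 + q)
    push_cast at this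
    rwa [mul_add, mul_div_cancel₀ _ (by positivity)] at this
  -- Write m = 2 + q. By induction the new log-discriminant is at most 2g + (q/2) x' + (q(q+2)/4) E.
  -- With x' ≤ x + 2g the terms in g collect to (2 + q) g ≤ (2 + q) E + x, and the total is (m/2) x
  -- + (m(m+2)/4) E.
  have hqx := mul_le_mul_of_nonneg_left hx' hq0
  refine ⟨u, ?_, isWeaklySymplectic_of_append u halt h12 h21 ?_, ?_, ?_⟩
  · intro i
    induction i using Fin.addCases with
    | left i => rw [hu1]; exact hvL i
    | right i => rw [hu2]; exact hb'L i
  · intro i j hij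
    simp only [hu2]
    exact hb's i j hij
  · rw [hu, Real.log_mul hpos1.ne' hpos2.ne', hlogv]
    push_cast
    linarith
  · have hH : finrank ℚ D * Real.log (((2 + q : ℕ) : ℝ) * finrank ℚ D) ≤
        finrank ℚ D * Real.log (finrank ℚ D * (m₀ : ℝ) ^ 2) := by
      refine mul_le_mul_of_nonneg_left ?_ (Nat.cast_nonneg _)
      have hD0 : 0 < finrank ℚ D := by
        have := σ.finiteDimensional
        exact finrank_pos
      refine Real.log_le_log (by positivity) ?_
      rw [mul_comm]
      refine mul_le_mul_of_nonneg_left ?_ (Nat.cast_nonneg _)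
      exact_mod_cast hmm.trans (Nat.le_self_pow two_ne_zero m₀)
    have hblock : (finrank ℚ D : ℝ) / 2 * Real.log (σ.normSq (ψ y z)) ≤
        (((2 + q : ℕ) : ℝ) + 2) / 8 * x +
          (((2 + q : ℕ) : ℝ) * (((2 + q : ℕ) : ℝ) + 2) - 8) / 16 * E +
          finrank ℚ D * Real.log (finrank ℚ D * (m₀ : ℝ) ^ 2) := by
      -- At q = 0 the claimed coefficient of E vanishes and that of x is 1/2, just enough for the
      -- term x / m of the first block.
      have h1 : x / ((2 + q : ℕ) : ℝ) ≤ x / 2 := by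
        push_cast
        exact div_le_div_of_nonneg_left hx0 (by norm_num) (by linarith)
      push_cast at h1 hc1 hH ⊢
      nlinarith [mul_nonneg hq0 hx0, mul_nonneg hq0 hE, mul_nonneg (mul_nonneg hq0 hq0) hE]
    intro i j hij
    induction i using Fin.addCases with
    | left i =>
      induction j using Fin.addCases with
      | left j =>
        simp only [hu1] at hij ⊢
        fin_cases i <;> fin_cases j
        · exact absurd (halt _) hij
        · change _ / 2 * Real.log (σ.normSq (ψ (v 0) (v 1))) ≤ _
          rw [hv0, hv1]
          exact hblock
        · change _ / 2 * Real.log (σ.normSq (ψ (v 1) (v 0))) ≤ _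
          rw [hv0, hv1, h.skew.1 y z, σ.normSq_neg, σ.normSq_star]
          exact hblock
        · exact absurd (halt _) hij
      | right j => exact absurd (h12 i j) hij
    | right i =>
      induction j using Fin.addCases with
      | left j => exact absurd (h21 j i) hij
      | right j =>
        simp only [hu2] at hij ⊢
        -- Inserting x' ≤ x + 2g and (2 + q) g ≤ (2 + q) E + x turns the bounds for q into exactly
        -- those for q + 2.
        refine (hb'n i j hij).trans ?_
        push_cast
        nlinarith

end TypeOneBasis

/-! ### Type II: induction over non-isotropic vectors and hyperbolic planes. -/

section TypeTwoBasis

variable {D : Type v} [DivisionRing D] [CharZero D] [StarRing D] {T : D →ₗ[ℚ] ℚ} {d : ℕ}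
  {S : Type u} [Fintype S] {α : Type*} [Fintype α] [DecidableEq α]

theorem restrictForm_skew {V : Type w} [AddCommGroup V] [Module ℚ V] [Module D V]
    {ψ : V →ₗ[ℚ] V →ₗ[ℚ] D} (hψ : IsSkewHermitian ψ) (W : Submodule D V) :
    IsSkewHermitian (restrictForm ψ W) :=
  ⟨fun x y => hψ.1 x y, fun a b x y => hψ.2 a b x y⟩

theorem exists_unitary_append (σ : Splitting T d S) (r : Basis α ℚ D) {V : Type w}
    [AddCommGroup V] [Module ℚ V] [Module D V] {ψ : V →ₗ[ℚ] V →ₗ[ℚ] D} (hψ : IsSkewHermitian ψ)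
    {W W' : Submodule D V} (hW : IsCompl W W')
    (horth : ∀ x ∈ W', ∀ y ∈ W, ψ x y = 0) {p q : ℕ} (v : Basis (Fin p) D W)
    (v' : Basis (Fin q) D W') (hv : IsWeaklyUnitary (restrictForm ψ W) v)
    (hv' : IsWeaklyUnitary (restrictForm ψ W') v') :
    ∃ u : Basis (Fin (p + q)) D V, IsWeaklyUnitary ψ u ∧
      (∀ i, (∃ j, u i = v j) ∨ ∃ j, u i = v' j) ∧
      latticeDisc σ r ψ u =
        latticeDisc σ r (restrictForm ψ W) v * latticeDisc σ r (restrictForm ψ W') v' := by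
  obtain ⟨u, hu1, hu2, hu⟩ := exists_basis_append σ r hψ hW horth v v'
  have h21 : ∀ i j, ψ (u (Fin.natAdd p j)) (u (Fin.castAdd q i)) = 0 := fun i j => by
    rw [hu1, hu2]
    exact horth _ (v' j).2 _ (v i).2
  refine ⟨u, fun i j hij => ?_, fun i => ?_, hu⟩
  · induction i using Fin.addCases with
    | left i =>
      induction j using Fin.addCases with
      | left j =>
        rw [hu1, hu1]
        exact hv i j fun h => hij (by rw [h])
      | right j => exact hψ.eq_zero_comm (h21 i j)
    | right i =>
      induction j using Fin.addCases with
      | left j => exact h21 j i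
      | right j =>
        rw [hu2, hu2]
        exact hv' i j fun h => hij (by rw [h])
  · induction i using Fin.addCases with
    | left i => exact Or.inl ⟨i, hu1 i⟩
    | right i => exact Or.inr ⟨i, hu2 i⟩

theorem isWeaklyUnitary_one {V : Type w} [AddCommGroup V] [Module ℚ V]
    [Module D V] {ψ : V →ₗ[ℚ] V →ₗ[ℚ] D} (v : Fin 1 → V) : IsWeaklyUnitary ψ v :=
  fun i j hij => (hij (Subsingleton.elim i j)).elim

theorem two_mul_log_le_of_sq_le {a b : ℝ} (ha : 0 < a) (h : a ^ 2 ≤ b) :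
    2 * Real.log a ≤ Real.log b := by
  have := Real.log_le_log (pow_pos ha 2) h
  rwa [Real.log_pow, Nat.cast_ofNat] at this

/-- In a hyperbolic plane over a quaternion algebra there is an orthogonal basis with small
discriminant. -/
theorem exists_unitary_basis_of_isotropic (σ : Splitting T 2 S) {R : Subalgebra ℤ D}
    (r : Basis α ℚ D)
    (hr : Subalgebra.toSubmodule R = Submodule.span ℤ (Set.range r)) (hr1 : 1 ≤ redDisc T r)
    (hsym : finrank ℚ (symmetric D) ≤ 3 * Fintype.card S)
    {V : Type w} [AddCommGroup V] [Module ℚ V] [Module D V] {ψ : V →ₗ[ℚ] V →ₗ[ℚ] D}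
    {L : Submodule ℤ V} (h : IsFormLattice T R ψ L) (hdim : finrank D V = 2) {x₀ : V}
    (hx₀ : x₀ ≠ 0) (hx₀L : x₀ ∈ L) (hxx₀ : ψ x₀ x₀ = 0) :
    ∃ u : Basis (Fin 2) D V, (∀ i, u i ∈ L) ∧ IsWeaklyUnitary ψ u ∧
      Real.log (latticeDisc σ r ψ u) ≤ 2 * Real.log (absDisc T ψ L) +
        7 * Real.log (redDisc T r) + 54 * (Fintype.card S * Real.log 2) ∧
      ∀ i, 2 * (Fintype.card S * Real.log (σ.normSq (ψ (u i) (u i)))) ≤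
          26 * (Fintype.card S * Real.log 2) + 6 * (Fintype.card S * Real.log (Fintype.card S)) +
            2 * Real.log (redDisc T r) + 1 / 2 * Real.log (absDisc T ψ L) ∨
        2 * (Fintype.card S * Real.log (σ.normSq (ψ (u i) (u i)))) ≤
          32 * (Fintype.card S * Real.log 2) + 4 * (Fintype.card S * Real.log (Fintype.card S)) +
            3 * Real.log (redDisc T r) + 3 / 2 * Real.log (absDisc T ψ L) := by
  have := h.finite
  have heR : (0 : ℝ) < Fintype.card S := by exact_mod_cast σ.card_pos
  have hΔ : 0 < redDisc T r := σ.redDisc_pos r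
  have hX := h.one_le_absDisc σ
  have hX0 : 0 < absDisc T ψ L := by linarith
  obtain ⟨x, hxL, hxx, hx1, hx2⟩ := h.exists_nonisotropic σ hr hr1 hsym hdim hx₀ hx₀L hxx₀
  obtain ⟨W, v, hv⟩ := exists_basis_single (D := D) (x := x) fun h0 => hxx (by
    rw [h0, map_zero])
  have hWskew := restrictForm_skew h.skew W
  have hv0 : restrictForm ψ W (v 0) (v 0) = ψ x x := by rw [restrictForm_apply, hv]
  have hWnd : IsNondegenerate (restrictForm ψ W) :=
    nondegenerate_of_basis_single hWskew.2 v (by rw [hv0]; exact hxx)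
  have hvL : ∀ i, (v i : V) ∈ L := fun i => by
    rw [Subsingleton.elim i 0, hv]
    exact hxL
  obtain ⟨h', hdim', hdisc⟩ := h.orthogonal_lattice σ r hr hWnd v hvL
  have hX' := h'.one_le_absDisc σ
  set W' := orthogonal h.skew.2 W with hW'
  have hdim1 : finrank D W' = 1 := by omega
  rw [latticeDisc_single, hv0] at hdisc
  obtain ⟨y, hyL, hyy, hy1, hy2⟩ := h'.exists_small_of_finrank_eq_one σ hdim1
  have hli : LinearIndependent D ![y] := LinearIndependent.of_subsingleton 0 fun h0 => hyy (by
    rw [show y = 0 from h0, map_zero])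
  let v' : Basis (Fin 1) D W' := basisOfLinearIndependentOfCardEqFinrank hli (by simp [hdim1])
  have hv'0 : v' 0 = y := by simp [v']
  obtain ⟨u, hu, hcases, hud⟩ := exists_unitary_append σ r h.skew
    (isCompl_orthogonal h.skew hWnd) (fun x hx => hx) v v' (isWeaklyUnitary_one _)
    (isWeaklyUnitary_one _)
  have hcases' : ∀ i, u i = x ∨ u i = y := by
    intro i
    rcases hcases i with ⟨j, hj⟩ | ⟨j, hj⟩
    · left
      rw [hj, Subsingleton.elim j 0, hv]
    · right
      rw [hj, Subsingleton.elim j 0, hv'0]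
  rw [latticeDisc_single, latticeDisc_single, hv0, hv'0] at hud
  rw [restrictForm_apply] at hyy hy1 hy2 hud
  set X := absDisc T ψ L
  set X' := absDisc T (restrictForm ψ W') (restrictLattice L W')
  have hX'0 : 0 < X' := by linarith
  have hP1 := σ.detProd_pos hxx
  have hP2 := σ.detProd_pos hyy
  have hn : ∀ c : D, c ≠ 0 → 0 < σ.normSq c := fun c hc => by
    have := σ.adaptedNorm.normSq_pos r (σ.gram_hermForm_ne_zero r) hc
    rwa [σ.adaptedNorm_normSq] at this
  have l1 := two_mul_log_le_of_sq_le hP1 hx1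
  have l2 := two_mul_log_le_of_sq_le hP2 hy1
  have l3 := Real.log_le_log (pow_pos (hn _ hxx) _) hx2
  have l4 := Real.log_le_log (pow_pos (hn _ hyy) _) hy2
  have l5 := Real.log_le_log hX'0 hdisc
  rw [Real.log_mul (by positivity) (by positivity), Real.log_mul (by positivity) (by positivity),
    Real.log_pow, Real.log_pow] at l1
  rw [Real.log_mul (by positivity) (by positivity), Real.log_pow, Real.log_pow] at l2
  rw [Real.log_mul (by positivity) (by positivity), Real.log_mul (by positivity) (by positivity),
    Real.log_pow, Real.log_pow, Real.log_pow, Real.log_mul (by positivity) (by positivity),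
    Real.log_pow, Real.log_pow] at l3
  rw [Real.log_mul (by positivity) (by positivity), Real.log_pow, Real.log_pow, Real.log_pow,
    Real.log_mul (by positivity) (by positivity),
    show (4 : ℝ) = 2 ^ 2 by norm_num, Real.log_pow] at l4
  rw [Real.log_mul (by positivity) (by positivity),
    Real.log_mul (by positivity) (by positivity)] at l5
  push_cast at l1 l2 l3 l4
  refine ⟨u, fun i => ?_, hu, ?_, fun i => ?_⟩
  · rcases hcases' i with hi | hi <;> rw [hi]
    exacts [hxL, hyL]
  -- With P₁, P₂ the norms of the two values and δ = log redDisc, the left side is 2δ + log P₁ + log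
  -- P₂. Here 2 log P₂ ≤ 12 e log 2 + 2x' and x' ≤ x + δ + log P₁. So log P₁ occurs twice, and 2 log
  -- P₁ ≤ 48 e log 2 + 4δ + x gives 54 = 48 + 6 and 7 = 3 + 4.
  · rw [hud, Real.log_mul (by positivity) (by positivity),
      Real.log_mul (by positivity) (by positivity), Real.log_mul (by positivity) (by positivity)]
    linarith
  · rcases hcases' i with hi | hi <;> rw [hi]
    · left
      linarith
    · right
      linarith

/-- Bounds for weakly unitary bases over a quaternion algebra. -/
theorem exists_unitary_basis (σ : Splitting T 2 S) {R : Subalgebra ℤ D} (r : Basis α ℚ D)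
    (hr : Subalgebra.toSubmodule R = Submodule.span ℤ (Set.range r)) (hr1 : 1 ≤ redDisc T r)
    (hsym : finrank ℚ (symmetric D) ≤ 3 * Fintype.card S) {m₀ : ℕ} {E Q P : ℝ}
    (hE : E = orderBound σ r m₀) (hQ : Q = Real.log (redDisc T r) + 4 * (Fintype.card S * Real.log 2))
    (hP : P = Fintype.card S * Real.log (2 * Fintype.card S * (m₀ : ℝ) ^ 2)) (m : ℕ) :
    ∀ (V : Type w) [AddCommGroup V] [Module ℚ V] [Module D V] (ψ : V →ₗ[ℚ] V →ₗ[ℚ] D)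
      (L : Submodule ℤ V), IsFormLattice T R ψ L → finrank D V = m → m ≤ m₀ →
      ∃ b : Basis (Fin m) D V, (∀ i, b i ∈ L) ∧ IsWeaklyUnitary ψ b ∧
        Real.log (latticeDisc σ r ψ b) ≤ m * Real.log (absDisc T ψ L) +
          m * (m + 1) / 2 * E + m * (P + 15 / 2 * Q) ∧
        ∀ i, 2 * (Fintype.card S * Real.log (σ.normSq (ψ (b i) (b i)))) ≤
            (m + 1) / 2 * Real.log (absDisc T ψ L) +
              (m * (m + 1) - 2) / 4 * E + (8 * P + 7 * Q) := by
  have he : 0 < Fintype.card S := σ.card_pos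
  have heR : (1 : ℝ) ≤ Fintype.card S := by exact_mod_cast he
  have hΔ : 0 < redDisc T r := σ.redDisc_pos r
  have hδ : 0 ≤ Real.log (redDisc T r) := Real.log_nonneg hr1
  have hl2 : 0 < Real.log 2 := Real.log_pos (by norm_num)
  have hle : 0 ≤ Real.log (Fintype.card S) := Real.log_nonneg heR
  have hel2 : 0 ≤ Fintype.card S * Real.log 2 := by positivity
  have hele : 0 ≤ Fintype.card S * Real.log (Fintype.card S) := by positivity
  -- Q is the logarithm of |disc R| and P the logarithm of (2 e m₀²)^e; excess multiples of E are
  -- paid for out of P and Q.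
  have hEQ : 0 < m₀ → E = Q + 2 * P := fun hm₀ => by
    rw [hE, hQ, hP, orderBound, abs_of_pos (by positivity), Real.log_mul (by positivity) hΔ.ne',
      Real.log_pow, σ.card_finrank]
    push_cast
    ring
  have hPeq : 0 < m₀ → P = Fintype.card S * Real.log 2 +
      Fintype.card S * Real.log (Fintype.card S) + 2 * (Fintype.card S * Real.log m₀) :=
    fun hm₀ => by
      have : (0 : ℝ) < m₀ := by exact_mod_cast hm₀
      rw [hP, Real.log_mul (by positivity) (by positivity),
        Real.log_mul (by positivity) (by positivity), Real.log_pow]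
      push_cast
      ring
  induction m using Nat.strong_induction_on with
  | _ m ih =>
  intro V _ _ _ ψ L h hdim hmm
  have := h.finite
  have hX1 := h.one_le_absDisc σ
  have hx0 := Real.log_nonneg hX1
  rcases Nat.eq_zero_or_pos m with rfl | hm
  · refine ⟨finBasisOfFinrankEq D V hdim, fun i => i.elim0, fun i => i.elim0, ?_, fun i => i.elim0⟩
    rw [latticeDisc_zero]
    simp
  have hm₀ := hm.trans_le hmm
  have hm₀R : (1 : ℝ) ≤ m₀ := by exact_mod_cast hm₀
  have hM0 : 0 ≤ Real.log m₀ := Real.log_nonneg hm₀R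
  have heM0 : 0 ≤ Fintype.card S * Real.log m₀ := by positivity
  replace hEQ := hEQ hm₀
  replace hPeq := hPeq hm₀
  have hQ0 : 0 ≤ Q := by rw [hQ]; linarith
  have hP0 : 0 ≤ P := by rw [hPeq]; linarith
  have hE0 : 0 ≤ E := by rw [hEQ]; linarith
  obtain ⟨y, hyL, z, hzL, hyz, hyz', hsmall⟩ := h.exists_block σ hdim hm
  have hdimV : finrank ℚ V = m * finrank ℚ D := by
    rw [← hdim, mul_comm, finrank_mul_finrank]
  rw [hdimV] at hsmall
  obtain ⟨hc1, hc2⟩ := log_bounds_of_normSq_pow_le σ r (Or.inr rfl) hyz hm hmm hX1 hsmall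
  rw [← hE] at hc2
  set x := Real.log (absDisc T ψ L) with hx
  set g := Real.log (redDisc T r * σ.detProd (ψ y z)) with hg
  have hmR : (0 : ℝ) < m := by exact_mod_cast hm
  have hKg : (m : ℝ) * g ≤ m * E + x := by
    have := mul_le_mul_of_nonneg_left hc2 hmR.le
    rwa [mul_add, mul_div_cancel₀ _ hmR.ne'] at this
  -- Two bases of the block are in play: `v`, whose discriminant controls the orthogonal complement,
  -- and the orthogonal basis `w`, which enters the result. For a hyperbolic plane `v` is the
  -- hyperbolic pair; for a line they coincide.
  have hstep : ∀ (p : ℕ) (W : Submodule D V) (v w : Basis (Fin p) D W), 0 < p →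
      IsNondegenerate (restrictForm ψ W) → (∀ i, (v i : V) ∈ L) → (∀ i, (w i : V) ∈ L) →
      IsWeaklyUnitary (restrictForm ψ W) w →
      Real.log (latticeDisc σ r (restrictForm ψ W) v) = p * g →
      ∃ q, p + q = m ∧ ∃ x' t : ℝ, x' ≤ x + p * g ∧
        t ≤ q * x' + q * (q + 1) / 2 * E + q * (P + 15 / 2 * Q) ∧
        ∃ u : Basis (Fin m) D V, (∀ i, u i ∈ L) ∧ IsWeaklyUnitary ψ u ∧
          Real.log (latticeDisc σ r ψ u) =
            Real.log (latticeDisc σ r (restrictForm ψ W) w) + t ∧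
          ∀ i, (∃ j, u i = w j) ∨
            2 * (Fintype.card S * Real.log (σ.normSq (ψ (u i) (u i)))) ≤
              (q + 1) / 2 * x' + (q * (q + 1) - 2) / 4 * E + (8 * P + 7 * Q) := by
    intro p W v w hp hWnd hvL hwL hwu hvd
    have hWskew := restrictForm_skew h.skew W
    obtain ⟨h', hdim', hdisc⟩ := h.orthogonal_lattice σ r hr hWnd v hvL
    set W' := orthogonal h.skew.2 W with hW'
    obtain ⟨q, hq⟩ : ∃ q, finrank D W' = q := ⟨_, rfl⟩
    rw [hq, hdim] at hdim'
    obtain ⟨b', hb'L, hb'u, hb'd, hb'n⟩ := ih q (by omega) W' _ _ h' hq (by omega)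
    have hX'1 := h'.one_le_absDisc σ
    have hpos1 := latticeDisc_pos σ r hWskew.2 hWnd v
    have hpos3 := latticeDisc_pos σ r hWskew.2 hWnd w
    have hpos2 := latticeDisc_pos σ r h'.skew.2 h'.nondeg b'
    obtain ⟨u, hu, hcases, hud⟩ := exists_unitary_append σ r h.skew
      (isCompl_orthogonal h.skew hWnd) (fun x hx => hx) w b' hwu hb'u
    subst hdim'
    refine ⟨q, rfl, _, _, ?_, hb'd, u, fun i => ?_, hu, ?_, fun i => ?_⟩
    · rw [hx, ← hvd, ← Real.log_mul (by linarith) hpos1.ne']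
      exact Real.log_le_log (by linarith) hdisc
    · rcases hcases i with ⟨j, hj⟩ | ⟨j, hj⟩ <;> rw [hj]
      exacts [hwL j, hb'L j]
    · rw [hud, Real.log_mul hpos3.ne' hpos2.ne']
    · rcases hcases i with hj | ⟨j, hj⟩
      · exact Or.inl hj
      · right
        rw [hj]
        exact hb'n j
  rcases hyz' with rfl | hyy
  · obtain ⟨W, v, hv⟩ := exists_basis_single (D := D) (x := y) fun h0 => hyz (by
      rw [h0, map_zero])
    have hv0 : restrictForm ψ W (v 0) (v 0) = ψ y y := by rw [restrictForm_apply, hv]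
    have hvL : ∀ i, (v i : V) ∈ L := fun i => by
      rw [Subsingleton.elim i 0, hv]
      exact hyL
    have hvd : Real.log (latticeDisc σ r (restrictForm ψ W) v) = g := by
      rw [latticeDisc_single, hv0]
    obtain ⟨q, hq, x', t, hx', ht, u, huL, hu, hud, hun⟩ := hstep 1 W v v one_pos
      (nondegenerate_of_basis_single (restrictForm_skew h.skew W).2 v (by rw [hv0]; exact hyz))
      hvL hvL (isWeaklyUnitary_one _) (by rw [hvd, Nat.cast_one, one_mul])
    subst hq
    have hq0 : (0 : ℝ) ≤ q := Nat.cast_nonneg q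
    have hqx := mul_le_mul_of_nonneg_left hx' hq0
    push_cast at hKg hqx hx' hc1 ⊢
    refine ⟨u, huL, hu, ?_, fun i => ?_⟩
    · rw [hud, hvd]
      linarith
    · rcases hun i with ⟨j, hj⟩ | hi
      · rw [hj, Subsingleton.elim j 0, hv]
        have h1 : x / (1 + q) ≤ x := div_le_self hx0 (by linarith)
        have h2 : (finrank ℚ D : ℝ) * Real.log ((1 + q) * finrank ℚ D) ≤ 8 * P := by
          have h3 : Real.log ((1 + q) * finrank ℚ D) ≤
              2 * Real.log (2 * Fintype.card S * (m₀ : ℝ) ^ 2) := by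
            rw [← Nat.cast_ofNat (R := ℝ) (n := 2), ← Real.log_pow]
            refine Real.log_le_log (by rw [σ.card_finrank]; positivity) ?_
            rw [σ.card_finrank]
            have h4 : (1 + q : ℝ) ≤ m₀ := by exact_mod_cast hmm
            push_cast
            calc (1 + q : ℝ) * (4 * Fintype.card S) ≤ m₀ * (4 * Fintype.card S) := by gcongr
              _ = 4 * (Fintype.card S * m₀ * 1) := by ring
              _ ≤ 4 * (Fintype.card S * m₀ * (Fintype.card S * (m₀ : ℝ) ^ 3)) := by
                  gcongr
                  exact one_le_mul_of_one_le_of_one_le heR (one_le_pow₀ hm₀R)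
              _ = _ := by ring
          have h5 := mul_le_mul_of_nonneg_left h3 (by positivity : (0 : ℝ) ≤ 4 * Fintype.card S)
          rw [hP]
          nth_rw 1 [σ.card_finrank]
          push_cast
          linarith
        have h6 : (finrank ℚ D : ℝ) / 2 = 2 * Fintype.card S := by
          rw [σ.card_finrank]
          push_cast
          ring
        rw [h6] at hc1
        linarith [mul_nonneg hq0 hx0, mul_nonneg hq0 hE0, mul_nonneg (mul_nonneg hq0 hq0) hE0]
      · refine hi.trans ?_
        linarith
  · obtain ⟨W, v, hv0, hv1⟩ := exists_basis_pair h.skew hyy hyz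
    have hWskew := restrictForm_skew h.skew W
    have hv00 : restrictForm ψ W (v 0) (v 0) = 0 := by rw [restrictForm_apply, hv0, hyy]
    have hv01 : restrictForm ψ W (v 0) (v 1) = ψ y z := by rw [restrictForm_apply, hv0, hv1]
    have hWnd : IsNondegenerate (restrictForm ψ W) := nondegenerate_of_basis_pair hWskew v
      hv00 (by rw [hv01]; exact hyz)
    have hvL : ∀ i, (v i : V) ∈ L := by
      intro i
      fin_cases i
      · exact hv0 ▸ hyL
      · exact hv1 ▸ hzL
    have hvd : Real.log (latticeDisc σ r (restrictForm ψ W) v) = 2 * g := by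
      rw [latticeDisc_pair σ r hWskew v hv00, hv01, Real.log_pow]
      push_cast
      rfl
    have hWdim : finrank D W = 2 := by rw [finrank_eq_card_basis v, Fintype.card_fin]
    have hWL := h.restrict hWnd
    obtain ⟨w, hwL, hwu, hwd, hwn⟩ := exists_unitary_basis_of_isotropic σ r hr hr1 hsym hWL hWdim
      (v.ne_zero 0) (hvL 0) hv00
    have hXN1 := hWL.one_le_absDisc σ
    have hXN : Real.log (absDisc T (restrictForm ψ W) (restrictLattice L W)) ≤ 2 * g := by
      rw [← hvd]
      exact Real.log_le_log (by linarith) (hWL.absDisc_le σ r v hvL hr)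
    obtain ⟨q, hq, x', t, hx', ht, u, huL, hu, hud, hun⟩ := hstep 2 W v w two_pos hWnd
      hvL hwL hwu (by rw [hvd, Nat.cast_ofNat])
    subst hq
    set xN := Real.log (absDisc T (restrictForm ψ W) (restrictLattice L W))
    have hq0 : (0 : ℝ) ≤ q := Nat.cast_nonneg q
    have hqx := mul_le_mul_of_nonneg_left hx' hq0
    have hM2 : Fintype.card S * Real.log 2 ≤ Fintype.card S * Real.log m₀ := by
      refine mul_le_mul_of_nonneg_left (Real.log_le_log (by norm_num) ?_) (Nat.cast_nonneg _)
      exact_mod_cast (Nat.le_add_right 2 q).trans hmm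
    push_cast at hKg hqx hx' hc2 ⊢
    have hxq : x / (2 + q) ≤ x / 2 := div_le_div_of_nonneg_left hx0 (by norm_num) (by linarith)
    refine ⟨u, huL, hu, ?_, fun i => ?_⟩
    -- A plane costs one E = Q + 2P more than the quadratic term provides, besides 7 log redDisc +
    -- 54 e log 2 ≤ 14 Q. The allowance 2(P + 15/2 Q) for its two vectors is exactly 2P + 15 Q.
    · rw [hud]
      linarith
    · rcases hun i with ⟨j, hj⟩ | hi
      · rw [hj]
        have hqE := mul_nonneg hq0 hE0
        have hqqE := mul_nonneg (mul_nonneg hq0 hq0) hE0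
        have hqx0 := mul_nonneg hq0 hx0
        rcases hwn j with hj' | hj'
        · rw [restrictForm_apply] at hj'
          linarith
        -- The term (3/2) log|disc| of the plane is at most 3g ≤ 3E + (3/2) x, of which E is always
        -- available. The other 2E = 2Q + 4P leaves 4P + 5Q of the allowance 8P + 7Q, which covers
        -- 32 e log 2 + 4 e log e + 3 log redDisc because m₀ ≥ 2.
        · rw [restrictForm_apply] at hj'
          linarith
      · refine hi.trans ?_
        have h1 := mul_le_mul_of_nonneg_left hc2 (by linarith : (0 : ℝ) ≤ q + 1)
        have h2 : (2 + q : ℝ) * (x / (2 + q)) = x := mul_div_cancel₀ _ (by positivity)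
        have h3 : 0 ≤ x / (2 + q : ℝ) := by positivity
        linarith

end TypeTwoBasis

/-! ### Integrality of reduced traces. -/

section Integrality

/-- The complex eigenvalues are roots of any monic integral polynomial annihilating M, and the trace
is their sum. -/
theorem isIntegral_trace_of_isIntegral {n : ℕ} {M : Matrix (Fin n) (Fin n) ℝ}
    (hM : IsIntegral ℤ M) : IsIntegral ℤ M.trace := by
  obtain ⟨p, hp, hpM⟩ := hM
  set N : Matrix (Fin n) (Fin n) ℂ := M.map (algebraMap ℝ ℂ) with hN
  have hN0 : Polynomial.aeval N (p.map (algebraMap ℤ ℂ)) = 0 := by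
    rw [Polynomial.aeval_map_algebraMap]
    have h1 : Polynomial.aeval ((algebraMap ℝ ℂ).mapMatrix.toIntAlgHom M) p =
        (algebraMap ℝ ℂ).mapMatrix.toIntAlgHom (Polynomial.aeval M p) :=
      Polynomial.aeval_algHom_apply _ _ _
    have h2 : Polynomial.aeval M p = 0 := hpM
    rw [h2, map_zero] at h1
    exact h1
  have hroots : ∀ μ ∈ N.charpoly.roots, IsIntegral ℤ μ := by
    intro μ hμ
    have h1 : μ ∈ spectrum ℂ N := Matrix.mem_spectrum_of_isRoot_charpoly
      (Polynomial.isRoot_of_mem_roots hμ)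
    have : Nontrivial (Matrix (Fin n) (Fin n) ℂ) := by
      by_contra hcon
      rw [not_nontrivial_iff_subsingleton] at hcon
      rw [spectrum.of_subsingleton] at h1
      exact h1
    have h2 := spectrum.subset_polynomial_aeval N (p.map (algebraMap ℤ ℂ)) ⟨μ, h1, rfl⟩
    rw [hN0, spectrum.zero_eq, Set.mem_singleton_iff] at h2
    simp only [Polynomial.eval_map] at h2
    exact ⟨p, hp, h2⟩
  have htr : IsIntegral ℤ N.trace := by
    rw [Matrix.trace_eq_sum_roots_charpoly]
    exact IsIntegral.multiset_sum hroots
  have h3 : N.trace = algebraMap ℝ ℂ M.trace := by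
    rw [hN, Matrix.trace, Matrix.trace, map_sum]
    rfl
  rw [h3] at htr
  exact (isIntegral_algebraMap_iff (algebraMap ℝ ℂ).injective).1 htr

variable {D : Type v} [DivisionRing D] [CharZero D] [StarRing D] {T : D →ₗ[ℚ] ℚ} {d : ℕ}
  {S : Type u} [Fintype S] {α : Type*} [Fintype α] [DecidableEq α]

/-- The reduced trace of an element of an order is an integer. -/
theorem Splitting.exists_T_eq_int (σ : Splitting T d S) (R : Subalgebra ℤ D) (hR : IsOrder R)
    {a : D} (ha : a ∈ R) : ∃ z : ℤ, T a = z := by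
  have h1 : IsIntegral ℤ a := IsIntegral.of_mem_of_fg R hR.fg a ha
  have h2 : IsIntegral ℤ ((T a : ℚ) : ℝ) := by
    rw [σ.trace_eq]
    exact IsIntegral.sum _ fun s _ =>
      isIntegral_trace_of_isIntegral (h1.map (σ.ρ s).toIntAlgHom)
  have h3 : IsIntegral ℤ (T a) :=
    (isIntegral_algebraMap_iff (A := ℚ) (B := ℝ) (algebraMap ℚ ℝ).injective).1 h2
  obtain ⟨z, hz⟩ := IsIntegrallyClosed.isIntegral_iff.1 h3
  exact ⟨z, by simpa using hz.symm⟩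

theorem Splitting.one_le_redDisc (σ : Splitting T d S) (R : Subalgebra ℤ D) (hR : IsOrder R)
    (r : Basis α ℚ D) (hr : Subalgebra.toSubmodule R = Submodule.span ℤ (Set.range r)) :
    1 ≤ redDisc T r := by
  have hmem : ∀ i, r i ∈ R := fun i => by
    rw [← Subalgebra.mem_toSubmodule, hr]
    exact Submodule.subset_span ⟨i, rfl⟩
  choose z hz using fun i j => σ.exists_T_eq_int R hR (R.mul_mem (hmem i) (hmem j))
  have hdet : (gram (mulForm T) r).det = ((Matrix.of z).det : ℤ) := by
    rw [Int.cast_det]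
    congr 1
    ext i j
    exact hz i j
  have hpos := σ.redDisc_pos r
  rw [redDisc, hdet] at *
  have h1 : (Matrix.of z).det ≠ 0 := by
    intro h0
    rw [h0] at hpos
    simp at hpos
  exact_mod_cast Int.one_le_abs h1

end Integrality

/-! ### Full and reduced traces in towers. -/

section Traces

theorem fullTrace_restrictScalars (F : Type u) (D : Type v) [Field F] [CharZero F]
    [DivisionRing D] [CharZero D] [Algebra F D] [FiniteDimensional ℚ F] [FiniteDimensional F D]
    (a : D) : fullTrace ℚ D a = Algebra.trace ℚ F (fullTrace F D a) := by
  classical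
  let b := finBasis ℚ F
  let c := finBasis F D
  rw [fullTrace, LinearMap.comp_apply, LinearMap.trace_eq_matrix_trace ℚ (b.smulTower c),
    fullTrace, LinearMap.comp_apply, LinearMap.trace_eq_matrix_trace F c, Matrix.trace, Matrix.trace,
    map_sum, Fintype.sum_prod_type, Finset.sum_comm]
  refine Finset.sum_congr rfl fun j _ => ?_
  rw [Algebra.trace_apply, LinearMap.trace_eq_matrix_trace ℚ b, Matrix.trace]
  refine Finset.sum_congr rfl fun i _ => ?_
  simp only [Matrix.diag_apply, LinearMap.toMatrix_apply, Basis.smulTower_repr,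
    Basis.smulTower_apply, LinearMap.mul_apply', Algebra.lmul, mul_smul_comm, map_smul]
  simp [mul_comm]

theorem fullTrace_eq_degree_mul (F : Type u) (D : Type v) [Field F] [CharZero F]
    [DivisionRing D] [CharZero D] [Algebra F D] [FiniteDimensional ℚ F] [FiniteDimensional F D]
    (hd : degree F D ≠ 0) (a : D) :
    fullTrace ℚ D a = degree F D * reducedTraceRat F D a := by
  have h1 : fullTrace F D a = (degree F D : ℚ) • reducedTrace F D a := by
    rw [reducedTrace, LinearMap.smul_apply, smul_eq_mul, Algebra.smul_def, ← mul_assoc]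
    have : (degree F D : F) ≠ 0 := by exact_mod_cast hd
    simp [this]
  rw [fullTrace_restrictScalars F, h1, map_smul, smul_eq_mul]
  rfl

theorem fullTrace_algebraMap (F : Type u) (D : Type v) [Field F] [DivisionRing D] [Algebra F D]
    [FiniteDimensional F D] (x : F) : fullTrace F D (algebraMap F D x) = x * finrank F D := by
  have h : LinearMap.mul F D (algebraMap F D x) = x • LinearMap.id := by
    ext y
    simp [Algebra.smul_def]
  rw [fullTrace, LinearMap.comp_apply, h, map_smul, LinearMap.trace_id, smul_eq_mul]

theorem fullTrace_conj (F : Type u) (D : Type v) [Field F] [DivisionRing D] [Algebra F D]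
    {a g : D} (hg : g ≠ 0) : fullTrace F D (g * a * g⁻¹) = fullTrace F D a := by
  rw [fullTrace, LinearMap.comp_apply, LinearMap.comp_apply]
  have h : LinearMap.mul F D (g * a * g⁻¹) =
      LinearMap.mul F D g * (LinearMap.mul F D a * LinearMap.mul F D g⁻¹) := by
    ext y
    simp [mul_assoc]
  have h2 : LinearMap.mul F D g⁻¹ * LinearMap.mul F D g = 1 := by
    ext y
    simp [hg]
  rw [h, LinearMap.trace_mul_comm, mul_assoc, h2, mul_one]

/-- Conjugation by g sends a to -a and preserves the trace. -/
theorem fullTrace_eq_zero_of_anticommute (F : Type u) (D : Type v) [Field F] [CharZero F]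
    [DivisionRing D] [Algebra F D] {a g : D} (hg : g ≠ 0) (h : g * a = -(a * g)) :
    fullTrace F D a = 0 := by
  have h1 := fullTrace_conj F D (a := a) hg
  rw [h, neg_mul, mul_assoc, mul_inv_cancel₀ hg, mul_one, map_neg] at h1
  exact neg_eq_self.1 h1

end Traces

/-! ### Real embeddings of a totally real field. -/

section RealEmbeddings

theorem nonneg_of_forall_rat {ι : Type*} [Finite ι] {f : (ι → ℝ) → ℝ} (hf : Continuous f)
    (h : ∀ x : ι → ℚ, 0 ≤ f fun i => x i) (x : ι → ℝ) : 0 ≤ f x := by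
  have hd : DenseRange (Pi.map fun _ : ι => (Rat.cast : ℚ → ℝ)) :=
    DenseRange.piMap fun _ => Rat.denseRange_cast
  refine hd.induction_on x (isClosed_Ici.preimage hf) fun y => h y

variable {F : Type u} [Field F] [NumberField F] [NumberField.IsTotallyReal F]

/-- The real embeddings of a totally real field. -/
noncomputable def realEmbedding (s : F →ₐ[ℚ] ℂ) : F →+* ℝ :=
  NumberField.ComplexEmbedding.IsReal.embedding
    (NumberField.IsTotallyReal.complexEmbedding_isReal (s : F →+* ℂ))

theorem ofReal_realEmbedding (s : F →ₐ[ℚ] ℂ) (x : F) : ((realEmbedding s x : ℝ) : ℂ) = s x :=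
  NumberField.ComplexEmbedding.IsReal.coe_embedding_apply _ x

theorem trace_eq_sum_realEmbedding (x : F) :
    ((Algebra.trace ℚ F x : ℚ) : ℝ) = ∑ s : F →ₐ[ℚ] ℂ, realEmbedding s x := by
  have h := trace_eq_sum_embeddings ℂ (K := ℚ) (x := x)
  have h2 : (((Algebra.trace ℚ F x : ℚ) : ℝ) : ℂ) =
      ((∑ s : F →ₐ[ℚ] ℂ, realEmbedding s x : ℝ) : ℂ) := by
    push_cast
    simp only [ofReal_realEmbedding]
    exact h
  exact_mod_cast h2

theorem card_realEmbedding : Fintype.card (F →ₐ[ℚ] ℂ) = finrank ℚ F := AlgHom.card ℚ F ℂ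

/-- Distinct characters are linearly independent, so the matrix of embeddings of a basis is
invertible: F ⊗ ℝ is the product of its real completions, and single places can be isolated. -/
theorem exists_coord_eq_single {e : ℕ} (b : Basis (Fin e) ℚ F) (y : (F →ₐ[ℚ] ℂ) → ℝ) :
    ∃ x : Fin e → ℝ, ∀ s, ∑ i, x i * realEmbedding s (b i) = y s := by
  classical
  have hcard : Fintype.card (F →ₐ[ℚ] ℂ) = Fintype.card (Fin e) := by
    rw [card_realEmbedding, finrank_eq_card_basis b]
  let ε := Fintype.equivOfCardEq hcard
  let M : Matrix (Fin e) (Fin e) ℝ := Matrix.of fun k i => realEmbedding (ε.symm k) (b i)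
  have hli : LinearIndependent ℝ M.row := by
    rw [Fintype.linearIndependent_iff]
    intro g hg
    have h1 := linearIndependent_monoidHom F ℝ
    have hinj : Function.Injective fun k => ((realEmbedding (ε.symm k) : F →+* ℝ) : F →* ℝ) := by
      intro k l hkl
      apply ε.symm.injective
      ext x
      have := DFunLike.congr_fun hkl x
      simp only [MonoidHom.coe_coe] at this
      rw [← ofReal_realEmbedding, ← ofReal_realEmbedding, this]
    refine Fintype.linearIndependent_iff.1 (h1.comp _ hinj) g ?_
    funext x
    simp only [Function.comp_apply, Finset.sum_apply, Pi.smul_apply, smul_eq_mul, MonoidHom.coe_coe,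
      Pi.zero_apply]
    rw [← b.sum_repr x]
    simp only [map_sum, Finset.mul_sum]
    rw [Finset.sum_comm]
    refine Finset.sum_eq_zero fun i _ => ?_
    have h2 := congrFun hg i
    simp only [Finset.sum_apply, Pi.smul_apply, smul_eq_mul, Matrix.row, Pi.zero_apply] at h2
    have h3 : ∀ k, realEmbedding (ε.symm k) (b.repr x i • b i) =
        (b.repr x i : ℝ) * realEmbedding (ε.symm k) (b i) := fun k => by
      rw [Rat.smul_def, map_mul, map_ratCast]
    simp only [h3]
    calc _ = (b.repr x i : ℝ) * ∑ k, g k * M k i := by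
          rw [Finset.mul_sum]
          exact Finset.sum_congr rfl fun k _ => by simp only [M, Matrix.of_apply]; ring
      _ = 0 := by rw [h2, mul_zero]
  have hunit := Matrix.linearIndependent_rows_iff_isUnit.1 hli
  obtain ⟨x, hx⟩ := Matrix.mulVec_surjective_iff_isUnit.2 hunit fun k => y (ε.symm k)
  refine ⟨x, fun s => ?_⟩
  have := congrFun hx (ε s)
  rw [Equiv.symm_apply_apply] at this
  rw [← this, Matrix.mulVec, dotProduct]
  exact Finset.sum_congr rfl fun i _ => by simp [M, mul_comm]

/-- An element of a totally real field with nonnegative trace form is totally nonnegative. -/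
theorem realEmbedding_nonneg {c : F} (h : ∀ x : F, 0 ≤ Algebra.trace ℚ F (x ^ 2 * c))
    (s : F →ₐ[ℚ] ℂ) : 0 ≤ realEmbedding s c := by
  classical
  let b := finBasis ℚ F
  let f : (Fin (finrank ℚ F) → ℝ) → ℝ := fun x =>
    ∑ s : F →ₐ[ℚ] ℂ, (∑ i, x i * realEmbedding s (b i)) ^ 2 * realEmbedding s c
  have hf : Continuous f := by fun_prop
  have h1 : ∀ x, 0 ≤ f x := nonneg_of_forall_rat hf fun x => by
    have h2 : f (fun i => (x i : ℝ)) = ((Algebra.trace ℚ F ((∑ i, x i • b i) ^ 2 * c) : ℚ) : ℝ) := by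
      rw [trace_eq_sum_realEmbedding]
      simp [f, Rat.smul_def]
    rw [h2]
    exact_mod_cast h _
  -- At the real point equal to 1 at s and 0 elsewhere, the form, non-negative by density of
  -- rational points, takes the value of c at s.
  obtain ⟨x, hx⟩ := exists_coord_eq_single b (Pi.single s 1)
  have h3 := h1 x
  simp only [f, hx] at h3
  rw [Finset.sum_eq_single s (fun t _ hts => by simp [Pi.single_eq_of_ne hts]) (by simp)] at h3
  simpa using h3

theorem realEmbedding_pos {c : F} (hc : c ≠ 0) (h : ∀ x : F, 0 ≤ Algebra.trace ℚ F (x ^ 2 * c))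
    (s : F →ₐ[ℚ] ℂ) : 0 < realEmbedding s c :=
  lt_of_le_of_ne (realEmbedding_nonneg h s) fun h0 =>
    hc ((map_eq_zero (realEmbedding s)).1 h0.symm)

theorem trace_sq_pos {x : F} (hx : x ≠ 0) : 0 < Algebra.trace ℚ F (x ^ 2) := by
  have h : (0 : ℝ) < (Algebra.trace ℚ F (x ^ 2) : ℚ) := by
    rw [trace_eq_sum_realEmbedding]
    have : Nonempty (F →ₐ[ℚ] ℂ) := by
      rw [← Fintype.card_pos_iff, card_realEmbedding]
      exact finrank_pos
    refine Finset.sum_pos (fun s _ => ?_) Finset.univ_nonempty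
    rw [map_pow]
    exact sq_pos_of_ne_zero ((map_ne_zero _).2 hx)
  exact_mod_cast h

end RealEmbeddings

/-! ### Positive involutions on the centre, and the splitting for type I. -/

section PositiveInvolutions

variable {F : Type u} [Field F] [NumberField F] {D : Type v} [DivisionRing D] [CharZero D]
  [Algebra F D] [StarRing D]

theorem reducedTraceRat_algebraMap [FiniteDimensional F D] (hd : finrank F D = degree F D ^ 2)
    (x : F) : reducedTraceRat F D (algebraMap F D x) = degree F D * Algebra.trace ℚ F x := by
  have hd0 : (degree F D : F) ≠ 0 := by
    have : 0 < finrank F D := finrank_pos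
    rw [hd] at this
    have := (Nat.pow_pos_iff.1 this).resolve_right two_ne_zero
    exact_mod_cast this.ne'
  have h1 : reducedTrace F D (algebraMap F D x) = (degree F D : ℚ) • x := by
    rw [reducedTrace, LinearMap.smul_apply, fullTrace_algebraMap, hd, smul_eq_mul, Rat.smul_def]
    push_cast
    field_simp
  rw [reducedTraceRat, LinearMap.comp_apply, LinearMap.restrictScalars_apply, h1, map_smul,
    smul_eq_mul]

/-- A positive involution which preserves a totally real base field fixes it. -/
theorem star_algebraMap [NumberField.IsTotallyReal F] [FiniteDimensional F D]
    (hd : finrank F D = degree F D ^ 2) (hpos : IsPositiveInvolution F D)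
    (h : ∀ x : F, ∃ y : F, star (algebraMap F D x) = algebraMap F D y) (x : F) :
    star (algebraMap F D x) = algebraMap F D x := by
  obtain ⟨y, hy⟩ := h x
  by_contra hne
  -- The involution negates x - y, so the positive quantity Trd(z z†) equals minus a non-negative
  -- multiple of Tr((x - y)²), which is positive: a contradiction.
  set z := algebraMap F D (x - y) with hz
  have hz0 : x - y ≠ 0 := by
    intro h0
    rw [sub_eq_zero] at h0
    exact hne (by rw [hy, h0])
  have hzs : star z = -z := by
    have h1 : star (algebraMap F D y) = algebraMap F D x := by rw [← hy, star_star]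
    rw [hz, map_sub, star_sub, hy, h1, neg_sub]
  have h2 := hpos z ((map_ne_zero _).2 hz0)
  rw [hzs, mul_neg, hz, ← map_mul, map_neg, reducedTraceRat_algebraMap hd, ← sq] at h2
  have h3 := trace_sq_pos hz0
  have h4 : (0 : ℚ) ≤ degree F D := Nat.cast_nonneg _
  nlinarith

theorem degree_of_isTypeI (h : IsTypeI F D) : finrank F D = 1 ∧ degree F D = 1 := by
  have h1 : finrank F D = 1 := by
    rw [← (LinearEquiv.ofBijective (Algebra.linearMap F D) h.2).finrank_eq, finrank_self]
  refine ⟨h1, ?_⟩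
  rw [degree, h1]
  rfl

theorem star_eq_self_of_isTypeI (h : IsTypeI F D) (hpos : IsPositiveInvolution F D) (a : D) :
    star a = a := by
  have := h.1
  obtain ⟨h1, h2⟩ := degree_of_isTypeI h
  have : FiniteDimensional F D := FiniteDimensional.of_finrank_pos (by omega)
  obtain ⟨x, rfl⟩ := h.2.2 a
  refine star_algebraMap (by rw [h1, h2, one_pow]) hpos (fun x => ?_) x
  obtain ⟨y, hy⟩ := h.2.2 (star (algebraMap F D x))
  exact ⟨y, hy.symm⟩

/-- The splitting given by the real embeddings of a totally real field. -/
theorem exists_splitting_of_isTypeI (h : IsTypeI F D) (hpos : IsPositiveInvolution F D) :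
    Nonempty (Splitting (reducedTraceRat F D) 1 (F →ₐ[ℚ] ℂ)) := by
  have := h.1
  obtain ⟨h1, h2⟩ := degree_of_isTypeI h
  have : FiniteDimensional F D := FiniteDimensional.of_finrank_pos (by omega)
  let ε : F ≃+* D := RingEquiv.ofBijective (algebraMap F D) h.2
  have hε : ∀ a, algebraMap F D (ε.symm a) = a := fun a => ε.apply_symm_apply a
  refine ⟨{ ρ := fun s => (Matrix.scalar (Fin 1)).comp ((realEmbedding s).comp (ε.symm : D →+* F))
            ρ_star := fun s a => ?_
            trace_eq := fun a => ?_
            fullTrace_eq := fun a => ?_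
            finrank_eq := ?_
            d_pos := one_pos
            card_pos := ?_ }⟩
  · rw [star_eq_self_of_isTypeI h hpos]
    simp
  · rw [← hε a, reducedTraceRat_algebraMap (by rw [h1, h2, one_pow]), h2]
    simp [trace_eq_sum_realEmbedding, hε, Matrix.trace]
  · rw [fullTrace_eq_degree_mul F D (by omega), h2]
  · rw [card_realEmbedding, ← finrank_mul_finrank ℚ F D, h1]
    ring
  · rw [card_realEmbedding]
    exact finrank_pos

end PositiveInvolutions

/-! ### A signature bound for skew elements. -/

section Signature

theorem fullTrace_baseChange {D : Type v} [DivisionRing D] [CharZero D] [FiniteDimensional ℚ D]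
    (a : D) : fullTrace ℝ (ℝ ⊗[ℚ] D) (1 ⊗ₜ a) = fullTrace ℚ D a := by
  have h1 := LinearMap.trace_baseChange (LinearMap.mul ℚ D a) ℝ
  rw [fullTrace, fullTrace, LinearMap.comp_apply, LinearMap.comp_apply]
  refine Eq.trans ?_ h1
  congr 1
  ext x
  simp

theorem fullTrace_algEquiv {K : Type*} {A B : Type*} [Field K] [Ring A] [Algebra K A] [Ring B]
    [Algebra K B] (φ : A ≃ₐ[K] B) (a : A) : fullTrace K B (φ a) = fullTrace K A a := by
  rw [fullTrace, fullTrace, LinearMap.comp_apply, LinearMap.comp_apply,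
    ← LinearMap.trace_conj' _ φ.toLinearEquiv]
  congr 1
  ext x : 1
  simp [LinearEquiv.conj_apply]

theorem fullTrace_pi_matrix {e n : ℕ} (M : Fin e → Matrix (Fin n) (Fin n) ℝ) :
    fullTrace ℝ (Fin e → Matrix (Fin n) (Fin n) ℝ) M = ∑ i, (n : ℝ) * (M i).trace := by
  rw [fullTrace, LinearMap.comp_apply, LinearMap.trace_eq_matrix_trace ℝ
    (Pi.basis fun _ : Fin e => Matrix.stdBasis ℝ (Fin n) (Fin n)), Matrix.trace,
    Fintype.sum_sigma]
  refine Finset.sum_congr rfl fun i _ => ?_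
  rw [← fullTrace_matrix, fullTrace, LinearMap.comp_apply,
    LinearMap.trace_eq_matrix_trace ℝ (Matrix.stdBasis ℝ (Fin n) (Fin n)), Matrix.trace]
  refine Finset.sum_congr rfl fun p _ => ?_
  rw [Matrix.diag_apply, Matrix.diag_apply, LinearMap.toMatrix_apply, LinearMap.toMatrix_apply,
    Pi.basis_repr, Pi.basis_apply]
  simp

/-- The subspace of skew-symmetric elements. -/
noncomputable def skewElements (D : Type v) [DivisionRing D] [CharZero D] [StarRing D] :
    Submodule ℚ D :=
  LinearMap.eqLocus (starLinearMap D) (-LinearMap.id)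

theorem mem_skewElements {D : Type v} [DivisionRing D] [CharZero D] [StarRing D] {a : D} :
    a ∈ skewElements D ↔ star a = -a := Iff.rfl

/-- The signature of the form `Tr (a b)` bounds the number of independent skew elements. -/
theorem finrank_skewElements_le {D : Type v} [DivisionRing D] [CharZero D] [StarRing D]
    [FiniteDimensional ℚ D] {e : ℕ}
    (Φ : (ℝ ⊗[ℚ] D) ≃ₐ[ℝ] (Fin e → Matrix (Fin 2) (Fin 2) ℝ))
    (hpos : ∀ a : D, 0 ≤ fullTrace ℚ D (a * star a)) : finrank ℚ (skewElements D) ≤ e := by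
  by_contra! hlt
  let b := finBasis ℚ (skewElements D)
  let y : (Fin (finrank ℚ (skewElements D)) → ℝ) →ₗ[ℝ] ℝ ⊗[ℚ] D :=
    (LinearMap.baseChange ℝ (skewElements D).subtype) ∘ₗ
      (Algebra.TensorProduct.basis ℝ b).equivFun.symm.toLinearMap
  have hy : ∀ x, y x = ∑ k, x k • ((1 : ℝ) ⊗ₜ[ℚ] (b k : D)) := by
    intro x
    simp [y, Basis.equivFun_symm_apply, map_sum]
  have hinj : Function.Injective y := by
    refine Function.Injective.comp (g := LinearMap.baseChange ℝ (skewElements D).subtype) ?_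
      (Algebra.TensorProduct.basis ℝ b).equivFun.symm.injective
    exact Module.Flat.lTensor_preserves_injective_linearMap (M := ℝ) (skewElements D).subtype
      Subtype.val_injective
  -- The kernel consists of real combinations of skew elements whose matrices are all symmetric: e
  -- linear conditions on more than e parameters.
  let g : (Fin (finrank ℚ (skewElements D)) → ℝ) →ₗ[ℝ] (Fin e → ℝ) :=
    { toFun := fun x i => Φ (y x) i 0 1 - Φ (y x) i 1 0
      map_add' := fun x z => by
        ext i
        simp
        ring
      map_smul' := fun c x => by
        ext i
        simp
        ring }
  have hker : LinearMap.ker g ≠ ⊥ := by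
    apply LinearMap.ker_ne_bot_of_finrank_lt
    rw [finrank_fin_fun, finrank_fin_fun]
    exact hlt
  obtain ⟨x, hx, hx0⟩ := (Submodule.ne_bot_iff _).1 hker
  -- f is -Tr(y²). At rational points y† = -y makes it Tr(y y†) ≥ 0, and density extends this to
  -- real points. On symmetric matrices Tr(y²) is twice the squared Frobenius norm, so a kernel
  -- vector gives y = 0.
  let f : (Fin (finrank ℚ (skewElements D)) → ℝ) → ℝ := fun x =>
    -∑ k, ∑ l, x k * x l * (fullTrace ℚ D (b k * b l) : ℝ)
  have hf : Continuous f := by fun_prop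
  have hf0 : 0 ≤ f x := nonneg_of_forall_rat hf (fun x => by
    set z : D := ∑ k, x k • (b k : D) with hz
    have hzs : star z = -z := by
      have : z ∈ skewElements D := Submodule.sum_mem _ fun k _ =>
        Submodule.smul_mem _ _ (b k).2
      exact mem_skewElements.1 this
    have h1 := hpos z
    have h2 : f (fun i => (x i : ℝ)) = ((fullTrace ℚ D (z * star z) : ℚ) : ℝ) := by
      rw [hzs, mul_neg, map_neg, hz, Finset.sum_mul_sum]
      simp only [f, map_sum, smul_mul_smul_comm, map_smul, smul_eq_mul]
      push_cast
      rfl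
    rw [h2]
    exact_mod_cast h1) x
  have hfull : fullTrace ℝ (ℝ ⊗[ℚ] D) (y x * y x) = -f x := by
    rw [hy, Finset.sum_mul_sum]
    simp only [map_sum, smul_mul_smul_comm, map_smul, smul_eq_mul,
      Algebra.TensorProduct.tmul_mul_tmul, mul_one, fullTrace_baseChange, f, neg_neg]
  rw [← fullTrace_algEquiv Φ, map_mul, fullTrace_pi_matrix] at hfull
  have hsym : ∀ i, Φ (y x) i 1 0 = Φ (y x) i 0 1 := fun i => by
    have := congrFun hx i
    exact (sub_eq_zero.1 this).symm
  have hsq : ∀ i, ((Φ (y x) * Φ (y x)) i).trace = frobSq (Φ (y x) i) := by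
    intro i
    rw [Pi.mul_apply, Matrix.trace_fin_two, frobSq]
    simp only [Matrix.mul_apply, Fin.sum_univ_two, hsym]
    ring
  have hzero : ∑ i, frobSq (Φ (y x) i) ≤ 0 := by
    simp only [hsq, ← Finset.mul_sum] at hfull
    push_cast at hfull
    linarith
  have hall := (Finset.sum_eq_zero_iff_of_nonneg fun i _ => frobSq_nonneg (Φ (y x) i)).1
    (le_antisymm hzero (Finset.sum_nonneg fun i _ => frobSq_nonneg _))
  apply hx0
  apply hinj
  rw [map_zero]
  apply Φ.injective
  rw [map_zero]
  funext i
  exact frobSq_eq_zero.1 (hall i (Finset.mem_univ i))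

end Signature

/-! ### Quaternion coordinates and the splitting for type II. -/

section Quaternions

variable {F : Type u} [Field F] [NumberField F] {D : Type v} [DivisionRing D] [CharZero D]
  [Algebra F D] [StarRing D]

theorem degree_of_isTypeII (h : IsTypeII F D) : degree F D = 2 := by
  rw [degree, h.2.2.1]
  norm_num

theorem finiteDimensional_of_isTypeII (h : IsTypeII F D) : FiniteDimensional F D :=
  FiniteDimensional.of_finrank_pos (by rw [h.2.2.1]; norm_num)

theorem exists_algebraMap_of_commute (h : IsTypeII F D) {a : D} (ha : ∀ b, a * b = b * a) :
    ∃ x : F, algebraMap F D x = a := by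
  have h1 : a ∈ Subalgebra.center F D := Subalgebra.mem_center_iff.2 fun b => (ha b).symm
  exact Algebra.mem_bot.1 (h.2.1.out h1)

/-- The involution maps the centre to itself, and a positive involution fixes a totally real centre.
-/
theorem star_smul_of_isTypeII (h : IsTypeII F D) (hpos : IsPositiveInvolution F D) (x : F)
    (a : D) : star (x • a) = x • star a := by
  have := h.1
  have := finiteDimensional_of_isTypeII h
  have h1 : star (algebraMap F D x) = algebraMap F D x := by
    refine star_algebraMap (by rw [h.2.2.1, degree_of_isTypeII h]; norm_num) hpos (fun y => ?_) x
    obtain ⟨z, hz⟩ := exists_algebraMap_of_commute h (a := star (algebraMap F D y)) fun b => by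
      have := congrArg star (Algebra.commutes y (star b))
      simpa using this.symm
    exact ⟨z, hz.symm⟩
  rw [Algebra.smul_def, star_mul, h1, Algebra.smul_def, Algebra.commutes]

theorem finrank_rat_of_isTypeII (h : IsTypeII F D) : finrank ℚ D = 4 * finrank ℚ F := by
  rw [← finrank_mul_finrank ℚ F D, h.2.2.1, mul_comm]

/-- Otherwise every a - a† would vanish, and a b = (a b)† = b a would make D commutative, whereas it
has dimension 4 over its centre. -/
theorem exists_star_eq_neg (h : IsTypeII F D) : ∃ j : D, j ≠ 0 ∧ star j = -j := by
  have := finiteDimensional_of_isTypeII h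
  by_contra! hcon
  have hstar : ∀ a : D, star a = a := by
    intro a
    by_contra hne
    exact hcon (a - star a) (fun h0 => hne (sub_eq_zero.1 h0).symm) (by simp)
  have hcomm : ∀ a b : D, a * b = b * a := fun a b => by
    rw [← hstar (a * b), star_mul, hstar, hstar]
  have htop : (⊤ : Subalgebra F D) = ⊥ := by
    rw [eq_comm, eq_top_iff]
    rintro a -
    exact Algebra.mem_bot.2 (exists_algebraMap_of_commute h (hcomm a))
  have h1 : finrank F (⊤ : Subalgebra F D) = 4 := by
    rw [subalgebra_top_finrank_eq_submodule_top_finrank, finrank_top, h.2.2.1]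
  rw [htop, Subalgebra.finrank_bot] at h1
  omega

/-- The skew elements form an F-subspace of ℚ-dimension at most [F : ℚ] by the signature bound,
hence a line. -/
theorem exists_smul_eq_of_star_eq_neg (h : IsTypeII F D) (hpos : IsPositiveInvolution F D)
    {j : D} (hj : j ≠ 0) (hjs : star j = -j) {a : D} (ha : star a = -a) : ∃ x : F, a = x • j := by
  have := finiteDimensional_of_isTypeII h
  have : FiniteDimensional ℚ D := Module.Finite.trans F D
  obtain ⟨Φ⟩ := h.2.2.2
  have hle := finrank_skewElements_le Φ fun a => by
    rw [fullTrace_eq_degree_mul F D (by rw [degree_of_isTypeII h]; norm_num)]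
    refine mul_nonneg (Nat.cast_nonneg _) ?_
    rcases eq_or_ne a 0 with rfl | ha
    · simp
    · exact (hpos a ha).le
  let W : Submodule F D :=
    { carrier := {a | star a = -a}
      add_mem' := fun {a b} ha hb => by
        change star (a + b) = -(a + b)
        rw [star_add, ha, hb, neg_add]
      zero_mem' := by simp
      smul_mem' := fun x a ha => by
        change star (x • a) = -(x • a)
        rw [star_smul_of_isTypeII h hpos, ha, smul_neg] }
  have hWr : finrank ℚ W = finrank ℚ (skewElements D) := rfl
  have hW1 : finrank F W ≤ 1 := by
    have h1 : finrank ℚ F * finrank F W = finrank ℚ W := finrank_mul_finrank ℚ F W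
    have h2 : 0 < finrank ℚ F := finrank_pos
    rw [hWr] at h1
    by_contra! hlt
    nlinarith
  have hjW : (⟨j, hjs⟩ : W) ≠ 0 := fun h0 => hj (congrArg Subtype.val h0)
  have hW2 : finrank F W = 1 :=
    le_antisymm hW1 (Nat.one_le_iff_ne_zero.2 fun h0 => by
      have : 0 < finrank F W := finrank_pos_iff_exists_ne_zero.2 ⟨⟨j, hjs⟩, hjW⟩
      omega)
  obtain ⟨x, hx⟩ := (finrank_eq_one_iff_of_nonzero' _ hjW).1 hW2 ⟨a, ha⟩
  exact ⟨x, (congrArg Subtype.val hx).symm⟩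

theorem algebraMap_mul_comm (x : F) (a : D) : a * algebraMap F D x = algebraMap F D x * a :=
  (Algebra.commutes x a).symm

/-- Standard generators of a quaternion algebra with a positive involution of orthogonal type. -/
theorem exists_quaternion_generators (h : IsTypeII F D) (hpos : IsPositiveInvolution F D) :
    ∃ (j k : D) (p q : F), j * j = algebraMap F D p ∧ k * k = algebraMap F D q ∧
      j ≠ 0 ∧ k ≠ 0 ∧ k * j = -(j * k) ∧ star j = -j ∧ star k = k := by
  obtain ⟨j, hj, hjs⟩ := exists_star_eq_neg h
  have hskew : ∀ a : D, star a = -a → ∃ x : F, a = x • j := fun a ha =>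
    exists_smul_eq_of_star_eq_neg h hpos hj hjs ha
  -- j³ is skew, so it is an F-multiple of j and j² lies in F. The same argument with k² j below
  -- gives k² ∈ F.
  obtain ⟨p, hp⟩ := hskew (j * j * j) (by simp [hjs, mul_assoc])
  have hjj : j * j = algebraMap F D p := by
    rw [Algebra.smul_def] at hp
    exact mul_right_cancel₀ hj hp
  obtain ⟨a, ha⟩ : ∃ a, a * j - j * a ≠ 0 := by
    by_contra! hcon
    obtain ⟨x, hx⟩ := exists_algebraMap_of_commute h (a := j) fun b =>
      (sub_eq_zero.1 (hcon b)).symm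
    have h1 := star_smul_of_isTypeII h hpos x 1
    rw [star_one, ← Algebra.algebraMap_eq_smul_one, hx, hjs, neg_eq_self] at h1
    exact hj h1
  set k := a * j - j * a with hk
  have hkj : k * j = -(j * k) := by
    rw [hk, sub_mul, mul_sub, neg_sub, mul_assoc a j j, ← mul_assoc j j a, hjj,
      algebraMap_mul_comm, mul_assoc]
  have hks : star k = k := by
    have h1 : star k * j = -(j * star k) := by
      have := congrArg star hkj
      rw [star_mul, star_neg, star_mul, hjs] at this
      rw [neg_mul, mul_neg, neg_neg] at this
      exact this.symm
    -- k† - k is a multiple of j and yet anticommutes with j, like k and k†; so it vanishes.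
    obtain ⟨x, hx⟩ := hskew (star k - k) (by simp)
    have h2 : (star k - k) * j = -(j * (star k - k)) := by
      rw [sub_mul, mul_sub, h1, hkj]
      abel
    rw [hx, smul_mul_assoc, mul_smul_comm, self_eq_neg, smul_eq_zero] at h2
    rcases h2 with h2 | h2
    · rw [h2, zero_smul] at hx
      exact sub_eq_zero.1 hx
    · exact absurd h2 (mul_ne_zero hj hj)
  obtain ⟨q, hq⟩ := hskew (k * k * j) (by
    rw [star_mul, star_mul, hks, hjs, neg_mul, ← mul_assoc, mul_assoc k k j, hkj, mul_neg,
      ← mul_assoc k j k, hkj]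
    simp [mul_assoc])
  refine ⟨j, k, p, q, hjj, ?_, hj, ha, hkj, hjs, hks⟩
  rw [Algebra.smul_def] at hq
  exact mul_right_cancel₀ hj hq

theorem smul_add_smul_eq_zero (h : IsTypeII F D) (hpos : IsPositiveInvolution F D) {j : D}
    (hj : j ≠ 0) (hjs : star j = -j) {x y : F} (h0 : x • (1 : D) + y • j = 0) :
    x = 0 ∧ y = 0 := by
  have h1 := congrArg star h0
  rw [star_add, star_smul_of_isTypeII h hpos, star_smul_of_isTypeII h hpos, star_one, hjs,
    star_zero, smul_neg] at h1
  have h2 : y • j = 0 := by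
    have : y • j = -(y • j) := by
      have h3 := h0.trans h1.symm
      exact add_left_cancel h3
    exact self_eq_neg.1 this
  rw [h2, add_zero] at h0
  exact ⟨(smul_eq_zero.1 h0).resolve_right one_ne_zero, (smul_eq_zero.1 h2).resolve_right hj⟩

open Quaternion in
/-- A quaternion algebra with a positive involution of orthogonal type, in coordinates. -/
theorem exists_quaternion_coordinates (h : IsTypeII F D) (hpos : IsPositiveInvolution F D) :
    ∃ (p q : F) (φ : ℍ[F,p,0,q] ≃ₐ[F] D), p ≠ 0 ∧ q ≠ 0 ∧
      (∀ x, star (φ x) = φ ⟨x.re, -x.imI, x.imJ, x.imK⟩) ∧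
      ∀ x, reducedTraceRat F D (φ x) = 2 * Algebra.trace ℚ F x.re := by
  have := finiteDimensional_of_isTypeII h
  obtain ⟨j, k, p, q, hjj, hkk, hj, hk, hkj, hjs, hks⟩ := exists_quaternion_generators h hpos
  let B : QuaternionAlgebra.Basis D p 0 q :=
    { i := j
      j := k
      k := j * k
      i_mul_i := by rw [hjj, zero_smul, add_zero, Algebra.algebraMap_eq_smul_one]
      j_mul_j := by rw [hkk, Algebra.algebraMap_eq_smul_one]
      i_mul_j := rfl
      j_mul_i := by rw [zero_smul, zero_sub, hkj] }
  have hB : ∀ x : ℍ[F,p,0,q], B.liftHom x =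
      x.re • (1 : D) + x.imI • j + x.imJ • k + x.imK • (j * k) := fun x => by
    rw [← Algebra.algebraMap_eq_smul_one]
    rfl
  have hinj : Function.Injective B.liftHom := by
    rw [injective_iff_map_eq_zero]
    intro x hx
    rw [hB] at hx
    -- Moving j across a vanishing combination flips the signs of the k and j k terms, so the parts
    -- commuting and anticommuting with j vanish separately.
    have h1 : j * (x.re • (1 : D) + x.imI • j + x.imJ • k + x.imK • (j * k)) =
        (x.re • (1 : D) + x.imI • j - x.imJ • k - x.imK • (j * k)) * j := by
      simp only [mul_add, add_mul, sub_mul, mul_smul_comm, smul_mul_assoc, mul_one, one_mul, hkj,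
        mul_assoc, smul_neg, mul_neg]
      abel
    rw [hx, mul_zero] at h1
    have h2 := (mul_eq_zero.1 h1.symm).resolve_right hj
    have h3 : x.re • (1 : D) + x.imI • j = 0 := by
      have : (2 : ℚ) • (x.re • (1 : D) + x.imI • j) = 0 := by
        rw [two_smul]
        calc _ = (x.re • (1 : D) + x.imI • j + x.imJ • k + x.imK • (j * k)) +
              (x.re • (1 : D) + x.imI • j - x.imJ • k - x.imK • (j * k)) := by abel
          _ = 0 := by rw [hx, h2, add_zero]
      exact (smul_eq_zero.1 this).resolve_left two_ne_zero
    have h4 : (x.imJ • (1 : D) + x.imK • j) * k = 0 := by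
      rw [h3, zero_add] at hx
      rw [add_mul, smul_mul_assoc, smul_mul_assoc, one_mul, hx]
    obtain ⟨e1, e2⟩ := smul_add_smul_eq_zero h hpos hj hjs h3
    obtain ⟨e3, e4⟩ := smul_add_smul_eq_zero h hpos hj hjs
      ((mul_eq_zero.1 h4).resolve_right hk)
    ext <;> assumption
  have hbij : Function.Bijective B.liftHom := by
    refine ⟨hinj, ?_⟩
    have := (LinearMap.injective_iff_surjective_of_finrank_eq_finrank
      (f := B.liftHom.toLinearMap) (by rw [QuaternionAlgebra.finrank_eq_four, h.2.2.1])).1 hinj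
    exact this
  have hp : p ≠ 0 := fun h0 => mul_ne_zero hj hj (by rw [hjj, h0, map_zero])
  have hq : q ≠ 0 := fun h0 => mul_ne_zero hk hk (by rw [hkk, h0, map_zero])
  refine ⟨p, q, AlgEquiv.ofBijective B.liftHom hbij, hp, hq, fun x => ?_, fun x => ?_⟩
  · rw [AlgEquiv.coe_ofBijective, hB, hB]
    simp only [star_add, star_smul_of_isTypeII h hpos, star_one, star_mul, hjs, hks, mul_neg, hkj,
      neg_neg, smul_neg, neg_smul]
  · rw [AlgEquiv.coe_ofBijective, hB]
    have t1 : fullTrace F D j = 0 := fullTrace_eq_zero_of_anticommute F D hk hkj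
    have t2 : fullTrace F D k = 0 := fullTrace_eq_zero_of_anticommute F D hj (by
      rw [hkj, neg_neg])
    have t3 : fullTrace F D (j * k) = 0 := fullTrace_eq_zero_of_anticommute F D hj (by
      rw [mul_assoc j k j, hkj, mul_neg, neg_neg])
    have t0 : fullTrace F D 1 = 4 := by
      have := fullTrace_algebraMap F D 1
      rwa [map_one, one_mul, h.2.2.1] at this
    have hred : reducedTrace F D
        (x.re • (1 : D) + x.imI • j + x.imJ • k + x.imK • (j * k)) = (2 : ℚ) • x.re := by
      rw [reducedTrace, LinearMap.smul_apply, degree_of_isTypeII h]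
      simp only [map_add, map_smul, t0, t1, t2, t3, smul_eq_mul,
        Rat.smul_def]
      push_cast
      ring
    rw [reducedTraceRat, LinearMap.comp_apply, LinearMap.restrictScalars_apply, hred, map_smul,
      smul_eq_mul]

open Quaternion in
/-- The real matrix representation of a quaternion algebra at a place. -/
noncomputable def quaternionRep {p q : F} (τ : F →+* ℝ) (hp : τ p < 0) (hq : 0 < τ q) :
    ℍ[F,p,0,q] →+* Matrix (Fin 2) (Fin 2) ℝ where
  -- The first generator goes to √(-p) times a quarter turn, the second to √q times diag(1, -1). The
  -- former is skew and the latter symmetric, as is their product, so † becomes transposition.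
  toFun x := !![τ x.re + τ x.imJ * √(τ q), √(-τ p) * τ x.imI - √(-τ p) * √(τ q) * τ x.imK;
    -(√(-τ p) * τ x.imI) - √(-τ p) * √(τ q) * τ x.imK, τ x.re - τ x.imJ * √(τ q)]
  map_one' := by
    ext i j
    fin_cases i <;> fin_cases j <;> simp
  map_zero' := by
    ext i j
    fin_cases i <;> fin_cases j <;> simp
  map_add' x y := by
    ext i j
    fin_cases i <;> fin_cases j <;> simp <;> ring
  map_mul' x y := by
    have h1 : √(-τ p) ^ 2 = -τ p := Real.sq_sqrt (by linarith)
    have h2 : √(τ q) ^ 2 = τ q := Real.sq_sqrt hq.le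
    ext i j
    fin_cases i <;> fin_cases j <;>
      simp [Matrix.mul_apply, Fin.sum_univ_two] <;> ring_nf <;> simp only [h1, h2] <;> ring

/-- The splitting of a totally indefinite quaternion algebra with a positive involution. -/
theorem exists_splitting_of_isTypeII (h : IsTypeII F D) (hpos : IsPositiveInvolution F D) :
    Nonempty (Splitting (reducedTraceRat F D) 2 (F →ₐ[ℚ] ℂ)) := by
  have := h.1
  have := finiteDimensional_of_isTypeII h
  obtain ⟨p, q, φ, hp, hq, hstar, htr⟩ := exists_quaternion_coordinates h hpos
  -- Positivity of † on the F-line of the first generator says that Tr(-p x²) > 0 for x ≠ 0, so -p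
  -- is totally positive. The line of the second generator gives the same for q.
  have hp' : ∀ s : F →ₐ[ℚ] ℂ, realEmbedding s p < 0 := fun s => by
    have := realEmbedding_pos (neg_ne_zero.2 hp) (fun x => ?_) s
    · rw [map_neg] at this
      linarith
    · rcases eq_or_ne x 0 with rfl | hx
      · simp
      have h1 := hpos (φ ⟨0, x, 0, 0⟩) (by
        rw [Ne, map_eq_zero_iff φ φ.injective]
        intro h0
        exact hx (congrArg QuaternionAlgebra.imI h0))
      rw [hstar, ← map_mul, htr] at h1
      simp only [QuaternionAlgebra.re_mul] at h1
      have h2 : (0 : F) * 0 + p * x * -x + q * 0 * 0 + 0 * q * 0 * 0 - p * q * 0 * 0 = x ^ 2 * -p := by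
        ring
      rw [← h2]
      linarith
  have hq' : ∀ s : F →ₐ[ℚ] ℂ, 0 < realEmbedding s q := fun s => by
    refine realEmbedding_pos hq (fun x => ?_) s
    rcases eq_or_ne x 0 with rfl | hx
    · simp
    have h1 := hpos (φ ⟨0, 0, x, 0⟩) (by
      rw [Ne, map_eq_zero_iff φ φ.injective]
      intro h0
      exact hx (congrArg QuaternionAlgebra.imJ h0))
    rw [hstar, ← map_mul, htr] at h1
    simp only [QuaternionAlgebra.re_mul] at h1
    have h2 : (0 : F) * 0 + p * 0 * -0 + q * x * x + 0 * q * x * 0 - p * q * 0 * 0 = x ^ 2 * q := by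
      ring
    rw [← h2]
    linarith
  refine ⟨{ ρ := fun s => (quaternionRep (realEmbedding s) (hp' s) (hq' s)).comp
              (φ.symm.toRingEquiv : D →+* _)
            ρ_star := fun s a => ?_
            trace_eq := fun a => ?_
            fullTrace_eq := fun a => ?_
            finrank_eq := ?_
            d_pos := two_pos
            card_pos := ?_ }⟩
  · obtain ⟨x, rfl⟩ := φ.surjective a
    rw [hstar]
    ext i j
    fin_cases i <;> fin_cases j <;> simp [quaternionRep]
  · obtain ⟨x, rfl⟩ := φ.surjective a
    rw [htr, Rat.cast_mul, trace_eq_sum_realEmbedding, Rat.cast_ofNat, Finset.mul_sum]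
    refine Finset.sum_congr rfl fun s _ => ?_
    rw [Matrix.trace_fin_two]
    simp [quaternionRep]
    ring
  · rw [fullTrace_eq_degree_mul F D (by rw [degree_of_isTypeII h]; norm_num),
      degree_of_isTypeII h]
  · rw [card_realEmbedding, finrank_rat_of_isTypeII h]
    ring
  · rw [card_realEmbedding]
    exact finrank_pos

/-- The line F j of skew elements meets the symmetric elements in zero and takes up e of the 4e
dimensions. -/
theorem finrank_symmetric_le (h : IsTypeII F D) (hpos : IsPositiveInvolution F D) :
    finrank ℚ (symmetric D) ≤ 3 * finrank ℚ F := by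
  have := finiteDimensional_of_isTypeII h
  have : FiniteDimensional ℚ D := Module.Finite.trans F D
  obtain ⟨j, hj, hjs⟩ := exists_star_eq_neg h
  let f : F × symmetric D →ₗ[ℚ] D :=
    (((LinearMap.toSpanSingleton F D j).restrictScalars ℚ).coprod (symmetric D).subtype)
  have hf : Function.Injective f := by
    rw [injective_iff_map_eq_zero]
    rintro ⟨x, a⟩ h0
    have h1 : x • j + (a : D) = 0 := h0
    have h2 := congrArg star h1
    rw [star_add, star_smul_of_isTypeII h hpos, hjs, mem_symmetric.1 a.2, star_zero,
      smul_neg] at h2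
    have h3 : x • j = 0 := self_eq_neg.1 (add_right_cancel (h1.trans h2.symm))
    rw [h3, zero_add] at h1
    exact Prod.ext ((smul_eq_zero.1 h3).resolve_right hj) (Subtype.ext h1)
  have := LinearMap.finrank_le_finrank_of_injective hf
  rw [finrank_prod, finrank_rat_of_isTypeII h] at this
  omega

end Quaternions

theorem le_mul_rpow_mul_rpow_of_log_le {A X Y c a p q : ℝ} (hc : 0 < c) (hA : 0 < A) (hX : 0 < X)
    (hY : 0 < Y) (h : Real.log c ≤ a * Real.log A + p * Real.log X + q * Real.log Y) :
    c ≤ A ^ a * X ^ p * Y ^ q := by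
  have h1 := Real.rpow_pos_of_pos hA a
  have h2 := Real.rpow_pos_of_pos hX p
  have h3 := Real.rpow_pos_of_pos hY q
  rw [← Real.log_le_log_iff hc (by positivity), Real.log_mul (by positivity) h3.ne',
    Real.log_mul h1.ne' h2.ne', Real.log_rpow hA, Real.log_rpow hX, Real.log_rpow hY]
  exact h

theorem mul_rpow_mul_rpow_mono {A A' X Y p p' q q' : ℝ} (hA : 0 ≤ A) (hA' : A ≤ A') (hX : 1 ≤ X)
    (hY : 1 ≤ Y) (hp : p ≤ p') (hq : q ≤ q') : A * X ^ p * Y ^ q ≤ A' * X ^ p' * Y ^ q' := by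
  have h1 := Real.rpow_le_rpow_of_exponent_le hX hp
  have h2 := Real.rpow_le_rpow_of_exponent_le hY hq
  have h3 : 0 ≤ A' := hA.trans hA'
  have h4 : 0 ≤ X := zero_le_one.trans hX
  have h5 : 0 ≤ Y := zero_le_one.trans hY
  gcongr

/-! ### From logarithmic bounds to the explicit constants, for each type. -/

section Bounds

variable {D : Type v} [DivisionRing D] [CharZero D] [StarRing D]
  {V : Type w} [AddCommGroup V] [Module ℚ V] [Module D V]

section Splitting

variable {T : D →ₗ[ℚ] ℚ} {d : ℕ} {S : Type u} [Fintype S] {α : Type*} [Fintype α] [DecidableEq α]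
  {R : Subalgebra ℤ D} {ψ : V →ₗ[ℚ] V →ₗ[ℚ] D} {L : Submodule ℤ V}

theorem log_spanIndex (σ : Splitting T d S) (r : Basis α ℚ D) (h : IsFormLattice T R ψ L) {m : ℕ}
    (v : Basis (Fin m) D V) (hv : ∀ i, v i ∈ L)
    (hr : Subalgebra.toSubmodule R = Submodule.span ℤ (Set.range r)) :
    2 * Real.log (spanIndex L R v) + Real.log (absDisc T ψ L) =
      Real.log (latticeDisc σ r ψ v) := by
  obtain ⟨h0, h1⟩ := h.spanIndex_sq σ r v hv hr
  have h2 := h.one_le_absDisc σ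
  have h3 : (spanIndex L R v : ℝ) ≠ 0 := by exact_mod_cast h0
  rw [← h1, Real.log_mul (pow_ne_zero 2 h3) (by positivity), Real.log_pow]
  norm_num

theorem one_le_abs_orderDisc (σ : Splitting T d S) (hR : IsOrder R) :
    1 ≤ |(orderDisc R : ℝ)| := by
  have : Submodule.IsLattice ℚ (Subalgebra.toSubmodule R) := hR
  obtain ⟨r, hr⟩ := exists_basis_span_eq (Subalgebra.toSubmodule R) rfl
  rw [abs_orderDisc_eq r σ R hr]
  have h1 := σ.one_le_redDisc R hR r hr
  have h2 : (1 : ℝ) ≤ (d : ℝ) ^ finrank ℚ D := one_le_pow₀ (by exact_mod_cast σ.d_pos)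
  exact one_le_mul_of_one_le_of_one_le h2 h1

theorem orderBound_eq (σ : Splitting T d S) (r : Basis α ℚ D)
    (hr : Subalgebra.toSubmodule R = Submodule.span ℤ (Set.range r)) (m₀ : ℕ) :
    orderBound σ r m₀ = Real.log |(orderDisc R : ℝ)| +
      (finrank ℚ D : ℝ) / 2 * Real.log (d * Fintype.card S * (m₀ : ℝ) ^ 2) := by
  rw [orderBound, abs_orderDisc_eq r σ R hr, Real.log_abs]

end Splitting

variable {F : Type u} [Field F] [NumberField F] [Algebra F D]
  {R : Subalgebra ℤ D} {ψ : V →ₗ[ℚ] V →ₗ[ℚ] D} {L : Submodule ℤ V} {m : ℕ}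

theorem log_normD {d : ℕ} {S : Type u} [Fintype S] (σ : Splitting (reducedTraceRat F D) d S)
    (a : D) : Real.log (normD F D a) = Real.log (σ.normSq a) / 2 := by
  rw [normD, ← σ.normSq_eq, Real.log_sqrt (σ.normSq_nonneg a)]

theorem normD_pos (hpos : IsPositiveInvolution F D) {a : D} (ha : a ≠ 0) : 0 < normD F D a :=
  Real.sqrt_pos.2 (by exact_mod_cast hpos a ha)

/-- Twice the logarithm of the index is the log-discriminant of the span minus log|disc L|, which
turns m/2 into the exponent (m - 2)/4. In the second bound (n/2) log of the squared norm is e times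
the log of the norm; the summand e log(e m²) raises the exponent of e m² by 1, from (m(m+2) - 8)/32
to (m(m+2) + 24)/32. -/
theorem exists_weaklySymplectic_basis (h : IsTypeI F D) (hpos : IsPositiveInvolution F D)
    (hL : IsFormLattice (reducedTraceRat F D) R ψ L) (hR : IsOrder R) (hm : finrank D V = m)
    (hm0 : 0 < m) :
    ∃ b : Basis (Fin m) D V, (∀ i, b i ∈ L) ∧ IsWeaklySymplectic ψ b ∧ spanIndex L R b ≠ 0 ∧
      (spanIndex L R b : ℝ) ≤ indexMult 1 (finrank ℚ F) m * |(orderDisc R : ℝ)| ^ indexR 1 m *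
        |(disc L (traceOfForm F ψ) : ℝ)| ^ indexL 1 m ∧
      ∀ i j, ψ (b i) (b j) ≠ 0 → normD F D (ψ (b i) (b j)) ≤
        psiMult 1 (finrank ℚ F) m * |(orderDisc R : ℝ)| ^ psiR 1 (finrank ℚ F) m *
          |(disc L (traceOfForm F ψ) : ℝ)| ^ psiL 1 (finrank ℚ F) m := by
  have := h.1
  obtain ⟨σ⟩ := exists_splitting_of_isTypeI h hpos
  have hn : finrank ℚ D = finrank ℚ F := by
    rw [σ.finrank_eq, card_realEmbedding, one_mul, mul_one]
  have : Submodule.IsLattice ℚ (Subalgebra.toSubmodule R) := hR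
  obtain ⟨r, hr⟩ := exists_basis_span_eq (Subalgebra.toSubmodule R) hn
  obtain ⟨b, hb, hsymp, hdisc, hval⟩ := exists_symplectic_basis σ r hr
    (σ.one_le_redDisc R hR r hr) (star_eq_self_of_isTypeI h hpos) m V ψ L hL hm le_rfl
  have hidx := log_spanIndex σ r hL b hb hr
  have hidx0 := (hL.spanIndex_sq σ r b hb hr).1
  have hX := hL.one_le_absDisc σ
  have hΔ := one_le_abs_orderDisc σ hR
  have he : (0 : ℝ) < finrank ℚ F := by exact_mod_cast finrank_pos (R := ℚ) (M := F)
  have hmR : (0 : ℝ) < m := by exact_mod_cast hm0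
  rw [orderBound_eq σ r hr, hn, card_realEmbedding, Nat.cast_one, one_mul] at hdisc hval
  change 1 ≤ |(disc L (traceOfForm F ψ) : ℝ)| at hX
  have hA : (0 : ℝ) < finrank ℚ F * (m : ℝ) ^ 2 := by positivity
  refine ⟨b, hb, hsymp, hidx0, ?_, fun i j hij => ?_⟩
  · rw [indexMult, indexR, indexL, if_pos rfl, if_pos rfl, if_pos rfl]
    refine le_mul_rpow_mul_rpow_of_log_le (by exact_mod_cast Nat.pos_of_ne_zero hidx0) hA
      (by positivity) (by positivity) ?_
    change _ ≤ _ + _ + _ * Real.log (absDisc (reducedTraceRat F D) ψ L)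
    linarith
  · rw [psiMult, psiR, psiL, if_pos rfl, if_pos rfl, if_pos rfl]
    refine le_mul_rpow_mul_rpow_of_log_le (normD_pos hpos hij) hA
      (by positivity) (by positivity) ?_
    change _ ≤ _ + _ + _ * Real.log (absDisc (reducedTraceRat F D) ψ L)
    rw [log_normD σ, ← mul_le_mul_iff_right₀ he]
    refine le_of_eq_of_le ?_ ((hval i j hij).trans_eq ?_)
    · ring
    · field_simp
      ring

/-- Substituting E = Q + 2P into (m(m+1)/2) E + m(P + 15/2 Q) gives (m(m+16)/2) Q + m(m+2) P;
halving yields the exponents of |disc R| and of 2 e m² in the index bound. -/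
theorem exists_weaklyUnitary_basis (h : IsTypeII F D) (hpos : IsPositiveInvolution F D)
    (hL : IsFormLattice (reducedTraceRat F D) R ψ L) (hR : IsOrder R) (hm : finrank D V = m)
    (hm0 : 0 < m) :
    ∃ b : Basis (Fin m) D V, (∀ i, b i ∈ L) ∧ IsWeaklyUnitary ψ b ∧ spanIndex L R b ≠ 0 ∧
      (spanIndex L R b : ℝ) ≤ indexMult 2 (finrank ℚ F) m * |(orderDisc R : ℝ)| ^ indexR 2 m *
        |(disc L (traceOfForm F ψ) : ℝ)| ^ indexL 2 m ∧
      ∀ i j, ψ (b i) (b j) ≠ 0 → normD F D (ψ (b i) (b j)) ≤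
        psiMult 2 (finrank ℚ F) m * |(orderDisc R : ℝ)| ^ psiR 2 (finrank ℚ F) m *
          |(disc L (traceOfForm F ψ) : ℝ)| ^ psiL 2 (finrank ℚ F) m := by
  have := h.1
  obtain ⟨σ⟩ := exists_splitting_of_isTypeII h hpos
  have hn := finrank_rat_of_isTypeII h
  have : Submodule.IsLattice ℚ (Subalgebra.toSubmodule R) := hR
  obtain ⟨r, hr⟩ := exists_basis_span_eq (Subalgebra.toSubmodule R) hn
  have hr1 := σ.one_le_redDisc R hR r hr
  obtain ⟨b, hb, huni, hdisc, hval⟩ := exists_unitary_basis σ r hr hr1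
    ((finrank_symmetric_le h hpos).trans_eq (by rw [card_realEmbedding])) rfl rfl rfl m V ψ L hL
    hm le_rfl
  have hidx := log_spanIndex σ r hL b hb hr
  have hidx0 := (hL.spanIndex_sq σ r b hb hr).1
  have hX := hL.one_le_absDisc σ
  have hΔ := one_le_abs_orderDisc σ hR
  have he : (0 : ℝ) < finrank ℚ F := by exact_mod_cast finrank_pos (R := ℚ) (M := F)
  have hmR : (0 : ℝ) < m := by exact_mod_cast hm0
  have hQ : Real.log (redDisc (reducedTraceRat F D) r) + 4 * (finrank ℚ F * Real.log 2) =
      Real.log |(orderDisc R : ℝ)| := by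
    rw [abs_orderDisc_eq r σ R hr, Real.log_mul (by positivity) (by positivity), Real.log_pow, hn]
    push_cast
    ring
  rw [orderBound_eq σ r hr, card_realEmbedding, hQ, hn] at hdisc hval
  push_cast at hdisc hval
  change 1 ≤ |(disc L (traceOfForm F ψ) : ℝ)| at hX
  have hA : (0 : ℝ) < 2 * finrank ℚ F * (m : ℝ) ^ 2 := by positivity
  refine ⟨b, hb, huni, hidx0, ?_, fun i j hij => ?_⟩
  · rw [indexMult, indexR, indexL, if_neg (by norm_num), if_neg (by norm_num),
      if_neg (by norm_num)]
    refine le_mul_rpow_mul_rpow_of_log_le (by exact_mod_cast Nat.pos_of_ne_zero hidx0) hA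
      (by positivity) (by positivity) ?_
    change _ ≤ _ + _ + _ * Real.log (absDisc (reducedTraceRat F D) ψ L)
    linarith
  · obtain rfl : i = j := by
      by_contra hne
      exact hij (huni i j hne)
    rw [psiMult, psiR, psiL, if_neg (by norm_num), if_neg (by norm_num), if_neg (by norm_num)]
    refine le_mul_rpow_mul_rpow_of_log_le (normD_pos hpos hij) hA
      (by positivity) (by positivity) ?_
    change _ ≤ _ + _ + _ * Real.log (absDisc (reducedTraceRat F D) ψ L)
    rw [log_normD σ, ← mul_le_mul_iff_right₀ (by positivity : (0 : ℝ) < 4 * finrank ℚ F)]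
    refine le_of_eq_of_le ?_ ((hval i).trans_eq ?_)
    · ring
    · field_simp
      ring

theorem isTypeI_isTypeII_false (h1 : IsTypeI F D) (h2 : IsTypeII F D) : False := by
  have h3 := (degree_of_isTypeI h1).1
  have h4 := h2.2.2.1
  omega

/-- Evaluation at a nonzero vector of L embeds the stabiliser into L, so it is finitely generated.
It spans D because, for every a, some multiple n a with n a nonzero integer maps a finite generating
set of L into L. -/
theorem isOrder_stab [FiniteDimensional ℚ D] [Nontrivial V] (hL : Submodule.IsLattice ℚ L) :
    IsOrder (stab D L) := by
  obtain ⟨x₀, hx₀⟩ := exists_ne (0 : V)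
  obtain ⟨n, hn, hnx⟩ := exists_smul_mem_of_isLattice L x₀
  have hx : n • x₀ ≠ 0 := by
    rw [← Int.cast_smul_eq_zsmul ℚ]
    exact smul_ne_zero (Int.cast_ne_zero.2 hn) hx₀
  have hfg := hL.fg
  have : Module.Finite ℤ L := Module.Finite.iff_fg.2 hfg
  refine ⟨?_, ?_⟩
  · let f : Subalgebra.toSubmodule (stab D L) →ₗ[ℤ] L :=
      { toFun := fun a => ⟨(a : D) • (n • x₀), a.2 _ hnx⟩
        map_add' := fun a b => Subtype.ext (add_smul _ _ _)
        map_smul' := fun k a => Subtype.ext (smul_assoc k (a : D) (n • x₀)) }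
    have hf : Function.Injective f := fun a b hab =>
      Subtype.ext (smul_left_injective D hx (congrArg Subtype.val hab))
    exact Module.Finite.iff_fg.1 (Module.Finite.of_injective f hf)
  · rw [eq_top_iff]
    rintro a -
    obtain ⟨s, hs⟩ := hfg
    choose k hk hka using fun x : V => exists_smul_mem_of_isLattice L (a • x)
    have hN : (∏ x ∈ s, k x) ≠ 0 := Finset.prod_ne_zero_iff.2 fun x _ => hk x
    have hmem : (∏ x ∈ s, k x) • a ∈ stab D L := by
      intro y hy
      rw [← hs] at hy
      induction hy using Submodule.span_induction with
      | mem y hy =>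
        obtain ⟨c, hc⟩ := Finset.dvd_prod_of_mem k hy
        rw [hc, smul_assoc, mul_comm, mul_smul]
        exact L.smul_mem c (hka y)
      | zero => rw [smul_zero]; exact L.zero_mem
      | add y z _ _ hy hz => rw [smul_add]; exact L.add_mem hy hz
      | smul t y _ hy => rw [smul_comm]; exact L.smul_mem t hy
    have h1 : a = ((∏ x ∈ s, k x : ℤ) : ℚ)⁻¹ • ((∏ x ∈ s, k x) • a) := by
      rw [← Int.cast_smul_eq_zsmul ℚ, smul_smul, inv_mul_cancel₀ (by exact_mod_cast hN), one_smul]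
    rw [h1]
    exact Submodule.smul_mem _ _ (Submodule.subset_span hmem)

theorem indexMult_nonneg (d e m : ℕ) : 0 ≤ indexMult d e m := by
  unfold indexMult
  split_ifs <;> positivity

theorem psiMult_nonneg (d e m : ℕ) : 0 ≤ psiMult d e m := by
  unfold psiMult
  split_ifs <;> positivity

end Bounds

/-! ### Both types together. -/

section Combined

variable {F : Type u} [Field F] [NumberField F]
  {D : Type v} [DivisionRing D] [CharZero D] [Algebra F D] [StarRing D]
  {V : Type w} [AddCommGroup V] [Module ℚ V] [Module D V]
  {R : Subalgebra ℤ D} {ψ : V →ₗ[ℚ] V →ₗ[ℚ] D} {L : Submodule ℤ V} {m d : ℕ}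

/-- Both types at once; in each case the discriminants are at least one in absolute value. -/
theorem exists_basis_bounds (htype : (IsTypeI F D ∧ d = 1) ∨ (IsTypeII F D ∧ d = 2))
    (hpos : IsPositiveInvolution F D) (hL : IsFormLattice (reducedTraceRat F D) R ψ L)
    (hR : IsOrder R) (hm : finrank D V = m) (hm0 : 0 < m) :
    1 ≤ |(orderDisc R : ℝ)| ∧ 1 ≤ |(disc L (traceOfForm F ψ) : ℝ)| ∧
    ∃ b : Basis (Fin m) D V, (∀ i, b i ∈ L) ∧ (IsTypeI F D → IsWeaklySymplectic ψ b) ∧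
      (IsTypeII F D → IsWeaklyUnitary ψ b) ∧ spanIndex L R b ≠ 0 ∧
      (spanIndex L R b : ℝ) ≤ indexMult d (finrank ℚ F) m * |(orderDisc R : ℝ)| ^ indexR d m *
        |(disc L (traceOfForm F ψ) : ℝ)| ^ indexL d m ∧
      ∀ i j, ψ (b i) (b j) ≠ 0 → normD F D (ψ (b i) (b j)) ≤
        psiMult d (finrank ℚ F) m * |(orderDisc R : ℝ)| ^ psiR d (finrank ℚ F) m *
          |(disc L (traceOfForm F ψ) : ℝ)| ^ psiL d (finrank ℚ F) m := by
  rcases htype with ⟨h, rfl⟩ | ⟨h, rfl⟩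
  · obtain ⟨σ⟩ := exists_splitting_of_isTypeI h hpos
    obtain ⟨b, h1, h2, h3⟩ := exists_weaklySymplectic_basis h hpos hL hR hm hm0
    exact ⟨one_le_abs_orderDisc σ hR, hL.one_le_absDisc σ, b, h1, fun _ => h2,
      fun h' => (isTypeI_isTypeII_false h h').elim, h3⟩
  · obtain ⟨σ⟩ := exists_splitting_of_isTypeII h hpos
    obtain ⟨b, h1, h2, h3⟩ := exists_weaklyUnitary_basis h hpos hL hR hm hm0
    exact ⟨one_le_abs_orderDisc σ hR, hL.one_le_absDisc σ, b, h1,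
      fun h' => (isTypeI_isTypeII_false h' h).elim, fun _ => h2, h3⟩

/-- A bound for a function of the type and the degree of `F` which depends on `dim_ℚ D` only. -/
theorem le_add_of_type {n : ℕ} (hn : finrank ℚ D = n)
    (htype : (IsTypeI F D ∧ d = 1) ∨ (IsTypeII F D ∧ d = 2)) {f : ℕ → ℕ → ℝ}
    {g : ℕ → ℕ → ℝ} (hfg : ∀ d e, f d e ≤ g d e) (hg : ∀ d e, 0 ≤ g d e) :
    f d (finrank ℚ F) ≤ g 1 n + g 2 (n / 4) := by
  rcases htype with ⟨h, rfl⟩ | ⟨h, rfl⟩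
  · have h1 : finrank ℚ F = n := by
      rw [← hn, ← finrank_mul_finrank ℚ F D, (degree_of_isTypeI h).1, mul_one]
    rw [h1]
    linarith [hfg 1 n, hg 2 (n / 4)]
  · have h1 : finrank ℚ F = n / 4 := by
      rw [← hn, finrank_rat_of_isTypeII h]
      omega
    rw [h1]
    linarith [hfg 2 (n / 4), hg 1 n]

end Combined

end SkewHermitianLattice

open SkewHermitianLattice in
theorem theorem1p2 :
    (∀ m n : ℕ, 0 < m →
      ∃ C₁ C₂ C₃ C₄ C₅ C₆ : ℝ,
      ∀ (F : Type u) [Field F] [NumberField F]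
        (D : Type v) [DivisionRing D] [CharZero D] [Algebra F D] [StarRing D]
        (V : Type w) [AddCommGroup V] [Module ℚ V] [Module D V]
        (ψ : V →ₗ[ℚ] V →ₗ[ℚ] D) (L : Submodule ℤ V),
        (IsTypeI F D ∨ IsTypeII F D) → IsPositiveInvolution F D →
        Module.finrank ℚ D = n → Module.finrank D V = m →
        IsSkewHermitian ψ → IsNondegenerate ψ →
        Submodule.IsLattice ℚ L →
        (∀ x ∈ L, ∀ y ∈ L, ∃ z : ℤ, reducedTraceRat F D (ψ x y) = z) →
        ∃ b : Module.Basis (Fin m) D V,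
          (∀ i, b i ∈ L) ∧
          (IsTypeI F D → IsWeaklySymplectic ψ b) ∧
          (IsTypeII F D → IsWeaklyUnitary ψ b) ∧
          spanIndex L (stab D L) b ≠ 0 ∧
          (spanIndex L (stab D L) b : ℝ) ≤
            C₁ * |(orderDisc (stab D L) : ℝ)| ^ C₂ * |(disc L (traceOfForm F ψ) : ℝ)| ^ C₃ ∧
          ∀ i j, normD F D (ψ (b i) (b j)) ≤
            C₄ * |(orderDisc (stab D L) : ℝ)| ^ C₅ * |(disc L (traceOfForm F ψ) : ℝ)| ^ C₆) ∧
    (∀ (F : Type u) [Field F] [NumberField F]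
        (D : Type v) [DivisionRing D] [CharZero D] [Algebra F D] [StarRing D]
        (V : Type w) [AddCommGroup V] [Module ℚ V] [Module D V]
        (ψ : V →ₗ[ℚ] V →ₗ[ℚ] D) (L : Submodule ℤ V) (R : Subalgebra ℤ D) (η d e m : ℕ),
        ((IsTypeI F D ∧ d = 1) ∨ (IsTypeII F D ∧ d = 2)) → IsPositiveInvolution F D →
        Module.finrank ℚ F = e → Module.finrank D V = m → 0 < m →
        IsSkewHermitian ψ → IsNondegenerate ψ →
        Submodule.IsLattice ℚ L →
        (∀ x ∈ L, ∀ y ∈ L, ∃ z : ℤ, reducedTraceRat F D (ψ x y) = z) →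
        IsOrder R → R ≤ stab D L → 0 < η → (∀ a ∈ R, (η : D) * star a ∈ R) →
        ∃ b : Module.Basis (Fin m) D V,
          (∀ i, b i ∈ L) ∧
          (IsTypeI F D → IsWeaklySymplectic ψ b) ∧
          (IsTypeII F D → IsWeaklyUnitary ψ b) ∧
          spanIndex L R b ≠ 0 ∧
          (spanIndex L R b : ℝ) ≤
            indexMult d e m * (η : ℝ) ^ indexEta d e m *
              |(orderDisc R : ℝ)| ^ indexR d m *
              |(disc L (traceOfForm F ψ) : ℝ)| ^ indexL d m ∧
          ∀ i j, ψ (b i) (b j) ≠ 0 → normD F D (ψ (b i) (b j)) ≤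
            psiMult d e m * (η : ℝ) ^ psiEta d *
              |(orderDisc R : ℝ)| ^ psiR d e m *
              |(disc L (traceOfForm F ψ) : ℝ)| ^ psiL d e m) := by
  -- e is n for type I and n / 4 for type II, and the sum of the constants of both types dominates
  -- either one. As the discriminants are at least 1, exponents may be increased; absolute values
  -- keep both summands non-negative.
  refine ⟨fun m n hm0 => ⟨indexMult 1 n m + indexMult 2 (n / 4) m,
    |indexR 1 m| + |indexR 2 m|, |indexL 1 m| + |indexL 2 m|,
    psiMult 1 n m + psiMult 2 (n / 4) m, |psiR 1 n m| + |psiR 2 (n / 4) m|,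
    |psiL 1 n m| + |psiL 2 (n / 4) m|, ?_⟩, ?_⟩
  · intro F _ _ D _ _ _ _ V _ _ _ ψ L htype hpos hn hm hψ hnd hL hint
    obtain ⟨d, htype⟩ : ∃ d, (IsTypeI F D ∧ d = 1) ∨ (IsTypeII F D ∧ d = 2) := by
      rcases htype with h | h
      exacts [⟨1, Or.inl ⟨h, rfl⟩⟩, ⟨2, Or.inr ⟨h, rfl⟩⟩]
    have hfin : FiniteDimensional ℚ D := by
      rcases htype with ⟨h, -⟩ | ⟨h, -⟩
      · have : FiniteDimensional F D :=
          FiniteDimensional.of_finrank_pos (by rw [(degree_of_isTypeI h).1]; norm_num)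
        exact Module.Finite.trans F D
      · have := finiteDimensional_of_isTypeII h
        exact Module.Finite.trans F D
    have hV : Nontrivial V := Module.nontrivial_of_finrank_pos (R := D) (by omega)
    have hR : IsOrder (stab D L) := isOrder_stab hL
    have hform : IsFormLattice (reducedTraceRat F D) (stab D L) ψ L :=
      ⟨hψ, hnd, hL, hint, fun a ha x hx => ha x hx⟩
    obtain ⟨hΔ, hX, b, h1, h2, h3, h4, h5, h6⟩ :=
      exists_basis_bounds htype hpos hform hR hm hm0
    refine ⟨b, h1, h2, h3, h4, h5.trans ?_, fun i j => ?_⟩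
    · exact mul_rpow_mul_rpow_mono (indexMult_nonneg _ _ _)
        (le_add_of_type hn htype (fun d e => le_refl (indexMult d e m))
          fun d e => indexMult_nonneg d e m) hΔ hX
        (le_add_of_type hn htype (fun d _ => le_abs_self (indexR d m)) fun _ _ => abs_nonneg _)
        (le_add_of_type hn htype (fun d _ => le_abs_self (indexL d m)) fun _ _ => abs_nonneg _)
    · rcases eq_or_ne (ψ (b i) (b j)) 0 with h0 | h0
      · rw [h0, normD, zero_mul, map_zero, Rat.cast_zero, Real.sqrt_zero]
        have := psiMult_nonneg 1 n m
        have := psiMult_nonneg 2 (n / 4) m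
        positivity
      · exact (h6 i j h0).trans (mul_rpow_mul_rpow_mono (psiMult_nonneg _ _ _)
          (le_add_of_type hn htype (fun d e => le_refl (psiMult d e m))
            fun d e => psiMult_nonneg d e m) hΔ hX
          (le_add_of_type hn htype (fun d e => le_abs_self (psiR d e m)) fun _ _ => abs_nonneg _)
          (le_add_of_type hn htype (fun d e => le_abs_self (psiL d e m)) fun _ _ => abs_nonneg _))
  · intro F _ _ D _ _ _ _ V _ _ _ ψ L R η d e m htype hpos he hm hm0 hψ hnd hL hint hR hRL hη _
    subst he
    have hform : IsFormLattice (reducedTraceRat F D) R ψ L :=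
      ⟨hψ, hnd, hL, hint, fun a ha x hx => hRL ha x hx⟩
    obtain ⟨hΔ, hX, b, h1, h2, h3, h4, h5, h6⟩ :=
      exists_basis_bounds htype hpos hform hR hm hm0
    have hη1 : (1 : ℝ) ≤ η := by exact_mod_cast hη
    -- A power of η with non-negative exponent is at least 1, so this factor only weakens the bound.
    have heta : ∀ {A p : ℝ}, 0 ≤ A → 0 ≤ p → A ≤ A * (η : ℝ) ^ p := fun hA hp =>
      le_mul_of_one_le_right hA (Real.one_le_rpow hη1 hp)
    refine ⟨b, h1, h2, h3, h4, h5.trans ?_, fun i j hij => (h6 i j hij).trans ?_⟩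
    · have h7 : 0 ≤ indexEta d (Module.finrank ℚ F) m := by
        unfold indexEta
        split_ifs <;> positivity
      exact mul_rpow_mul_rpow_mono (indexMult_nonneg _ _ _) (heta (indexMult_nonneg _ _ _) h7)
        hΔ hX le_rfl le_rfl
    · have h7 : 0 ≤ psiEta d := by
        unfold psiEta
        split_ifs <;> positivity
      exact mul_rpow_mul_rpow_mono (psiMult_nonneg _ _ _) (heta (psiMult_nonneg _ _ _) h7)
        hΔ hX le_rfl le_rfl
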